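/- Let $S$ be a closed simplicial surface in $\mathbb R^3$: a finite abstract simplicial complex with vertex set $V$ and edge set $E$ that triangulates a closed surface (every edge lies in exactly two triangles and every vertex link is a cycle), together with a position in $\mathbb R^3$ for each vertex such that every triangle is non-degenerate. The surface may be non-orientable and may intersect itself. For an edge $e=uv$ with adjacent triangles $uva$ and $vub$, let $\beta(e)\in[0,\pi]$ be the external intersection angle of the circumcircles of the two triangles, i.e. the angle, at a common point of the two circles, between their tangent vectors when the circles are oriented in the cyclic orders $u\to v\to a$ and $v\to u\to b$. Define the discrete conformal (Willmore) energy $$W(S)=\sum_{e\in E}\beta(e)-\pi|V|.$$ Then $W(S)\ge 0$. Suppose moreover that $S$ is connected and that its vertices do not all lie in one plane (this holds automatically for a surface that is embedded or immersed). Then $W(S)=0$ if and only if $S$ is a convex polyhedron inscribed in a sphere, that is: all vertices of $S$ lie on a common sphere, their convex hull $P$ has non-empty interior, and $S$ is embedded with image the boundary $\partial P$. (Adjacent triangles of $S$ may be coplanar, so a face of $P$ may be subdivided into several triangles.) -/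

import Mathlib

open scoped Matrix

namespace DiscreteWillmore

/-- Euclidean three-space. -/
abbrev E3 : Type := EuclideanSpace ℝ (Fin 3)

/-! ### Circumcircles and their external intersection angle -/

section Circles

/-- The tangent vector at `p` of the circumcircle of the (non-degenerate) triangle `p q r`, the
circle being oriented so that it is traversed in the cyclic order `p → q → r → p`. With `o` the
centre of the circle and `N = (q - p) × (r - p)` the normal of the oriented triangle, it is the
radius vector `p - o` turned by a right angle about the axis `N`, that is `N × (p - o)`. (Only its
direction matters. For collinear points the value is `0` by convention.) -/
noncomputable def circleTangent (p q r : E3) : E3 :=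
  open Classical in
  if h : AffineIndependent ℝ ![p, q, r] then
    WithLp.toLp 2 (((q - p).ofLp ⨯₃ (r - p).ofLp) ⨯₃
      (p - (⟨![p, q, r], h⟩ : Affine.Simplex ℝ E3 2).circumcenter).ofLp)
  else 0

/-- The external intersection angle, in `[0, π]`, of the circumcircles of the triangles `u v a` and
`v u b` (consistently oriented: they induce opposite orientations on the common edge `u v`): the
angle between the tangent vectors of the oriented circles at their common point `u`. -/
noncomputable def circleAngle (u v a b : E3) : ℝ :=
  InnerProductGeometry.angle (circleTangent u v a) (circleTangent u b v)

theorem inner_circumcenter (p q r : E3) (h : AffineIndependent ℝ ![p, q, r]) (i : Fin 3) :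
    2 * inner ℝ (![p, q, r] i - p)
      (p - (⟨![p, q, r], h⟩ : Affine.Simplex ℝ E3 2).circumcenter) =
      -(‖![p, q, r] i - p‖ ^ 2) := by
  set s : Affine.Simplex ℝ E3 2 := ⟨![p, q, r], h⟩
  have h0 : dist p s.circumcenter = s.circumradius := s.dist_circumcenter_eq_circumradius 0
  have h1 : dist (![p, q, r] i) s.circumcenter = s.circumradius :=
    s.dist_circumcenter_eq_circumradius i
  rw [← h0, dist_eq_norm, dist_eq_norm] at h1
  have h2 : ![p, q, r] i - s.circumcenter = (![p, q, r] i - p) + (p - s.circumcenter) := by abel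
  have h3 := congrArg (fun t => t ^ 2) h1
  simp only [h2, norm_add_sq_real] at h3
  linarith

theorem circleTangent_eq {p q r : E3} (h : AffineIndependent ℝ ![p, q, r]) :
    circleTangent p q r =
      (1 / 2 : ℝ) • (‖r - p‖ ^ 2 • (q - p) - ‖q - p‖ ^ 2 • (r - p)) := by
  have hq := inner_circumcenter p q r h 1
  have hr := inner_circumcenter p q r h 2
  simp only [Matrix.cons_val] at hq hr
  rw [circleTangent, dif_pos h]
  set o := (⟨![p, q, r], h⟩ : Affine.Simplex ℝ E3 2).circumcenter
  have key : WithLp.toLp 2 (((q - p).ofLp ⨯₃ (r - p).ofLp) ⨯₃ (p - o).ofLp) =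
      (inner ℝ (q - p) (p - o) : ℝ) • (r - p) - (inner ℝ (r - p) (p - o) : ℝ) • (q - p) := by
    ext i
    fin_cases i <;>
      simp [cross_apply, PiLp.inner_apply, Fin.sum_univ_three] <;> ring
  have hq' : (inner ℝ (q - p) (p - o) : ℝ) = -(1 / 2) * ‖q - p‖ ^ 2 := by linarith
  have hr' : (inner ℝ (r - p) (p - o) : ℝ) = -(1 / 2) * ‖r - p‖ ^ 2 := by linarith
  rw [key, hq', hr']
  module

theorem affineIndependent_swap {p q r : E3} (h : AffineIndependent ℝ ![p, q, r]) :
    AffineIndependent ℝ ![p, r, q] := by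
  have := h.comp_embedding (Equiv.swap (1 : Fin 3) 2).toEmbedding
  convert this using 1
  ext i j
  fin_cases i <;> rfl

theorem affineIndependent_swap' {p q r : E3} (h : AffineIndependent ℝ ![p, q, r]) :
    AffineIndependent ℝ ![q, p, r] := by
  have := h.comp_embedding (Equiv.swap (0 : Fin 3) 1).toEmbedding
  convert this using 1
  ext i j
  fin_cases i <;> rfl

theorem circleTangent_swap {p q r : E3} (h : AffineIndependent ℝ ![p, q, r]) :
    circleTangent p r q = -circleTangent p q r := by
  rw [circleTangent_eq h, circleTangent_eq (affineIndependent_swap h)]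
  module

/-- Reversing both orientations does not change the angle. -/
theorem circleAngle_swap_apex {u v a b : E3} (ha : AffineIndependent ℝ ![u, v, a])
    (hb : AffineIndependent ℝ ![u, v, b]) : circleAngle u v b a = circleAngle u v a b := by
  rw [circleAngle, circleAngle, circleTangent_swap ha, circleTangent_swap hb,
    InnerProductGeometry.angle_neg_right, InnerProductGeometry.angle_neg_right,
    InnerProductGeometry.angle_comm]

theorem circleTangent_reflect {u v a : E3} (ha : AffineIndependent ℝ ![u, v, a]) :
    (ℝ ∙ (v - u))ᗮ.reflection (circleTangent u v a) = circleTangent v u a := by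
  have hne : v - u ≠ 0 := by
    have := ha.injective.ne (show (1 : Fin 3) ≠ 0 by decide)
    exact sub_ne_zero.2 (by simpa using this)
  have hn : ‖v - u‖ ^ 2 ≠ 0 := by positivity
  rw [Submodule.reflection_orthogonal_apply, Submodule.reflection_singleton_apply,
    circleTangent_eq ha, circleTangent_eq (affineIndependent_swap' ha)]
  have e1 : a - v = (a - u) - (v - u) := by abel
  have e2 : u - v = -(v - u) := by abel
  rw [e1, e2, norm_neg]
  generalize v - u = d at *
  generalize a - u = A at *
  rw [norm_sub_sq_real A d, inner_smul_right, inner_sub_right, inner_smul_right, inner_smul_right,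
    real_inner_self_eq_norm_sq, real_inner_comm d A]
  have hc : ((1 / 2 : ℝ) * (‖A‖ ^ 2 * ‖d‖ ^ 2 - ‖d‖ ^ 2 * inner ℝ A d)) / ((‖d‖ : ℝ) ^ 2) =
      (1 / 2) * (‖A‖ ^ 2 - inner ℝ A d) := by
    field_simp
  simp only [RCLike.ofReal_real_eq_id, id]
  rw [real_inner_comm A d, hc]
  module

/-- The two circles intersect at the same angle at both of their common points. -/
theorem circleAngle_swap_edge {u v a b : E3} (ha : AffineIndependent ℝ ![u, v, a])
    (hb : AffineIndependent ℝ ![u, v, b]) : circleAngle v u a b = circleAngle u v a b := by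
  rw [circleAngle, circleAngle, circleTangent_swap hb,
    circleTangent_swap (affineIndependent_swap' hb), ← circleTangent_reflect ha,
    ← circleTangent_reflect hb, InnerProductGeometry.angle_neg_right,
    InnerProductGeometry.angle_neg_right]
  exact congrArg _ ((ℝ ∙ (v - u))ᗮ.reflection.toLinearIsometry.angle_map _ _)

end Circles

/-! ### Abstract closed surfaces -/

section Surfaces

variable {V : Type*} [DecidableEq V]

/-- The 1-skeleton. -/
def edgeGraph (K : AbstractSimplicialComplex V) : SimpleGraph V where
  Adj u v := u ≠ v ∧ ({u, v} : Finset V) ∈ K.faces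
  symm := ⟨fun u v h => ⟨h.1.symm, by rw [Finset.pair_comm]; exact h.2⟩⟩
  loopless := ⟨fun _ h => h.1 rfl⟩

/-- The apices of the triangles that contain the edge `u v`. -/
def apices (K : AbstractSimplicialComplex V) (u v : V) : Set V :=
  {w | w ≠ u ∧ w ≠ v ∧ ({u, v, w} : Finset V) ∈ K.faces}

/-- The link of the vertex `v` as a graph: its vertices are the neighbours of `v`, its edges are
the pairs `a b` for which `v a b` is a triangle. -/
def linkGraph (K : AbstractSimplicialComplex V) (v : V) :
    SimpleGraph {a : V // (edgeGraph K).Adj v a} where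
  Adj a b := a ≠ b ∧ ({v, a.1, b.1} : Finset V) ∈ K.faces
  symm := ⟨fun a b h => ⟨h.1.symm, by rw [Finset.pair_comm]; exact h.2⟩⟩
  loopless := ⟨fun _ h => h.1 rfl⟩

/-- `K` triangulates a closed surface (a compact 2-manifold without boundary): it has dimension at
most two, every edge lies in exactly two triangles, and every vertex link is connected (in
particular non-empty). By the edge condition links are 2-regular, so every link is a cycle. -/
structure IsClosedSurface (K : AbstractSimplicialComplex V) : Prop where
  card_le_three : ∀ s ∈ K.faces, s.card ≤ 3
  apices_ncard : ∀ u v, (edgeGraph K).Adj u v → (apices K u v).ncard = 2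
  link_connected : ∀ v, (linkGraph K v).Connected

/-! ### Simplicial surfaces in space -/

/-- The vertex positions `x` realize `K` by non-degenerate triangles: the vertices of each face are
affinely independent. (Self-intersections are allowed.) -/
def IsNondegenerate (K : AbstractSimplicialComplex V) (x : V → E3) : Prop :=
  ∀ s ∈ K.faces, AffineIndependent ℝ (fun i : s => x i)

/-- `u v` is the edge `e`, and `a`, `b` are the apices of the two triangles sharing it. -/
def IsEdgeFlap (K : AbstractSimplicialComplex V) (e : Sym2 V) (u v a b : V) : Prop :=
  e = s(u, v) ∧ (edgeGraph K).Adj u v ∧ a ≠ b ∧ a ∈ apices K u v ∧ b ∈ apices K u v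

/-- `β(e)`: the external intersection angle of the circumcircles of the two triangles sharing the
edge `e`. By `edgeAngle_eq` it does not depend on the labelling of the vertices involved. -/
noncomputable def edgeAngle (K : AbstractSimplicialComplex V) (x : V → E3) (e : Sym2 V) : ℝ :=
  open Classical in
  if h : ∃ t : V × V × V × V, IsEdgeFlap K e t.1 t.2.1 t.2.2.1 t.2.2.2 then
    circleAngle (x h.choose.1) (x h.choose.2.1) (x h.choose.2.2.1) (x h.choose.2.2.2)
  else 0

theorem apices_comm (K : AbstractSimplicialComplex V) (u v : V) : apices K u v = apices K v u := by
  ext w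
  simp only [apices, Set.mem_ofPred_eq, Finset.insert_comm u v]
  tauto

theorem IsNondegenerate.affineIndependent {K : AbstractSimplicialComplex V} {x : V → E3}
    (hx : IsNondegenerate K x) {u v a : V} (huv : u ≠ v) (ha : a ∈ apices K u v) :
    AffineIndependent ℝ ![x u, x v, x a] := by
  let f : Fin 3 ↪ ({u, v, a} : Finset V) :=
    ⟨![⟨u, by simp⟩, ⟨v, by simp⟩, ⟨a, by simp⟩], by
      intro i j
      fin_cases i <;> fin_cases j <;> simp [huv, huv.symm, ha.1, ha.2.1, ha.1.symm, ha.2.1.symm]⟩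
  have := (hx _ ha.2.2).comp_embedding f
  convert this using 1
  ext i j
  fin_cases i <;> rfl

theorem edgeAngle_eq {K : AbstractSimplicialComplex V} (hK : IsClosedSurface K) {x : V → E3}
    (hx : IsNondegenerate K x) {e : Sym2 V} {u v a b : V} (h : IsEdgeFlap K e u v a b) :
    edgeAngle K x e = circleAngle (x u) (x v) (x a) (x b) := by
  have hex : ∃ t : V × V × V × V, IsEdgeFlap K e t.1 t.2.1 t.2.2.1 t.2.2.2 := ⟨(u, v, a, b), h⟩
  rw [edgeAngle, dif_pos hex]
  obtain ⟨h1, h2, h3, h4, h5⟩ := hex.choose_spec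
  generalize hex.choose.1 = u' at *
  generalize hex.choose.2.1 = v' at *
  generalize hex.choose.2.2.1 = a' at *
  generalize hex.choose.2.2.2 = b' at *
  obtain ⟨g1, g2, g3, g4, g5⟩ := h
  have hset : apices K u' v' = apices K u v := by
    rw [g1, Sym2.eq_iff] at h1
    rcases h1 with ⟨rfl, rfl⟩ | ⟨rfl, rfl⟩
    · rfl
    · exact apices_comm K _ _
  rw [hset] at h4 h5
  have hA := hx.affineIndependent g2.1 g4
  have hB := hx.affineIndependent g2.1 g5
  have hab : (a' = a ∧ b' = b) ∨ (a' = b ∧ b' = a) := by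
    obtain ⟨p, q, hpq, hs⟩ := Set.ncard_eq_two.1 (hK.apices_ncard u v g2)
    rw [hs] at h4 h5 g4 g5
    simp only [Set.mem_insert_iff, Set.mem_singleton_iff] at h4 h5 g4 g5
    grind
  rw [g1, Sym2.eq_iff] at h1
  rcases h1 with ⟨rfl, rfl⟩ | ⟨rfl, rfl⟩ <;> rcases hab with ⟨rfl, rfl⟩ | ⟨rfl, rfl⟩
  · rfl
  · exact circleAngle_swap_apex hA hB
  · exact circleAngle_swap_edge hA hB
  · exact (circleAngle_swap_edge hB hA).trans (circleAngle_swap_apex hA hB)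

/-- The discrete conformal (Willmore) energy `W(S) = ∑_e β(e) - π |V|`. -/
noncomputable def energy [Fintype V] (K : AbstractSimplicialComplex V) (x : V → E3) : ℝ :=
  open Classical in
  (∑ e ∈ (edgeGraph K).edgeFinset, edgeAngle K x e) - Real.pi * Fintype.card V

/-- The underlying space of `K`, in barycentric coordinates. -/
def space [Fintype V] (K : AbstractSimplicialComplex V) : Set (V → ℝ) :=
  {w | (∀ v, 0 ≤ w v) ∧ ∑ v, w v = 1 ∧ ∃ s ∈ K.faces, ∀ v, v ∉ s → w v = 0}

/-- The map of the underlying space into `ℝ³` that is affine on faces and sends each vertex `v` to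
`x v`. -/
noncomputable def realize [Fintype V] (x : V → E3) (w : V → ℝ) : E3 := ∑ v, w v • x v

/-- The simplicial surface is (the triangulated boundary of) a convex polyhedron inscribed in a
sphere: all vertices lie on one sphere, their convex hull is a convex polyhedron (it has interior
points), and the surface is embedded with the boundary of that polyhedron as its image. -/
structure IsInscribedConvexPolyhedron [Fintype V] (K : AbstractSimplicialComplex V)
    (x : V → E3) : Prop where
  inscribed : ∃ (c : E3) (r : ℝ), ∀ v, x v ∈ Metric.sphere c r
  solid : (interior (convexHull ℝ (Set.range x))).Nonempty
  boundary : Set.BijOn (realize x) (space K) (frontier (convexHull ℝ (Set.range x)))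

end Surfaces

end DiscreteWillmore

/-!
Inverting the neighbours `a i` of a vertex `v` in the unit sphere centred at `v` turns the link of `v`
into a closed polygon (`linkPolygon`). The inversion is conformal and straightens the circumcircles
through `v` into the sides of this polygon, so the angle `β` at the edge `v (a i)` is the exterior
angle (`turn`) of the polygon at its `i`-th vertex. Since every edge has two ends, `2 W(S)` is the
sum over the vertices of the total turning of the inverted link minus `2π`, and the total turning of
a closed polygon is at least `2π` (`two_pi_le_sum_turn`). Hence `W(S) ≥ 0` (`energy_nonneg`), and
`W(S) = 0` makes all inverted links convex plane polygons. The latter is used in the form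
`LinksConvex`: the diagonals through any two alternating pairs of vertices meet.

Assume that the links are convex, and that the surface is connected and does not lie in a plane. The
spheres and planes through the triangles at a proper corner of an inverted link contain the whole
star, and comparing along edges yields one sphere through all vertices (`LinksConvex.exists_sphere`).
By a Morse-type argument a linear function on the surface with a strict local minimum at a vertex
has a global minimum there, because the part of each link below any plane through its vertex is
connected (`LinksConvex.inner_pos_of_forall_adj`). On a sphere this shows that the vertex positions
are distinct and that the planes of all triangles are supporting planes
(`LinksConvex.exists_supporting`). Two edges that cross would lie in one face of the convex hull, and
an extremal crossing contradicts the convexity of the links (`LinksConvex.not_crossing`). These facts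
are collected in `IsFaceted`. They make the surface embedded in the boundary of the convex hull
(`IsFaceted.injOn`). It is the whole boundary, since the cones over its triangles from an interior
point form a closed set which has no boundary point off the lines through the vertices
(`IsFaceted.coneOver_eq_univ`).

Conversely, let the surface be an inscribed convex polyhedron. If the inverted link of `v` were not
convex, then some plane through `v` would separate four neighbours of `v` alternately. In this plane
the convex cone of the polyhedron at `v` would have three different boundary rays, which is
impossible (`false_of_three_supporting`). So the links are convex, and the total turning of a convex
polygon is `2π` (`sum_turn_of_diagonalsMeet`).
-/

namespace DiscreteWillmore

/-! ### Total curvature of closed polygons -/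

section Fenchel

open InnerProductGeometry Finset

variable {E : Type*} [NormedAddCommGroup E] [InnerProductSpace ℝ E]

/-- The exterior angle of the polygon `y` at the vertex `y (i + 1)`. -/
noncomputable def turn (y : ℕ → E) (i : ℕ) : ℝ :=
  angle (y (i + 1) - y i) (y (i + 2) - y (i + 1))

/-- Any four vertices in cyclic order span a quadrilateral whose diagonals meet. For a closed
polygon with `n` vertices this says that the polygon is planar and convex, but it also makes sense
for degenerate polygons. -/
def DiagonalsMeet (y : ℕ → E) (n : ℕ) : Prop :=
  ∀ i j k l, i < j → j < k → k < l → l < n →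
    (segment ℝ (y i) (y k) ∩ segment ℝ (y j) (y l)).Nonempty

theorem angle_add_angle_of_add (s e : E) (hse : s + e ≠ 0) :
    angle s e = angle s (s + e) + angle (s + e) e := by
  apply angle_eq_angle_add_add_angle_add_of_mem_span hse
  rw [Submodule.mem_span_pair]
  exact ⟨1, 1, by simp⟩

/-- Replacing two consecutive edge vectors by their sum does not increase the total angle. Zero
vectors are allowed: they make an angle `π / 2` with every vector by convention. -/
theorem angle_merge_le (a b s e : E) :
    angle a (s + e) + angle (s + e) b ≤ angle a s + angle s e + angle e b := by
  by_cases hs : s = 0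
  · subst hs
    simp only [zero_add, angle_zero_left, angle_zero_right]
    linarith [angle_le_pi a e]
  by_cases he : e = 0
  · subst he
    simp only [add_zero, angle_zero_left, angle_zero_right]
    linarith [angle_le_pi s b]
  by_cases hse : s + e = 0
  · have : e = -s := by rw [← add_eq_zero_iff_eq_neg, add_comm, hse]
    subst this
    rw [hse, angle_self_neg_of_nonzero hs, angle_zero_left, angle_zero_right]
    linarith [angle_nonneg a s, angle_nonneg (-s) b]
  · rw [angle_add_angle_of_add s e hse]
    linarith [angle_le_angle_add_angle a s (s + e), angle_le_angle_add_angle (s + e) e b]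

/-- Replacing a path of the polygon by its chord does not increase the total angle. -/
theorem angle_chord_le (y : ℕ → E) (a b : E) {p q : ℕ} (hpq : p < q) :
    angle a (y q - y p) + angle (y q - y p) b ≤
      angle a (y (p + 1) - y p) + ∑ m ∈ Ico p (q - 1), turn y m +
        angle (y q - y (q - 1)) b := by
  induction q, hpq using Nat.le_induction generalizing b with
  | base => simp
  | succ q hq ih =>
    have h1 := ih (y (q + 1) - y q)
    have h2 := angle_merge_le a b (y q - y p) (y (q + 1) - y q)
    have h3 : y q - y p + (y (q + 1) - y q) = y (q + 1) - y p := by abel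
    rw [h3] at h2
    have h4 : angle (y q - y (q - 1)) (y (q + 1) - y q) = turn y (q - 1) := by
      rw [turn, show q - 1 + 1 = q by omega, show q - 1 + 2 = q + 1 by omega]
    have h5 : ∑ m ∈ Ico p (q + 1 - 1), turn y m =
        ∑ m ∈ Ico p (q - 1), turn y m + turn y (q - 1) := by
      rw [← Finset.sum_Ico_succ_top (by omega)]
      congr 2; omega
    rw [h5, Nat.add_sub_cancel]
    linarith

/-- Fenchel's theorem for closed polygons: the total curvature is at least `2 π`. -/
theorem two_pi_le_sum_turn (y : ℕ → E) {n : ℕ} (hn : 2 ≤ n) (hper : ∀ i, y (i + n) = y i)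
    (hne : y 1 ≠ y 0) : 2 * Real.pi ≤ ∑ i ∈ range n, turn y i := by
  have h := angle_chord_le y (y 1 - y 0) (y 1 - y 0) (p := 1) (q := n) (by omega)
  have h0 : y n = y 0 := by simpa using hper 0
  have h1 : y (n + 1) = y 1 := by simpa [add_comm] using hper 1
  have hne' : y 1 - y 0 ≠ 0 := sub_ne_zero.2 hne
  rw [h0, ← neg_sub (y 1) (y 0), angle_self_neg_of_nonzero hne',
    angle_neg_self_of_nonzero hne'] at h
  have e1 : angle (-(y 1 - y 0) + (y 1 - y (n - 1))) (y 1 - y 0) = turn y (n - 1) := by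
    rw [turn, show n - 1 + 1 = n by omega, show n - 1 + 2 = n + 1 by omega, h0, h1]
    congr 1; abel
  have e2 : ∑ i ∈ range n, turn y i =
      turn y 0 + ∑ i ∈ Ico 1 (n - 1), turn y i + turn y (n - 1) := by
    obtain ⟨m, rfl⟩ : ∃ m, n = m + 2 := ⟨n - 2, by omega⟩
    rw [Finset.range_eq_Ico, Finset.sum_eq_sum_Ico_succ_bot (by omega),
      Finset.sum_Ico_succ_top (by omega), add_assoc]
    simp
  rw [e2]
  have e3 : turn y 0 = angle (y 1 - y 0) (y (1 + 1) - y 1) := rfl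
  rw [show y 0 - y (n - 1) = -(y 1 - y 0) + (y 1 - y (n - 1)) by abel, e1] at h
  linarith

/-- A closed quadrilateral of total curvature `2 π` has no plane that separates one pair of opposite
vertices from the other pair. -/
theorem quadrilateral_not_alternating {A B C D : E}
    (h : angle (B - A) (C - B) + angle (C - B) (D - C) + angle (D - C) (A - D) +
      angle (A - D) (B - A) ≤ 2 * Real.pi) (L : E →L[ℝ] ℝ) (t : ℝ)
    (hA : L A < t) (hC : L C < t) (hB : t < L B) (hD : t < L D) : False := by
  have key : ∀ X, L X < t → angle (B - X) (D - X) ≠ Real.pi := by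
    intro X hX hpi
    obtain ⟨-, r, hr, hrX⟩ := angle_eq_pi_iff.1 hpi
    have := congrArg L hrX
    simp only [map_sub, map_smul, smul_eq_mul] at this
    nlinarith
  have hBA : B - A ≠ 0 := fun h0 => by
    have := congrArg L h0; simp only [map_sub, map_zero] at this; linarith
  have hDA : D - A ≠ 0 := fun h0 => by
    have := congrArg L h0; simp only [map_sub, map_zero] at this; linarith
  by_cases hAC : C = A
  · subst hAC
    refine key C hC (le_antisymm (angle_le_pi _ _) ?_)
    rw [← neg_sub B C, ← neg_sub D C, angle_self_neg_of_nonzero hBA, angle_neg_left,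
      angle_self_neg_of_nonzero hDA, angle_neg_left, angle_comm (D - C)] at h
    linarith
  · have hCA : C - A ≠ 0 := sub_ne_zero.2 hAC
    have tri : ∀ X, X - A ≠ 0 →
        angle (X - A) (C - A) + angle (A - X) (C - X) + angle (A - C) (X - C) = Real.pi := by
      intro X hX
      have := angle_add_angle_sub_add_angle_sub_eq_pi (X - A) hCA
      rw [sub_sub_sub_cancel_right, sub_sub_sub_cancel_right, ← angle_neg_neg (X - A) (X - C),
        ← angle_neg_neg (C - A) (C - X)] at this
      simp only [neg_sub] at this
      linarith
    have tB := tri B hBA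
    have tD := tri D hDA
    have i1 := angle_le_angle_add_angle (B - A) (C - A) (D - A)
    have i2 := angle_le_angle_add_angle (B - C) (A - C) (D - C)
    have x1 : angle (B - A) (C - B) = Real.pi - angle (A - B) (C - B) := by
      rw [← neg_sub A B, angle_neg_left]
    have x2 : angle (C - B) (D - C) = Real.pi - angle (B - C) (D - C) := by
      rw [← neg_sub B C, angle_neg_left]
    have x3 : angle (D - C) (A - D) = Real.pi - angle (A - D) (C - D) := by
      rw [← neg_sub C D, angle_neg_left, angle_comm]
    have x4 : angle (A - D) (B - A) = Real.pi - angle (B - A) (D - A) := by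
      rw [← neg_sub D A, angle_neg_left, angle_comm]
    rw [angle_comm (D - A)] at tD
    rw [angle_comm (A - C) (B - C)] at tB
    have j1 : angle (B - A) (D - A) = angle (B - A) (C - A) + angle (C - A) (D - A) := by linarith
    have j2 : angle (B - C) (D - C) = angle (B - C) (A - C) + angle (A - C) (D - C) := by linarith
    rw [angle_eq_angle_add_angle_iff hCA] at j1
    rw [angle_eq_angle_add_angle_iff (by rwa [← neg_sub, neg_ne_zero])] at j2
    have j1 := j1.resolve_left (key A hA)
    have j2 := j2.resolve_left (key C hC)
    rw [Submodule.mem_span_pair] at j1 j2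
    obtain ⟨α, β, h1⟩ := j1
    obtain ⟨γ, δ, h2⟩ := j2
    have h1' : (α : ℝ) • (B - A) + (β : ℝ) • (D - A) = C - A := h1
    have h2' : (γ : ℝ) • (B - C) + (δ : ℝ) • (D - C) = A - C := h2
    have l1 := congrArg L h1'
    have l2 := congrArg L h2'
    simp only [map_add, map_sub, map_smul, smul_eq_mul] at l1 l2
    have := mul_nonneg α.2 (show 0 ≤ L B - L A by linarith)
    have := mul_nonneg β.2 (show 0 ≤ L D - L A by linarith)
    have := mul_nonneg γ.2 (show 0 ≤ L B - L C by linarith)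
    have := mul_nonneg δ.2 (show 0 ≤ L D - L C by linarith)
    simp only [NNReal.val_eq_coe] at *
    have hα : (α : ℝ) * (L B - L A) = 0 := by linarith
    have hβ : (β : ℝ) * (L D - L A) = 0 := by linarith
    have hα := (mul_eq_zero.1 hα).resolve_right (by linarith)
    have hβ := (mul_eq_zero.1 hβ).resolve_right (by linarith)
    rw [hα, hβ] at h1'
    exact hCA (by rw [← h1']; simp)

theorem segment_inter_nonempty_of_not_alternating {A B C D : E}
    (h : ∀ (L : E →L[ℝ] ℝ) (t : ℝ), L A < t → L C < t → t < L B → t < L D → False) :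
    (segment ℝ A C ∩ segment ℝ B D).Nonempty := by
  by_contra hcon
  have hdisj : Disjoint (segment ℝ A C) (segment ℝ B D) := by
    rwa [Set.disjoint_iff_inter_eq_empty, ← Set.not_nonempty_iff_eq_empty]
  have hc : ∀ X Y : E, IsCompact (segment ℝ X Y) := by
    intro X Y
    rw [segment_eq_image]
    exact isCompact_Icc.image (by fun_prop)
  obtain ⟨f, u, v, hu, huv, hv⟩ := geometric_hahn_banach_compact_closed (convex_segment A C)
    (hc A C) (convex_segment B D) (hc B D).isClosed hdisj
  exact h f u (hu _ (left_mem_segment ℝ A C)) (hu _ (right_mem_segment ℝ A C))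
    (huv.trans (hv _ (left_mem_segment ℝ B D))) (huv.trans (hv _ (right_mem_segment ℝ B D)))

theorem sum_turn_shift (y : ℕ → E) {n : ℕ} (hper : ∀ i, y (i + n) = y i) (p : ℕ) :
    ∑ i ∈ range n, turn (fun m => y (p + m)) i = ∑ i ∈ range n, turn y i := by
  have hp : Function.Periodic (turn y) n := by
    intro i
    simp only [turn]
    rw [show i + n + 1 = i + 1 + n by omega, show i + n + 2 = i + 2 + n by omega, hper, hper, hper]
  have h1 : ∀ i, turn (fun m => y (p + m)) i = turn y (p + i) := fun i => by
    simp only [turn, add_assoc]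
  simp only [h1]
  induction p with
  | zero => simp
  | succ p ih =>
    rw [← ih (by intro i; simp only [turn, add_assoc])]
    have := Finset.sum_range_succ' (fun i => turn y (p + i)) n
    rw [Finset.sum_range_succ] at this
    have h2 : turn y (p + n) = turn y (p + 0) := hp p
    simp only [h2] at this
    rw [add_right_cancel_iff] at this
    rw [this]
    exact Finset.sum_congr rfl fun i _ => by congr 1; omega

/-- The case of equality in Fenchel's theorem. -/
theorem diagonalsMeet_of_sum_turn_le (y : ℕ → E) {n : ℕ} (hper : ∀ i, y (i + n) = y i)
    (h : ∑ i ∈ range n, turn y i ≤ 2 * Real.pi) : DiagonalsMeet y n := by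
  suffices H : ∀ z : ℕ → E, (∀ i, z (i + n) = z i) → ∑ i ∈ range n, turn z i ≤ 2 * Real.pi →
      ∀ j k l, 0 < j → j < k → k < l → l < n →
        (segment ℝ (z 0) (z k) ∩ segment ℝ (z j) (z l)).Nonempty by
    intro i j k l hij hjk hkl hln
    have := H (fun m => y (i + m)) (fun m => by rw [← add_assoc, hper])
      (by rwa [sum_turn_shift y hper]) (j - i) (k - i) (l - i) (by omega) (by omega) (by omega)
      (by omega)
    simpa [show i + (j - i) = j by omega, show i + (k - i) = k by omega,
      show i + (l - i) = l by omega] using this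
  intro z hz hs j k l h0j hjk hkl hln
  apply segment_inter_nonempty_of_not_alternating
  refine quadrilateral_not_alternating ?_
  have hzn : z n = z 0 := by simpa using hz 0
  have hzn1 : z (n + 1) = z 1 := by simpa [add_comm] using hz 1
  have ht : ∀ m, 0 < m → turn z (m - 1) = angle (z m - z (m - 1)) (z (m + 1) - z m) := by
    intro m hm
    rw [turn, show m - 1 + 1 = m by omega, show m - 1 + 2 = m + 1 by omega]
  have split : ∀ p q, p < q →
      ∑ m ∈ Ico p q, turn z m = ∑ m ∈ Ico p (q - 1), turn z m + turn z (q - 1) := by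
    intro p q hpq
    rw [← Finset.sum_Ico_succ_top (by omega), show q - 1 + 1 = q by omega]
  have tot : ∑ i ∈ range n, turn z i = ∑ m ∈ Ico 0 j, turn z m + ∑ m ∈ Ico j k, turn z m +
      ∑ m ∈ Ico k l, turn z m + ∑ m ∈ Ico l n, turn z m := by
    rw [Finset.sum_Ico_consecutive _ (by omega) (by omega),
      Finset.sum_Ico_consecutive _ (by omega) (by omega),
      Finset.sum_Ico_consecutive _ (by omega) (by omega), Finset.range_eq_Ico]
  rw [split 0 j h0j, split j k hjk, split k l hkl, split l n hln, ht j h0j, ht k (by omega),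
    ht l (by omega), ht n (by omega), hzn, hzn1] at tot
  have p1 := angle_chord_le z (z 0 - z (n - 1)) (z (j + 1) - z j) h0j
  have p2 := angle_chord_le z (z j - z 0) (z (k + 1) - z k) hjk
  have p3 := angle_chord_le z (z k - z j) (z (l + 1) - z l) hkl
  have p4 := angle_chord_le z (z l - z k) (z j - z 0) hln
  rw [hzn] at p4
  simp only [zero_add] at p1
  linarith

/-- The diagonals of a quadrilateral `A B C D` meeting, the angle at `A` is the sum of the two
angles into which it is divided by the diagonal. -/
theorem angle_eq_add_of_segment_inter {A B C D : E} (hAB : A ≠ B) (hAC : A ≠ C) (hAD : A ≠ D)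
    (h : (segment ℝ A C ∩ segment ℝ B D).Nonempty) :
    angle (B - A) (D - A) = angle (B - A) (C - A) + angle (C - A) (D - A) := by
  obtain ⟨z, ⟨a, b, ha, hb, hab, rfl⟩, c, d, hc, hd, hcd, hz⟩ := h
  have e : c • (B - A) + d • (D - A) = b • (C - A) := by
    have e1 : c • (B - A) + d • (D - A) = (c • B + d • D) - (c + d) • A := by module
    have e2 : b • (C - A) = (a • A + b • C) - (a + b) • A := by module
    rw [e1, e2, hz, hab, hcd]
  rw [angle_eq_angle_add_angle_iff (sub_ne_zero.2 hAC.symm)]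
  rcases hb.eq_or_lt with rfl | hb
  · left
    rw [zero_smul] at e
    have hd0 : d ≠ 0 := by
      rintro rfl
      rw [show c = 1 by linarith] at e
      simp only [one_smul, zero_smul, add_zero] at e
      exact hAB (sub_eq_zero.1 e).symm
    have hc0 : c ≠ 0 := by
      rintro rfl
      rw [show d = 1 by linarith] at e
      simp only [one_smul, zero_smul, zero_add] at e
      exact hAD (sub_eq_zero.1 e).symm
    rw [angle_eq_pi_iff]
    refine ⟨sub_ne_zero.2 hAB.symm, -(c / d), ?_, ?_⟩
    · have : 0 < c / d := div_pos (hc.lt_of_ne' hc0) (hd.lt_of_ne' hd0)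
      linarith
    · have : d • (D - A) = -(c • (B - A)) := by rw [← add_eq_zero_iff_eq_neg, add_comm, e]
      rw [neg_smul, div_eq_inv_mul, mul_smul, ← smul_neg, ← this, smul_smul, inv_mul_cancel₀ hd0,
        one_smul]
  · right
    rw [Submodule.mem_span_pair]
    refine ⟨⟨c / b, by positivity⟩, ⟨d / b, by positivity⟩, ?_⟩
    change (c / b) • (B - A) + (d / b) • (D - A) = C - A
    rw [div_eq_inv_mul, div_eq_inv_mul, mul_smul, mul_smul, ← smul_add, e, smul_smul,
      inv_mul_cancel₀ hb.ne', one_smul]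

/-- A closed polygon with distinct vertices whose diagonals meet has total curvature `2 π`. The
polygons `y 0, …, y j` all have the same total curvature, as cutting off the triangle
`y 0, y j, y (j + 1)` does not change it. -/
theorem sum_turn_of_diagonalsMeet (y : ℕ → E) {n : ℕ} (hn : 3 ≤ n) (hper : ∀ i, y (i + n) = y i)
    (hinj : Set.InjOn y (Set.Iio n)) (h : DiagonalsMeet y n) :
    ∑ i ∈ range n, turn y i = 2 * Real.pi := by
  have hne : ∀ i j, i < n → j < n → i ≠ j → y i ≠ y j := fun i j hi hj hij he =>
    hij (hinj hi hj he)
  have hnz : ∀ i j, i < n → j < n → i ≠ j → y i - y j ≠ 0 := fun i j hi hj hij =>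
    sub_ne_zero.2 (hne i j hi hj hij)
  have key : ∀ j, 1 ≤ j → j < n → ∑ m ∈ range (j - 1), turn y m +
      angle (y j - y (j - 1)) (y 0 - y j) + angle (y 0 - y j) (y 1 - y 0) = 2 * Real.pi := by
    intro j hj
    induction j, hj using Nat.le_induction with
    | base =>
      intro _
      have h10 := hnz 1 0 (by omega) (by omega) (by omega)
      rw [← neg_sub (y 1) (y 0)]
      simp only [Nat.sub_self, range_zero, sum_empty]
      rw [angle_self_neg_of_nonzero h10, angle_neg_self_of_nonzero h10]
      ring
    | succ j hj ih =>
      intro hjn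
      have ih := ih (by omega)
      have e0 : ∑ m ∈ range (j + 1 - 1), turn y m =
          ∑ m ∈ range (j - 1), turn y m +
            angle (y j - y (j - 1)) (y (j + 1) - y j) := by
        rw [show j + 1 - 1 = (j - 1) + 1 by omega, Finset.sum_range_succ, turn,
          show j - 1 + 1 = j by omega, show j - 1 + 2 = j + 1 by omega]
      rw [e0, Nat.add_sub_cancel]
      have hj0 := hnz j 0 (by omega) (by omega) (by omega)
      have hj10 := hnz (j + 1) 0 (by omega) (by omega) (by omega)
      -- the angle sum of the triangle `y 0, y j, y (j + 1)`
      have tri := angle_add_angle_sub_add_angle_sub_eq_pi (y j - y 0) hj10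
      rw [sub_sub_sub_cancel_right, sub_sub_sub_cancel_right] at tri
      -- the diagonal from `y j` to `y 0` divides the angle at `y j`
      have a1 : angle (y (j - 1) - y j) (y (j + 1) - y j) =
          angle (y (j - 1) - y j) (y 0 - y j) + angle (y 0 - y j) (y (j + 1) - y j) := by
        rcases hj.eq_or_lt with rfl | hj1
        · simp only [Nat.sub_self]
          rw [angle_self (hnz 0 1 (by omega) (by omega) (by omega)), zero_add]
        · apply angle_eq_add_of_segment_inter (hne _ _ (by omega) (by omega) (by omega))
            (hne _ _ (by omega) (by omega) (by omega)) (hne _ _ (by omega) (by omega) (by omega))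
          rw [segment_symm]
          exact h 0 (j - 1) j (j + 1) (by omega) (by omega) (by omega) (by omega)
      -- the diagonal from `y 0` to `y j` divides the angle at `y 0`
      have a2 : angle (y 1 - y 0) (y (j + 1) - y 0) =
          angle (y 1 - y 0) (y j - y 0) + angle (y j - y 0) (y (j + 1) - y 0) := by
        rcases hj.eq_or_lt with rfl | hj1
        · rw [angle_self hj0, zero_add]
        · apply angle_eq_add_of_segment_inter (hne _ _ (by omega) (by omega) (by omega))
            (hne _ _ (by omega) (by omega) (by omega)) (hne _ _ (by omega) (by omega) (by omega))
          exact h 0 1 j (j + 1) (by omega) (by omega) (by omega) (by omega)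
      rw [← neg_sub (y j) (y (j - 1)), angle_neg_left, angle_neg_left] at a1
      rw [← neg_sub (y j) (y 0), angle_neg_right, angle_neg_left, angle_comm (y j - y 0)] at ih
      rw [← neg_sub (y j) (y 0), angle_neg_right, angle_neg_left] at a1
      rw [← neg_sub (y (j + 1)) (y 0), angle_neg_right, angle_neg_left,
        angle_comm (y (j + 1) - y 0) (y 1 - y 0)]
      rw [angle_comm (y (j + 1) - y 0) (y (j + 1) - y j)] at tri
      rw [← neg_sub (y (j + 1)) (y j), angle_neg_right] at tri
      linarith
  have hk := key (n - 1) (by omega) (by omega)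
  have h0 : y n = y 0 := by simpa using hper 0
  have h1 : y (n + 1) = y 1 := by simpa [add_comm] using hper 1
  obtain ⟨m, rfl⟩ : ∃ m, n = m + 2 := ⟨n - 2, by omega⟩
  rw [Finset.sum_range_succ, Finset.sum_range_succ, ← hk]
  simp only [turn]
  rw [h0, h1]
  rfl

end Fenchel

/-! ### Vertex links as cycles -/

section Links

theorem mem_faces_of_subset {V : Type*} {K : AbstractSimplicialComplex V} {s t : Finset V}
    (hs : s ∈ K.faces) (hts : t ⊆ s) (ht : t.Nonempty) : t ∈ K.faces :=
  (K.isRelLowerSet_faces hs).2 hts ht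

variable {V : Type*} [DecidableEq V]

/-- `u v w` is a triangle of the complex `K`. -/
def IsTriangle (K : AbstractSimplicialComplex V) (u v w : V) : Prop :=
  u ≠ v ∧ u ≠ w ∧ v ≠ w ∧ ({u, v, w} : Finset V) ∈ K.faces

namespace IsTriangle

variable {K : AbstractSimplicialComplex V} {u v w : V}

theorem rotate (h : IsTriangle K u v w) : IsTriangle K v w u :=
  ⟨h.2.2.1, h.1.symm, h.2.1.symm, by
    rw [show ({v, w, u} : Finset V) = {u, v, w} by ext; simp; tauto]; exact h.2.2.2⟩

theorem swap (h : IsTriangle K u v w) : IsTriangle K v u w :=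
  ⟨h.1.symm, h.2.2.1, h.2.1, by rw [Finset.insert_comm]; exact h.2.2.2⟩

theorem adj (h : IsTriangle K u v w) : (edgeGraph K).Adj u v :=
  ⟨h.1, mem_faces_of_subset h.2.2.2 (by intro; simp; tauto) (by simp)⟩

theorem mem_apices (h : IsTriangle K u v w) : w ∈ apices K u v :=
  ⟨h.2.1.symm, h.2.2.1.symm, h.2.2.2⟩

end IsTriangle

/-- The sequence `a`, of period `n`, runs once around the link of the vertex `v`. -/
structure IsLinkCycle (K : AbstractSimplicialComplex V) (v : V) (n : ℕ) (a : ℕ → V) : Prop where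
  three_le : 3 ≤ n
  periodic : ∀ i, a (i + n) = a i
  injOn : Set.InjOn a (Set.Iio n)
  adj_iff : ∀ u, (edgeGraph K).Adj v u ↔ ∃ i < n, a i = u
  isTriangle : ∀ i, IsTriangle K v (a i) (a (i + 1))
  apices_eq : ∀ i, apices K v (a (i + 1)) = {a i, a (i + 2)}

namespace IsLinkCycle

variable {K : AbstractSimplicialComplex V} {v : V} {n : ℕ} {a : ℕ → V}

theorem adj (h : IsLinkCycle K v n a) (i : ℕ) : (edgeGraph K).Adj v (a i) :=
  (h.isTriangle i).adj

theorem ne_succ_succ (h : IsLinkCycle K v n a) (i : ℕ) : a i ≠ a (i + 2) := by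
  have hn := h.three_le
  have hm : ∀ j, a j = a (j % n) := fun j => by
    have hp : Function.Periodic a n := h.periodic
    exact (hp.map_mod_nat j).symm
  rw [hm i, hm (i + 2)]
  intro he
  have := h.injOn (Nat.mod_lt _ (by omega)) (Nat.mod_lt _ (by omega)) he
  have h2 : (i + 0) ≡ (i + 2) [MOD n] := this
  have h3 := (Nat.ModEq.add_left_cancel' i h2)
  have h4 := (Nat.modEq_iff_dvd' (by omega)).1 h3
  have := Nat.le_of_dvd (by omega) h4
  omega

/-- The enumeration may start at any vertex of the link. -/
theorem shift (h : IsLinkCycle K v n a) (p : ℕ) : IsLinkCycle K v n (fun i => a (p + i)) := by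
  have hn := h.three_le
  have hp : Function.Periodic a n := h.periodic
  have hmod : ∀ i j, a i = a j → i ≡ j [MOD n] := by
    intro i j hij
    rw [← hp.map_mod_nat i, ← hp.map_mod_nat j] at hij
    exact h.injOn (Nat.mod_lt _ (by omega)) (Nat.mod_lt _ (by omega)) hij
  refine ⟨h.three_le, fun i => by rw [← add_assoc, h.periodic], ?_, ?_,
    fun i => h.isTriangle (p + i), fun i => h.apices_eq (p + i)⟩
  · intro i hi j hj hij
    have := Nat.ModEq.add_left_cancel' p (hmod _ _ hij)
    rwa [Nat.ModEq, Nat.mod_eq_of_lt hi, Nat.mod_eq_of_lt hj] at this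
  · intro u
    constructor
    · intro hu
      obtain ⟨i, hi, rfl⟩ := (h.adj_iff u).1 hu
      refine ⟨(i + (n - p % n)) % n, Nat.mod_lt _ (by omega), ?_⟩
      rw [← hp.map_mod_nat, ← hp.map_mod_nat i]
      congr 1
      have hpn := Nat.mod_lt p (show 0 < n by omega)
      have h1 : p + (i + (n - p % n)) % n ≡ p + (i + (n - p % n)) [MOD n] :=
        Nat.ModEq.add_left p (Nat.mod_modEq _ _)
      have h2 : p + (i + (n - p % n)) ≡ p % n + (i + (n - p % n)) [MOD n] :=
        Nat.ModEq.add_right _ (Nat.mod_modEq _ _).symm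
      have h3 : p % n + (i + (n - p % n)) = i + n := by omega
      rw [h3] at h2
      exact (h1.trans h2).trans (by simp [Nat.ModEq])
    · rintro ⟨i, -, rfl⟩
      exact h.adj _

theorem exists_shift (h : IsLinkCycle K v n a) {u : V} (hu : (edgeGraph K).Adj v u) :
    ∃ b, IsLinkCycle K v n b ∧ b 0 = u := by
  obtain ⟨i, -, rfl⟩ := (h.adj_iff u).1 hu
  exact ⟨_, h.shift i, rfl⟩

theorem apices_last (h : IsLinkCycle K v n a) : apices K v (a 0) = {a (n - 1), a 1} := by
  have hn := h.three_le
  have := h.apices_eq (n - 1)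
  have h0 : a n = a 0 := by simpa using h.periodic 0
  have h1 : a (n + 1) = a 1 := by simpa [add_comm] using h.periodic 1
  rwa [show n - 1 + 1 = n by omega, show n - 1 + 2 = n + 1 by omega, h0, h1] at this

/-- The enumeration may start with any oriented edge of the link. -/
theorem exists_shift_of_isTriangle (h : IsLinkCycle K v n a) {u w : V} (hu : IsTriangle K v u w) :
    ∃ b, IsLinkCycle K v n b ∧ ((b 0 = u ∧ b 1 = w) ∨ (b 0 = w ∧ b 1 = u)) := by
  obtain ⟨b, hb, rfl⟩ := h.exists_shift hu.adj
  have hw := hu.mem_apices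
  rw [hb.apices_last] at hw
  rcases hw with rfl | hw
  · refine ⟨_, hb.shift (n - 1), Or.inr ⟨rfl, ?_⟩⟩
    have hn := hb.three_le
    change b (n - 1 + 1) = b 0
    rw [show n - 1 + 1 = n by omega]
    simpa using hb.periodic 0
  · exact ⟨b, hb, Or.inl ⟨rfl, hw.symm⟩⟩

end IsLinkCycle

/-- In a closed surface, the link of every vertex is a cycle. -/
theorem IsClosedSurface.exists_isLinkCycle [Finite V] {K : AbstractSimplicialComplex V}
    (hK : IsClosedSurface K) (v : V) : ∃ n a, IsLinkCycle K v n a := by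
  classical
  have hnb : ∀ u : {a : V // (edgeGraph K).Adj v a},
      Subtype.val '' ((linkGraph K v).neighborSet u) = apices K v u.1 := by
    intro u
    ext w
    simp only [Set.mem_image, SimpleGraph.mem_neighborSet, Subtype.exists, exists_and_right,
      exists_eq_right, apices, Set.mem_ofPred_eq]
    constructor
    · rintro ⟨hw, hne, hf⟩
      exact ⟨hw.1.symm, fun h => hne (Subtype.ext h.symm), hf⟩
    · rintro ⟨h1, h2, h3⟩
      exact ⟨⟨h1.symm, mem_faces_of_subset h3 (by intro; simp; tauto) (by simp)⟩,
        fun h => h2 (congrArg Subtype.val h).symm, h3⟩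
  have hcard : ∀ u, ((linkGraph K v).neighborSet u).ncard = 2 := by
    intro u
    rw [← Set.ncard_image_of_injective _ Subtype.val_injective, hnb, hK.apices_ncard v u.1 u.2]
  have hcyc : (linkGraph K v).IsCycles := fun u _ => hcard u
  obtain ⟨u⟩ := (hK.link_connected v).nonempty
  obtain ⟨p, hp, hverts⟩ := hcyc.exists_cycle_toSubgraph_verts_eq_connectedComponentSupp
    (v := u) (c := (linkGraph K v).connectedComponentMk u) rfl
    (Set.nonempty_of_ncard_ne_zero (by rw [hcard]; norm_num))
  have hall : ∀ w, w ∈ p.support := by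
    intro w
    rw [← SimpleGraph.Walk.mem_verts_toSubgraph, hverts]
    exact SimpleGraph.ConnectedComponent.sound ((hK.link_connected v).preconnected w u)
  have h3 := hp.three_le_length
  set n := p.length with hn
  set a : ℕ → V := fun i => (p.getVert (i % n)).1 with ha
  have hstep : ∀ i, (linkGraph K v).Adj (p.getVert (i % n)) (p.getVert ((i + 1) % n)) := by
    intro i
    have hi := Nat.mod_lt i (show 0 < n by omega)
    have h1 := p.adj_getVert_succ hi
    rcases Nat.lt_or_ge (i % n + 1) n with hlt | hge
    · rw [Nat.add_mod, Nat.mod_eq_of_lt (show 1 < n by omega), Nat.mod_eq_of_lt hlt]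
      exact h1
    · have he : i % n + 1 = n := by omega
      rw [Nat.add_mod, Nat.mod_eq_of_lt (show 1 < n by omega), he, Nat.mod_self]
      rw [he, hn, SimpleGraph.Walk.getVert_length] at h1
      rwa [SimpleGraph.Walk.getVert_zero]
  have htri : ∀ i, IsTriangle K v (a i) (a (i + 1)) := by
    intro i
    have h := hstep i
    exact ⟨(p.getVert (i % n)).2.1, (p.getVert ((i + 1) % n)).2.1,
      fun he => h.1 (Subtype.ext he), h.2⟩
  have hinj : Set.InjOn a (Set.Iio n) := by
    intro i hi j hj hij
    simp only [ha, Nat.mod_eq_of_lt hi, Nat.mod_eq_of_lt hj] at hij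
    have hi' : i < n := hi
    have hj' : j < n := hj
    exact hp.getVert_injOn' (by simp only [Set.mem_ofPred_eq]; omega)
      (by simp only [Set.mem_ofPred_eq]; omega) (Subtype.ext hij)
  have hper : ∀ i, a (i + n) = a i := fun i => by simp [ha]
  have hne : ∀ i, a i ≠ a (i + 2) := by
    intro i he
    have hl := hinj (Nat.mod_lt i (show 0 < n by omega))
      (Nat.mod_lt (i + 2) (show 0 < n by omega)) (by simpa [ha] using he)
    have h2 : (i + 0) ≡ (i + 2) [MOD n] := hl
    have h4 := (Nat.modEq_iff_dvd' (by omega)).1 (Nat.ModEq.add_left_cancel' i h2)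
    have := Nat.le_of_dvd (by omega) h4
    omega
  refine ⟨n, a, h3, hper, hinj, ?_, htri, ?_⟩
  · intro w
    constructor
    · intro hw
      obtain ⟨i, hi, hil⟩ := SimpleGraph.Walk.mem_support_iff_exists_getVert.1 (hall ⟨w, hw⟩)
      refine ⟨i % n, Nat.mod_lt _ (by omega), ?_⟩
      rcases hil.eq_or_lt with rfl | hil
      · rw [SimpleGraph.Walk.getVert_length] at hi
        simp [ha, ← hn, hi]
      · simp only [ha]
        rw [Nat.mod_mod, Nat.mod_eq_of_lt hil, hi]
    · rintro ⟨i, -, rfl⟩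
      exact (htri i).adj
  · intro i
    have hc := hK.apices_ncard v (a (i + 1)) (htri (i + 1)).adj
    symm
    apply Set.eq_of_subset_of_ncard_le
    · rintro w (rfl | rfl)
      · exact (htri i).swap.rotate.mem_apices
      · exact (htri (i + 1)).mem_apices
    · rw [hc, Set.ncard_pair (hne i)]
    · exact Set.finite_of_ncard_ne_zero (by rw [hc]; norm_num)

end Links

/-! ### The energy as a sum of total curvatures -/

section Energy

/-- The position of `q` relative to `p` after the inversion in the unit sphere around `p`. -/
noncomputable def invVec (p q : E3) : E3 := (‖q - p‖ ^ 2)⁻¹ • (q - p)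

theorem eq_zero_of_affineIndependent {p q r : E3} (h : AffineIndependent ℝ ![p, q, r]) {α β : ℝ}
    (hαβ : α • (q - p) + β • (r - p) = 0) : α = 0 ∧ β = 0 := by
  rw [affineIndependent_iff] at h
  have := h Finset.univ ![-(α + β), α, β] (by simp [Fin.sum_univ_three]) (by
    simp only [Fin.sum_univ_three, Matrix.cons_val]
    rw [← hαβ]
    module)
  exact ⟨by simpa using this 1 (Finset.mem_univ _), by simpa using this 2 (Finset.mem_univ _)⟩

theorem circleTangent_eq_invVec {p q r : E3} (h : AffineIndependent ℝ ![p, q, r]) :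
    circleTangent p q r =
      (1 / 2 * ‖q - p‖ ^ 2 * ‖r - p‖ ^ 2 : ℝ) • (invVec p q - invVec p r) := by
  have hq : ‖q - p‖ ^ 2 ≠ 0 := by
    have := h.injective.ne (show (1 : Fin 3) ≠ 0 by decide)
    have : q - p ≠ 0 := sub_ne_zero.2 (by simpa using this)
    positivity
  have hr : ‖r - p‖ ^ 2 ≠ 0 := by
    have := h.injective.ne (show (2 : Fin 3) ≠ 0 by decide)
    have : r - p ≠ 0 := sub_ne_zero.2 (by simpa using this)
    positivity
  rw [circleTangent_eq h, invVec, invVec]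
  generalize q - p = A at *
  generalize r - p = B at *
  generalize ‖A‖ ^ 2 = s at *
  generalize ‖B‖ ^ 2 = t at *
  rw [smul_sub, smul_sub, smul_smul, smul_smul, smul_smul, smul_smul]
  congr 2 <;> field_simp

/-- The inversion at a common point of two circles turns them into lines. So the intersection angle
of the two circumcircles of adjacent triangles is an exterior angle of the inverted link. -/
theorem circleAngle_eq_angle {u v a b : E3} (ha : AffineIndependent ℝ ![u, v, a])
    (hb : AffineIndependent ℝ ![u, b, v]) :
    circleAngle u v a b =
      InnerProductGeometry.angle (invVec u v - invVec u a) (invVec u b - invVec u v) := by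
  have pos : ∀ {q r : E3}, AffineIndependent ℝ ![u, q, r] →
      0 < (1 / 2 * ‖q - u‖ ^ 2 * ‖r - u‖ ^ 2 : ℝ) := by
    intro q r h
    have h1 := h.injective.ne (show (1 : Fin 3) ≠ 0 by decide)
    have h1 : q - u ≠ 0 := sub_ne_zero.2 (by simpa using h1)
    have h2 := h.injective.ne (show (2 : Fin 3) ≠ 0 by decide)
    have h2 : r - u ≠ 0 := sub_ne_zero.2 (by simpa using h2)
    positivity
  rw [circleAngle, circleTangent_eq_invVec ha, circleTangent_eq_invVec hb,
    InnerProductGeometry.angle_smul_left_of_pos _ _ (pos ha),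
    InnerProductGeometry.angle_smul_right_of_pos _ _ (pos hb)]

variable {V : Type*} [DecidableEq V] {K : AbstractSimplicialComplex V} {x : V → E3}

theorem IsTriangle.affineIndependent {u v w : V} (h : IsTriangle K u v w)
    (hx : IsNondegenerate K x) : AffineIndependent ℝ ![x u, x v, x w] :=
  hx.affineIndependent h.1 h.mem_apices

/-- The vertices of the link of `v`, after the inversion at `v`. -/
noncomputable def linkPolygon (x : V → E3) (v : V) (a : ℕ → V) (i : ℕ) : E3 :=
  invVec (x v) (x (a i))

theorem IsLinkCycle.linkPolygon_periodic {v : V} {n : ℕ} {a : ℕ → V} (h : IsLinkCycle K v n a)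
    (x : V → E3) (i : ℕ) : linkPolygon x v a (i + n) = linkPolygon x v a i := by
  rw [linkPolygon, h.periodic, linkPolygon]

theorem IsLinkCycle.edgeAngle_eq_turn (hK : IsClosedSurface K) (hx : IsNondegenerate K x) {v : V}
    {n : ℕ} {a : ℕ → V} (h : IsLinkCycle K v n a) (i : ℕ) :
    edgeAngle K x s(v, a (i + 1)) = turn (linkPolygon x v a) i := by
  have hap := h.apices_eq i
  have hflap : IsEdgeFlap K s(v, a (i + 1)) v (a (i + 1)) (a i) (a (i + 2)) :=
    ⟨rfl, h.adj _, h.ne_succ_succ i, by rw [hap]; simp, by rw [hap]; simp⟩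
  rw [edgeAngle_eq hK hx hflap, circleAngle_eq_angle
    (hx.affineIndependent (h.adj _).1 hflap.2.2.2.1)
    (affineIndependent_swap (hx.affineIndependent (h.adj _).1 hflap.2.2.2.2))]
  rfl

theorem IsLinkCycle.sum_edgeAngle_eq [Fintype V] (hK : IsClosedSurface K)
    (hx : IsNondegenerate K x) {v : V} {n : ℕ} {a : ℕ → V} (h : IsLinkCycle K v n a)
    [DecidableRel (edgeGraph K).Adj] :
    ∑ d : (edgeGraph K).Dart with d.fst = v, edgeAngle K x d.edge =
      ∑ i ∈ Finset.range n, turn (linkPolygon x v a) i := by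
  have h' := h.shift 1
  symm
  refine Finset.sum_bij (fun i _ => (⟨(v, a (1 + i)), h.adj _⟩ : (edgeGraph K).Dart)) ?_ ?_ ?_ ?_
  · intro i _; simp
  · intro i hi j hj hij
    simp only [SimpleGraph.Dart.mk.injEq, Prod.mk.injEq, true_and] at hij
    exact h'.injOn (Finset.mem_range.1 hi) (Finset.mem_range.1 hj) hij
  · rintro ⟨⟨p, q⟩, hd⟩ hpv
    simp only [Finset.mem_filter, Finset.mem_univ, true_and] at hpv
    subst hpv
    obtain ⟨i, hi, hiq⟩ := (h'.adj_iff q).1 hd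
    exact ⟨i, Finset.mem_range.2 hi, by simp only [← hiq]⟩
  · intro i _
    rw [← h.edgeAngle_eq_turn hK hx, add_comm i 1]
    rfl

theorem sum_edgeFinset_eq_sum_darts [Fintype V] (G : SimpleGraph V) [DecidableRel G.Adj]
    (f : Sym2 V → ℝ) :
    ∑ e ∈ G.edgeFinset, f e = ∑ v, 1 / 2 * ∑ d : G.Dart with d.fst = v, f d.edge := by
  rw [← Finset.mul_sum, Finset.sum_fiberwise,
    ← Finset.sum_fiberwise_of_maps_to (s := Finset.univ) (t := G.edgeFinset)
      (g := fun d : G.Dart => d.edge) (fun d _ => by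
        rw [SimpleGraph.mem_edgeFinset]; exact d.edge_mem), Finset.mul_sum]
  refine Finset.sum_congr rfl fun e he => ?_
  rw [Finset.sum_congr rfl (g := fun _ => f e) (fun d hd => by rw [(Finset.mem_filter.1 hd).2]),
    Finset.sum_const, G.dart_edge_fiber_card e (SimpleGraph.mem_edgeFinset.1 he)]
  simp

theorem energy_eq_sum [Fintype V] [DecidableRel (edgeGraph K).Adj] :
    energy K x = ∑ v, (1 / 2 * ∑ d : (edgeGraph K).Dart with d.fst = v, edgeAngle K x d.edge -
      Real.pi) := by
  rw [energy, Finset.sum_sub_distrib]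
  congr 1
  · rw [← sum_edgeFinset_eq_sum_darts]
    congr!
  · simp [mul_comm]

theorem IsLinkCycle.linkPolygon_succ_ne (hx : IsNondegenerate K x) {v : V} {n : ℕ} {a : ℕ → V}
    (h : IsLinkCycle K v n a) (i : ℕ) : linkPolygon x v a (i + 1) ≠ linkPolygon x v a i := by
  intro he
  have hA := (h.isTriangle i).affineIndependent hx
  have h1 : ‖x (a i) - x v‖ ^ 2 ≠ 0 := by
    have := hA.injective.ne (show (1 : Fin 3) ≠ 0 by decide)
    have : x (a i) - x v ≠ 0 := sub_ne_zero.2 (by simpa using this)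
    positivity
  rw [linkPolygon, linkPolygon, invVec, invVec, ← sub_eq_zero, sub_eq_add_neg, ← neg_smul,
    add_comm] at he
  exact inv_ne_zero h1 (neg_eq_zero.1 (eq_zero_of_affineIndependent hA he).1)

/-- The contribution of a vertex to the energy is non-negative. -/
theorem pi_le_sum_darts [Fintype V] [DecidableRel (edgeGraph K).Adj] (hK : IsClosedSurface K)
    (hx : IsNondegenerate K x) (v : V) :
    0 ≤ 1 / 2 * ∑ d : (edgeGraph K).Dart with d.fst = v, edgeAngle K x d.edge - Real.pi := by
  obtain ⟨n, a, h⟩ := hK.exists_isLinkCycle v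
  rw [h.sum_edgeAngle_eq hK hx]
  have := two_pi_le_sum_turn (linkPolygon x v a) (le_trans (by norm_num) h.three_le)
    (h.linkPolygon_periodic x) (h.linkPolygon_succ_ne hx 0)
  linarith

theorem energy_nonneg [Fintype V] (hK : IsClosedSurface K) (hx : IsNondegenerate K x) :
    0 ≤ energy K x := by
  classical
  rw [energy_eq_sum]
  exact Finset.sum_nonneg fun v _ => pi_le_sum_darts hK hx v

/-- Every inverted link is a planar convex polygon (possibly a degenerate one). -/
def LinksConvex (K : AbstractSimplicialComplex V) (x : V → E3) : Prop :=
  ∀ v n a, IsLinkCycle K v n a → DiagonalsMeet (linkPolygon x v a) n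

theorem linksConvex_of_energy_eq_zero [Fintype V] (hK : IsClosedSurface K)
    (hx : IsNondegenerate K x) (h0 : energy K x = 0) : LinksConvex K x := by
  classical
  intro v n a h
  rw [energy_eq_sum, Finset.sum_eq_zero_iff_of_nonneg fun v _ => pi_le_sum_darts hK hx v] at h0
  have hv := h0 v (Finset.mem_univ v)
  rw [h.sum_edgeAngle_eq hK hx] at hv
  exact diagonalsMeet_of_sum_turn_le _ (h.linkPolygon_periodic x) (by linarith)

theorem invVec_injective_left (p : E3) : Function.Injective (invVec p) := by
  have key : ∀ q, q - p = (‖invVec p q‖ ^ 2)⁻¹ • invVec p q := by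
    intro q
    by_cases hq : q - p = 0
    · simp [invVec, hq]
    · have hq' : ‖q - p‖ ≠ 0 := norm_ne_zero_iff.2 hq
      rw [invVec, norm_smul, smul_smul, norm_inv, norm_pow, norm_norm]
      have : ((((‖q - p‖ ^ 2)⁻¹ * ‖q - p‖) ^ 2)⁻¹ * (‖q - p‖ ^ 2)⁻¹ : ℝ) = 1 := by field_simp
      rw [this, one_smul]
  intro q r hqr
  have : q - p = r - p := by rw [key q, key r, hqr]
  exact sub_left_injective this

theorem energy_eq_zero_of_linksConvex [Fintype V] (hK : IsClosedSurface K)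
    (hx : IsNondegenerate K x) (hinj : Function.Injective x) (h : LinksConvex K x) :
    energy K x = 0 := by
  classical
  rw [energy_eq_sum]
  refine Finset.sum_eq_zero fun v _ => ?_
  obtain ⟨n, a, ha⟩ := hK.exists_isLinkCycle v
  rw [ha.sum_edgeAngle_eq hK hx, sum_turn_of_diagonalsMeet _ ha.three_le
    (ha.linkPolygon_periodic x) _ (h v n a ha)]
  · ring
  · exact fun i hi j hj hij => ha.injOn hi hj (hinj (invVec_injective_left _ hij))

end Energy

/-! ### Surfaces with convex links lie on a sphere -/

section Sphere

theorem turn_eq_zero_of_mem_segment {E : Type*} [NormedAddCommGroup E] [InnerProductSpace ℝ E]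
    {y : ℕ → E} {i : ℕ} (h1 : y (i + 1) ≠ y i) (h2 : y (i + 2) ≠ y (i + 1))
    (h : y (i + 1) ∈ segment ℝ (y i) (y (i + 2))) : turn y i = 0 := by
  obtain ⟨s, t, hs, ht, hst, he⟩ := h
  rw [turn, InnerProductGeometry.angle_eq_zero_iff]
  obtain rfl : s = 1 - t := by linarith
  have e1 : y (i + 1) - y i = t • (y (i + 2) - y i) := by rw [← he]; module
  have e2 : y (i + 2) - y (i + 1) = (1 - t) • (y (i + 2) - y i) := by rw [← he]; module
  have ht0 : t ≠ 0 := by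
    rintro rfl
    exact h1 (sub_eq_zero.1 (by rw [e1, zero_smul]))
  have ht1 : 1 - t ≠ 0 := by
    intro h0
    exact h2 (sub_eq_zero.1 (by rw [e2, h0, zero_smul]))
  refine ⟨sub_ne_zero.2 h1, (1 - t) / t, div_pos (hs.lt_of_ne' ht1) (ht.lt_of_ne' ht0), ?_⟩
  rw [e1, e2, smul_smul, div_mul_cancel₀ _ ht0]

/-- A closed polygon has a corner at which it does not go straight on. -/
theorem exists_not_mem_segment {E : Type*} [NormedAddCommGroup E] [InnerProductSpace ℝ E]
    {y : ℕ → E} {n : ℕ} (hn : 2 ≤ n) (hper : ∀ i, y (i + n) = y i)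
    (hne : ∀ i, y (i + 1) ≠ y i) : ∃ i, y (i + 1) ∉ segment ℝ (y i) (y (i + 2)) := by
  by_contra! hcon
  have h := two_pi_le_sum_turn y hn hper (hne 0)
  rw [Finset.sum_eq_zero fun i _ => turn_eq_zero_of_mem_segment (hne i) (hne (i + 1)) (hcon i)] at h
  linarith [Real.pi_pos]

theorem exists_ne_zero_inner_eq_zero (a b : E3) :
    ∃ η : E3, η ≠ 0 ∧ inner ℝ η a = 0 ∧ inner ℝ η b = 0 := by
  have h : LinearMap.ker ((innerₛₗ ℝ a).prod (innerₛₗ ℝ b)) ≠ ⊥ :=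
    LinearMap.ker_ne_bot_of_finrank_lt (by simp)
  obtain ⟨η, hη, h0⟩ := Submodule.exists_mem_ne_zero_of_ne_bot h
  have hη : ((inner ℝ a η, inner ℝ b η) : ℝ × ℝ) = 0 := hη
  rw [Prod.mk_eq_zero] at hη
  exact ⟨η, h0, by rw [real_inner_comm]; exact hη.1, by rw [real_inner_comm]; exact hη.2⟩

theorem coplanar_of_inner_eq {s : Set E3} {η : E3} (hη : η ≠ 0) {t : ℝ}
    (h : ∀ p ∈ s, inner ℝ η p = t) : Coplanar ℝ s := by
  rw [coplanar_iff_finrank_le_two]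
  have hle : vectorSpan ℝ s ≤ (ℝ ∙ η)ᗮ := by
    rw [vectorSpan_def, Submodule.span_le]
    rintro _ ⟨p, hp, q, hq, rfl⟩
    simp only [vsub_eq_sub, SetLike.mem_coe, Submodule.mem_orthogonal_singleton_iff_inner_right,
      inner_sub_right, h p hp, h q hq, sub_self]
  have h3 : Module.finrank ℝ E3 = 2 + 1 := by simp
  have : Fact (Module.finrank ℝ E3 = 2 + 1) := ⟨h3⟩
  exact (Submodule.finrank_mono hle).trans (Submodule.finrank_orthogonal_span_singleton hη).le

/-- The quadratic function `κ |p|² + ⟨ξ, p⟩ + t`; the zero sets of these functions are the spheres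
and planes. -/
noncomputable def sphereFun (F : ℝ × E3 × ℝ) (p : E3) : ℝ :=
  F.1 * ‖p‖ ^ 2 + inner ℝ F.2.1 p + F.2.2

theorem sphereFun_eq {F : ℝ × E3 × ℝ} {p : E3} (hp : sphereFun F p = 0) {q : E3} (hqp : q ≠ p) :
    sphereFun F q = ‖q - p‖ ^ 2 * (inner ℝ (F.2.1 + (2 * F.1) • p) (invVec p q) + F.1) := by
  have hn : ‖q - p‖ ^ 2 ≠ 0 := by
    have := sub_ne_zero.2 hqp
    positivity
  have h1 : ‖q‖ ^ 2 = ‖q - p‖ ^ 2 + 2 * inner ℝ p (q - p) + ‖p‖ ^ 2 := by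
    have : q = (q - p) + p := by abel
    nth_rewrite 1 [this]
    rw [norm_add_sq_real, real_inner_comm]
  have h2 : inner ℝ F.2.1 q = inner ℝ F.2.1 (q - p) + inner ℝ F.2.1 p := by
    rw [← inner_add_right]; congr 1; abel
  rw [sphereFun] at hp ⊢
  rw [invVec, inner_smul_right, mul_add, mul_inv_cancel_left₀ hn, inner_add_left, inner_smul_left,
    h1, h2]
  simp only [conj_trivial]
  linear_combination hp

theorem sphereFun_eq_zero_iff {F : ℝ × E3 × ℝ} {p : E3} (hp : sphereFun F p = 0) {q : E3}
    (hqp : q ≠ p) :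
    sphereFun F q = 0 ↔ inner ℝ (F.2.1 + (2 * F.1) • p) (invVec p q) + F.1 = 0 := by
  have hn : ‖q - p‖ ^ 2 ≠ 0 := by
    have := sub_ne_zero.2 hqp
    positivity
  rw [sphereFun_eq hp hqp, mul_eq_zero, or_iff_right hn]

/-- If the vertex `y 1` is a proper corner of a polygon whose diagonals meet, then the polygon lies
in every plane through `y 0`, `y 1` and `y 2`. -/
theorem DiagonalsMeet.inner_eq_zero {E : Type*} [NormedAddCommGroup E] [InnerProductSpace ℝ E]
    {y : ℕ → E} {n : ℕ} (h : DiagonalsMeet y n) (hc : y 1 ∉ segment ℝ (y 0) (y 2)) {η : E} {k : ℝ}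
    (h0 : inner ℝ η (y 0) + k = 0) (h1 : inner ℝ η (y 1) + k = 0)
    (h2 : inner ℝ η (y 2) + k = 0) : ∀ j < n, inner ℝ η (y j) + k = 0 := by
  intro j hj
  match j, hj with
  | 0, _ => exact h0
  | 1, _ => exact h1
  | 2, _ => exact h2
  | j + 3, hj =>
    obtain ⟨z, hz, s, t, hs, ht, hst, rfl⟩ := h 0 1 2 (j + 3) (by omega) (by omega) (by omega) hj
    have ht0 : t ≠ 0 := by
      rintro rfl
      obtain rfl : s = 1 := by linarith
      simp only [one_smul, zero_smul, add_zero] at hz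
      exact hc hz
    obtain ⟨a, b, -, -, hab, he⟩ := hz
    have := congrArg (inner ℝ η) he
    simp only [inner_add_right, inner_smul_right] at this
    have e : t * (inner ℝ η (y (j + 3)) + k) = 0 := by
      obtain rfl : s = 1 - t := by linarith
      obtain rfl : a = 1 - b := by linarith
      linear_combination -this + (1 - b) * h0 + b * h2 - (1 - t) * h1
    exact (mul_eq_zero.1 e).resolve_left ht0

/-- If `v a u b` is a convex quadrilateral inscribed in a circle, then the angle at `a` or that at
`b` is not acute, so that the diagonal `u v` is longer than the two sides that meet there. -/
theorem exists_shorter_of_mem_segment {u v a b : E3} (hu : u ≠ v) (hau : a ≠ u) (hav : a ≠ v)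
    (hbu : b ≠ u) (hbv : b ≠ v)
    (h : invVec v u ∈ segment ℝ (invVec v a) (invVec v b)) :
    ∃ w ∈ ({a, b} : Set E3), dist u w < dist u v ∧ dist w v < dist u v := by
  have key : ∀ w : E3, w ≠ u → w ≠ v → 1 ≤ inner ℝ (invVec v w) (u - v) →
      dist u w < dist u v ∧ dist w v < dist u v := by
    intro w hwu hwv h1
    have hwn : 0 < ‖w - v‖ ^ 2 := by
      have := sub_ne_zero.2 hwv
      positivity
    have hwn' : 0 < ‖u - w‖ ^ 2 := by
      have := sub_ne_zero.2 hwu.symm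
      positivity
    rw [invVec, inner_smul_left, conj_trivial, inv_mul_eq_div, le_div_iff₀ hwn, one_mul] at h1
    have e : ‖u - w‖ ^ 2 = ‖u - v‖ ^ 2 - 2 * inner ℝ (w - v) (u - v) + ‖w - v‖ ^ 2 := by
      rw [show u - w = (u - v) - (w - v) by abel, norm_sub_sq_real, real_inner_comm]
    rw [dist_eq_norm, dist_eq_norm, dist_eq_norm]
    constructor <;> apply lt_of_pow_lt_pow_left₀ 2 (norm_nonneg _) <;> linarith
  obtain ⟨s, t, hs, ht, hst, he⟩ := h
  have h1 : inner ℝ (invVec v u) (u - v) = 1 := by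
    have : ‖u - v‖ ^ 2 ≠ 0 := by
      have := sub_ne_zero.2 hu
      positivity
    rw [invVec, inner_smul_left, real_inner_self_eq_norm_sq, conj_trivial, inv_mul_cancel₀ this]
  rw [← he, inner_add_left, inner_smul_left, inner_smul_left, conj_trivial, conj_trivial] at h1
  by_cases ha : 1 ≤ inner ℝ (invVec v a) (u - v)
  · exact ⟨a, by simp, key a hau hav ha⟩
  · refine ⟨b, by simp, key b hbu hbv ?_⟩
    by_contra hb
    push Not at ha hb
    rcases hs.eq_or_lt with rfl | hs
    · obtain rfl : t = 1 := by linarith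
      linarith
    · nlinarith

variable {V : Type*} [DecidableEq V] {K : AbstractSimplicialComplex V} {x : V → E3}

theorem IsNondegenerate.ne_of_adj (hx : IsNondegenerate K x) {u v : V}
    (h : (edgeGraph K).Adj u v) : x u ≠ x v := by
  have := (hx _ h.2).injective.ne (a₁ := ⟨u, by simp⟩) (a₂ := ⟨v, by simp⟩)
    (by simpa [Subtype.ext_iff] using h.1)
  exact this

/-- A function on the vertices is constant along edges if this holds for every edge that is not the
longest side of an adjacent triangle. -/
theorem eq_of_adj_of_shorter [Finite V] {α : Type*} (f : V → α)
    (h : ∀ u v, (edgeGraph K).Adj u v → f u = f v ∨ ∃ w, IsTriangle K u v w ∧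
      dist (x u) (x w) < dist (x u) (x v) ∧ dist (x w) (x v) < dist (x u) (x v))
    {u v : V} (huv : (edgeGraph K).Adj u v) : f u = f v := by
  by_contra hne
  obtain ⟨p, ⟨hp, hpne⟩, hmin⟩ := Set.exists_min_image
    {p : V × V | (edgeGraph K).Adj p.1 p.2 ∧ f p.1 ≠ f p.2} (fun p => dist (x p.1) (x p.2))
    (Set.toFinite _) ⟨(u, v), huv, hne⟩
  obtain h | ⟨w, hw, h1, h2⟩ := h p.1 p.2 hp
  · exact hpne h
  · have e1 : f p.1 = f w := by
      by_contra hc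
      exact absurd (hmin (p.1, w) ⟨hw.rotate.rotate.swap.adj, hc⟩) (not_le.2 h1)
    have e2 : f w = f p.2 := by
      by_contra hc
      exact absurd (hmin (w, p.2) ⟨hw.rotate.adj.symm, hc⟩) (not_le.2 h2)
    exact hpne (e1.trans e2)

/-- The spheres and planes through all vertices of the star of `v`. -/
def starSpheres (K : AbstractSimplicialComplex V) (x : V → E3) (v : V) : Set (ℝ × E3 × ℝ) :=
  {F | sphereFun F (x v) = 0 ∧ ∀ u, (edgeGraph K).Adj v u → sphereFun F (x u) = 0}

theorem IsLinkCycle.exists_shift_one {v : V} {n : ℕ} {a : ℕ → V} (h : IsLinkCycle K v n a) {u : V}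
    (hu : (edgeGraph K).Adj v u) : ∃ b, IsLinkCycle K v n b ∧ b 1 = u := by
  obtain ⟨b, hb, rfl⟩ := h.exists_shift hu
  refine ⟨_, hb.shift (n - 1), ?_⟩
  have hn := hb.three_le
  change b (n - 1 + 1) = b 0
  rw [show n - 1 + 1 = n by omega]
  simpa using hb.periodic 0

/-- At a proper corner of the inverted link of `v`, the spheres through the star of `v` are
determined by `v` and the three consecutive neighbours. -/
theorem LinksConvex.mem_starSpheres (hX : LinksConvex K x) (hx : IsNondegenerate K x) {v : V} {n : ℕ}
    {a : ℕ → V} (h : IsLinkCycle K v n a)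
    (hc : linkPolygon x v a 1 ∉ segment ℝ (linkPolygon x v a 0) (linkPolygon x v a 2))
    {F : ℝ × E3 × ℝ} (hv : sphereFun F (x v) = 0) (h0 : sphereFun F (x (a 0)) = 0)
    (h1 : sphereFun F (x (a 1)) = 0) (h2 : sphereFun F (x (a 2)) = 0) :
    F ∈ starSpheres K x v := by
  refine ⟨hv, fun u hu => ?_⟩
  have hi : ∀ i, sphereFun F (x (a i)) = 0 ↔
      inner ℝ (F.2.1 + (2 * F.1) • x v) (linkPolygon x v a i) + F.1 = 0 :=
    fun i => sphereFun_eq_zero_iff hv (hx.ne_of_adj (h.adj i)).symm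
  obtain ⟨i, hin, rfl⟩ := (h.adj_iff u).1 hu
  rw [hi] at h0 h1 h2 ⊢
  exact (hX v n a h).inner_eq_zero hc h0 h1 h2 i hin

theorem LinksConvex.starSpheres_eq_of_adj [Finite V] (hK : IsClosedSurface K)
    (hX : LinksConvex K x) (hx : IsNondegenerate K x) {u v : V} (huv : (edgeGraph K).Adj u v) :
    starSpheres K x u = starSpheres K x v := by
  refine eq_of_adj_of_shorter (x := x) (starSpheres K x) (fun u v huv => ?_) huv
  by_contra! hcon
  obtain ⟨hne, hno⟩ := hcon
  have key : ∀ u v, (edgeGraph K).Adj u v → (∀ w, IsTriangle K u v w →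
      dist (x u) (x w) < dist (x u) (x v) → dist (x u) (x v) ≤ dist (x w) (x v)) →
      starSpheres K x u ⊆ starSpheres K x v := by
    intro u v huv hno F hF
    obtain ⟨n, a, ha⟩ := hK.exists_isLinkCycle v
    obtain ⟨a, ha, rfl⟩ := ha.exists_shift_one huv.symm
    have t0 := (ha.isTriangle 0).rotate.swap
    have t2 := (ha.isTriangle 1).swap
    refine hX.mem_starSpheres hx ha ?_ (hF.2 _ huv) (hF.2 _ t0.adj)
      hF.1 (hF.2 _ t2.rotate.rotate.swap.adj)
    intro hseg
    obtain ⟨w, hw, h1, h2⟩ := exists_shorter_of_mem_segment (hx.ne_of_adj huv)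
      (hx.ne_of_adj t0.adj).symm (hx.ne_of_adj (ha.adj 0)).symm
      (hx.ne_of_adj t2.rotate.rotate.swap.adj).symm (hx.ne_of_adj (ha.adj 2)).symm hseg
    rcases hw with rfl | rfl
    · exact absurd (hno _ t0.rotate.rotate.swap h1) (not_le.2 h2)
    · exact absurd (hno _ t2 h1) (not_le.2 h2)
  refine hne (Set.Subset.antisymm (key u v huv hno) (key v u huv.symm ?_))
  intro w hw h1
  by_contra h2
  push Not at h2
  rw [dist_comm (x v) (x u)] at h1 h2
  rw [dist_comm] at h1 h2
  exact absurd (hno w hw.swap h2) (not_le.2 h1)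

/-- In a connected surface with convex links, the stars of all vertices lie on the same spheres and
planes. -/
theorem LinksConvex.eq_zero_of_mem_starSpheres [Finite V] (hK : IsClosedSurface K)
    (hX : LinksConvex K x) (hx : IsNondegenerate K x) (hconn : (edgeGraph K).Connected) {v : V}
    {F : ℝ × E3 × ℝ} (hF : F ∈ starSpheres K x v) (u : V) : sphereFun F (x u) = 0 := by
  have h : ∀ u, starSpheres K x u = starSpheres K x v := by
    intro u
    obtain ⟨p⟩ := hconn.preconnected u v
    induction p with
    | nil => rfl
    | cons hadj p ih => rw [hX.starSpheres_eq_of_adj hK hx hadj, ih hF]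
  rw [← h u] at hF
  exact hF.1

theorem LinksConvex.exists_inner_ne_zero [Finite V] (hK : IsClosedSurface K)
    (hX : LinksConvex K x) (hx : IsNondegenerate K x) (hconn : (edgeGraph K).Connected)
    (hcop : ¬ Coplanar ℝ (Set.range x)) (v : V) {η : E3} (hη : η ≠ 0) :
    ∃ u, (edgeGraph K).Adj v u ∧ inner ℝ η (x u - x v) ≠ 0 := by
  by_contra! hcon
  apply hcop
  refine coplanar_of_inner_eq hη (t := inner ℝ η (x v)) ?_
  rintro _ ⟨u, rfl⟩
  have hF : ((0, η, -inner ℝ η (x v)) : ℝ × E3 × ℝ) ∈ starSpheres K x v := by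
    refine ⟨by simp [sphereFun], fun u hu => ?_⟩
    have := hcon u hu
    rw [inner_sub_right] at this
    simp only [sphereFun]
    linarith
  have := hX.eq_zero_of_mem_starSpheres hK hx hconn hF u
  simp only [sphereFun] at this
  linarith

/-- If two adjacent triangles `v a u`, `v u b` are coplanar, then `v a u b` is a convex inscribed
quadrilateral. -/
theorem LinksConvex.mem_segment_of_coplanar [Finite V] (hK : IsClosedSurface K)
    (hX : LinksConvex K x) (hx : IsNondegenerate K x) (hconn : (edgeGraph K).Connected)
    (hcop : ¬ Coplanar ℝ (Set.range x)) {v : V} {n : ℕ} {a : ℕ → V} (h : IsLinkCycle K v n a)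
    {η : E3} (hη : η ≠ 0) (h0 : inner ℝ η (x (a 0) - x v) = 0)
    (h1 : inner ℝ η (x (a 1) - x v) = 0) (h2 : inner ℝ η (x (a 2) - x v) = 0) :
    linkPolygon x v a 1 ∈ segment ℝ (linkPolygon x v a 0) (linkPolygon x v a 2) := by
  by_contra hc
  have hF : ((0, η, -inner ℝ η (x v)) : ℝ × E3 × ℝ) ∈ starSpheres K x v := by
    rw [inner_sub_right] at h0 h1 h2
    apply hX.mem_starSpheres hx h hc <;> simp only [sphereFun] <;> linarith
  obtain ⟨u, hu, hne⟩ := hX.exists_inner_ne_zero hK hx hconn hcop v hη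
  apply hne
  have := hF.2 u hu
  simp only [sphereFun] at this
  rw [inner_sub_right]
  linarith

theorem LinksConvex.exists_sphere [Finite V] (hK : IsClosedSurface K)
    (hX : LinksConvex K x) (hx : IsNondegenerate K x) (hconn : (edgeGraph K).Connected)
    (hcop : ¬ Coplanar ℝ (Set.range x)) :
    ∃ (c : E3) (r : ℝ), ∀ v, x v ∈ Metric.sphere c r := by
  obtain ⟨v⟩ := hconn.nonempty
  obtain ⟨n, a, ha⟩ := hK.exists_isLinkCycle v
  obtain ⟨i, hi⟩ := exists_not_mem_segment (y := linkPolygon x v a)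
    (le_trans (by norm_num) ha.three_le) (ha.linkPolygon_periodic x) (ha.linkPolygon_succ_ne hx)
  have ha := ha.shift i
  generalize hb : (fun j => a (i + j)) = b at ha
  have hc : linkPolygon x v b 1 ∉ segment ℝ (linkPolygon x v b 0) (linkPolygon x v b 2) := by
    rw [← hb]; exact hi
  -- a plane through three consecutive vertices of the inverted link
  obtain ⟨η, hη, e1, e2⟩ := exists_ne_zero_inner_eq_zero
    (linkPolygon x v b 1 - linkPolygon x v b 0) (linkPolygon x v b 2 - linkPolygon x v b 0)
  rw [inner_sub_right, sub_eq_zero] at e1 e2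
  set k := -inner ℝ η (linkPolygon x v b 0) with hk
  -- the sphere or plane through `v` that is the image of this plane
  let F : ℝ × E3 × ℝ := (k, η - (2 * k) • x v, k * ‖x v‖ ^ 2 - inner ℝ η (x v))
  have hv : sphereFun F (x v) = 0 := by
    simp only [sphereFun, F, inner_sub_left, inner_smul_left, conj_trivial,
      real_inner_self_eq_norm_sq]
    ring
  have hF2 : F.2.1 + (2 * F.1) • x v = η := by simp [F]
  have hj : ∀ j, inner ℝ η (linkPolygon x v b j) + k = 0 → sphereFun F (x (b j)) = 0 := by
    intro j hj
    rw [sphereFun_eq_zero_iff hv (hx.ne_of_adj (ha.adj j)).symm, hF2]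
    exact hj
  have hF := hX.mem_starSpheres hx ha hc hv (hj 0 (by simp [hk])) (hj 1 (by simp [hk, e1]))
    (hj 2 (by simp [hk, e2]))
  have hall := hX.eq_zero_of_mem_starSpheres hK hx hconn hF
  have hk0 : k ≠ 0 := by
    intro hk0
    apply hcop
    refine coplanar_of_inner_eq hη (t := inner ℝ η (x v)) ?_
    rintro _ ⟨u, rfl⟩
    have := hall u
    simp only [sphereFun, F, hk0] at this
    simp only [mul_zero, zero_smul, sub_zero, zero_mul, zero_sub, zero_add] at this
    linarith
  have key : ∀ u, ‖x u - -((2 * k)⁻¹ • F.2.1)‖ ^ 2 =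
      ‖(2 * k)⁻¹ • F.2.1‖ ^ 2 - F.2.2 / k := by
    intro u
    have hu : k * ‖x u‖ ^ 2 + inner ℝ F.2.1 (x u) + F.2.2 = 0 := hall u
    rw [sub_neg_eq_add, norm_add_sq_real, inner_smul_right, real_inner_comm]
    field_simp
    linear_combination hu
  refine ⟨-((2 * k)⁻¹ • F.2.1), √(‖(2 * k)⁻¹ • F.2.1‖ ^ 2 - F.2.2 / k), fun u => ?_⟩
  rw [mem_sphere_iff_norm, ← key u, Real.sqrt_sq (norm_nonneg _)]

end Sphere

/-! ### Linear functions on surfaces with convex links -/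

section Morse

open Relation

/-- Discrete Morse theory: if the lower link of every vertex is connected, then no two sublevel
components ever merge, so that a connected graph has only one local minimum. Indeed, take a path
from `u` to `p` whose highest level `t` is as low as possible. It can be pushed down into the lower links
of its highest vertices. -/
theorem lt_of_forall_adj_lt {V : Type*} [Finite V] {G : SimpleGraph V} (hconn : G.Connected)
    {f : V → ℝ} (hne : ∀ u v, G.Adj u v → f u ≠ f v)
    (hlow : ∀ u w w', G.Adj u w → G.Adj u w' → f w < f u → f w' < f u →
      ReflTransGen (fun a b => G.Adj a b ∧ f a < f u ∧ f b < f u) w w')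
    {u p : V} (hu : ∀ w, G.Adj u w → f u < f w) (hpu : p ≠ u) : f u < f p := by
  by_contra! hpu'
  let T : Set V := {v | ReflTransGen (fun a b => G.Adj a b ∧ f a ≤ f v ∧ f b ≤ f v) u p}
  have hT : T.Nonempty := by
    have : Nonempty V := ⟨u⟩
    obtain ⟨m, hm⟩ := Finite.exists_max f
    refine ⟨m, ?_⟩
    obtain ⟨q⟩ := hconn.preconnected u p
    clear hpu hpu' hu
    induction q with
    | nil => exact ReflTransGen.refl
    | cons h q ih => exact ReflTransGen.head ⟨h, hm _, hm _⟩ ih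
  obtain ⟨v, hv, hmin⟩ := Set.exists_min_image T f (Set.toFinite T) hT
  have hfirst : ∀ {r : V → V → Prop}, ReflTransGen r u p → ∃ w, r u w := by
    intro r hr
    rcases ReflTransGen.cases_head hr with h | ⟨w, hw, -⟩
    · exact absurd h.symm hpu
    · exact ⟨w, hw⟩
  have huv : f u < f v := by
    obtain ⟨w, hw⟩ := hfirst hv
    exact (hu w hw.1).trans_le hw.2.2
  -- the path can be pushed strictly below the level of `v`
  have key : ∀ b, ReflTransGen (fun a b => G.Adj a b ∧ f a ≤ f v ∧ f b ≤ f v) u b →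
      (f b < f v → ReflTransGen (fun a b => G.Adj a b ∧ f a < f v ∧ f b < f v) u b) ∧
      (f b = f v → ∃ c, G.Adj b c ∧ f c < f v ∧
        ReflTransGen (fun a b => G.Adj a b ∧ f a < f v ∧ f b < f v) u c) := by
    intro b hb
    induction hb with
    | refl => exact ⟨fun _ => ReflTransGen.refl, fun h => absurd h huv.ne⟩
    | tail _ hbc ih =>
      obtain ⟨hadj, hb, hc⟩ := hbc
      rcases hb.lt_or_eq with hb | hb
      · exact ⟨fun hc => (ih.1 hb).tail ⟨hadj, hb, hc⟩, fun _ => ⟨_, hadj.symm, hb, ih.1 hb⟩⟩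
      · obtain ⟨d, hd, hdv, hud⟩ := ih.2 hb
        refine ⟨fun hc => hud.trans ?_, fun hc => absurd (hb.trans hc.symm) (hne _ _ hadj)⟩
        have := hlow _ _ _ hd hadj (by rwa [hb]) (by rwa [hb])
        rwa [hb] at this
  have hlt := (key p hv).1 (hpu'.trans_lt huv)
  obtain ⟨m, hm, hmax⟩ := Set.exists_max_image {w | f w < f v} f (Set.toFinite _) ⟨u, huv⟩
  refine absurd (hmin m ?_) (not_le.2 hm)
  exact ReflTransGen.mono (fun a b h => ⟨h.1, hmax a h.2.1, hmax b h.2.2⟩) _ _ hlt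

variable {V : Type*} [DecidableEq V] {K : AbstractSimplicialComplex V} {x : V → E3}

theorem IsLinkCycle.adj_succ {v : V} {n : ℕ} {a : ℕ → V} (h : IsLinkCycle K v n a)
    (i : ℕ) : (edgeGraph K).Adj (a i) (a (i + 1)) := (h.isTriangle i).rotate.adj

theorem inner_invVec_neg_iff {p q : E3} (hpq : q ≠ p) (ξ : E3) :
    inner ℝ ξ (invVec p q) < 0 ↔ inner ℝ ξ (q - p) < 0 := by
  have : 0 < ‖q - p‖ ^ 2 := by
    have := sub_ne_zero.2 hpq
    positivity
  rw [invVec, inner_smul_right, inv_mul_lt_iff₀ this, mul_zero]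

theorem reflTransGen_of_forall_mem_Icc {α : Type*} {r : α → α → Prop} (a : ℕ → α) {p q : ℕ}
    (hpq : p ≤ q) (h : ∀ i, p ≤ i → i < q → r (a i) (a (i + 1))) : ReflTransGen r (a p) (a q) := by
  induction q, hpq using Nat.le_induction with
  | base => exact ReflTransGen.refl
  | succ q hq ih =>
    exact (ih fun i hi hiq => h i hi (by omega)).tail (h q hq (by omega))

/-- The neighbours of a vertex `v` on one side of a plane through `v` form a path in the link. -/
theorem LinksConvex.lower_link_connected [Finite V] (hK : IsClosedSurface K) (hX : LinksConvex K x)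
    (hx : IsNondegenerate K x) (ξ : E3) {v w w' : V} (hw : (edgeGraph K).Adj v w)
    (hw' : (edgeGraph K).Adj v w') (h : inner ℝ ξ (x w - x v) < 0)
    (h' : inner ℝ ξ (x w' - x v) < 0) :
    ReflTransGen (fun a b => (edgeGraph K).Adj a b ∧ inner ℝ ξ (x a - x v) < 0 ∧
      inner ℝ ξ (x b - x v) < 0) w w' := by
  obtain ⟨n, a, ha⟩ := hK.exists_isLinkCycle v
  obtain ⟨a, ha, rfl⟩ := ha.exists_shift hw
  obtain ⟨k, hk, rfl⟩ := (ha.adj_iff w').1 hw'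
  have hY := hX v n a ha
  have hs : ∀ i, inner ℝ ξ (linkPolygon x v a i) < 0 ↔ inner ℝ ξ (x (a i) - x v) < 0 :=
    fun i => inner_invVec_neg_iff (hx.ne_of_adj (ha.adj i)).symm ξ
  by_cases hall : ∀ j, 0 ≤ j → j ≤ k → inner ℝ ξ (x (a j) - x v) < 0
  · exact reflTransGen_of_forall_mem_Icc a (Nat.zero_le k) fun i hi hik =>
      ⟨ha.adj_succ i, hall i hi hik.le, hall _ (by omega) hik⟩
  · push Not at hall
    obtain ⟨j, -, hjk, hj⟩ := hall
    have hj0 : j ≠ 0 := by rintro rfl; linarith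
    have hjk' : j ≠ k := by rintro rfl; linarith
    have hn : a n = a 0 := by simpa using ha.periodic 0
    have hall' : ∀ l, k ≤ l → l ≤ n → inner ℝ ξ (x (a l) - x v) < 0 := by
      intro l hkl hln
      rcases hkl.eq_or_lt with rfl | hkl
      · exact h'
      rcases hln.eq_or_lt with rfl | hln
      · rwa [hn]
      by_contra hl
      rw [← hs] at h h' hl
      have hj' := not_lt.2 hj
      rw [← hs] at hj'
      obtain ⟨z, ⟨s, t, hs, ht, hst, rfl⟩, s', t', hs', ht', hst', he⟩ :=
        hY 0 j k l (by omega) (by omega) hkl hln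
      have := congrArg (inner ℝ ξ) he
      simp only [inner_add_right, inner_smul_right] at this
      rw [not_lt] at hl hj'
      have e1 := mul_nonneg hs' hj'
      have e2 := mul_nonneg ht' hl
      rcases hs.eq_or_lt with rfl | hs
      · obtain rfl : t = 1 := by linarith
        linarith
      · have e3 := mul_neg_of_pos_of_neg hs h
        have e4 := mul_nonpos_of_nonneg_of_nonpos ht h'.le
        linarith
    have h1 := reflTransGen_of_forall_mem_Icc (r := fun a b => (edgeGraph K).Adj a b ∧
      inner ℝ ξ (x a - x v) < 0 ∧ inner ℝ ξ (x b - x v) < 0) a hk.le fun i hi hik =>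
        ⟨ha.adj_succ i, hall' i hi hik.le, hall' _ (by omega) hik⟩
    rw [hn] at h1
    have : Std.Symm fun a b => (edgeGraph K).Adj a b ∧ inner ℝ ξ (x a - x v) < 0 ∧
        inner ℝ ξ (x b - x v) < 0 := ⟨fun a b h => ⟨h.1.symm, h.2.2, h.2.1⟩⟩
    exact ReflTransGen.stdSymm.symm _ _ h1

/-- A strict local minimum of a linear function is a strict global minimum. The function is perturbed
so that no edge is level, and then discrete Morse theory applies. -/
theorem LinksConvex.inner_pos_of_forall_adj [Finite V] (hK : IsClosedSurface K)
    (hX : LinksConvex K x) (hx : IsNondegenerate K x) (hconn : (edgeGraph K).Connected) {ξ : E3}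
    {u : V} (hu : ∀ w, (edgeGraph K).Adj u w → 0 < inner ℝ ξ (x w - x u)) {p : V} (hpu : p ≠ u) :
    0 < inner ℝ ξ (x p - x u) := by
  by_contra! hp
  -- a direction in which no edge is level
  obtain ⟨η, hη⟩ : ∃ η : E3, ∀ e : {e : V × V // (edgeGraph K).Adj e.1 e.2},
      inner ℝ (x e.1.2 - x e.1.1) η ≠ 0 := by
    apply Module.Dual.exists_forall_ne_zero_of_forall_exists
      (fun e : {e : V × V // (edgeGraph K).Adj e.1 e.2} => innerₛₗ ℝ (x e.1.2 - x e.1.1))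
    intro e
    refine ⟨x e.1.2 - x e.1.1, ?_⟩
    exact (inner_self_ne_zero (𝕜 := ℝ)).2 (sub_ne_zero.2 (hx.ne_of_adj e.2).symm)
  wlog hηp : inner ℝ η (x p - x u) ≤ 0 generalizing η
  · refine this (-η) (fun e => by rw [inner_neg_right, neg_ne_zero]; exact hη e) ?_
    rw [inner_neg_left]
    linarith
  have hη : ∀ v w, (edgeGraph K).Adj v w → inner ℝ η (x w - x v) ≠ 0 := by
    intro v w h
    rw [real_inner_comm]
    exact hη ⟨(v, w), h⟩
  have hcont : ∀ d : E3, Filter.Tendsto (fun δ : ℝ => inner ℝ (ξ + δ • η) d)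
      (nhdsWithin 0 (Set.Ioi 0)) (nhds (inner ℝ ξ d)) := by
    intro d
    have : Continuous fun δ : ℝ => (inner ℝ (ξ + δ • η) d : ℝ) := by fun_prop
    have := this.tendsto 0
    simp only [zero_smul, add_zero] at this
    exact this.mono_left nhdsWithin_le_nhds
  have ev1 : ∀ᶠ δ : ℝ in nhdsWithin 0 (Set.Ioi 0),
      ∀ w, (edgeGraph K).Adj u w → 0 < inner ℝ (ξ + δ • η) (x w - x u) := by
    rw [Filter.eventually_all]
    intro w
    by_cases hw : (edgeGraph K).Adj u w
    · exact ((hcont _).eventually_const_lt (hu w hw)).mono fun δ h _ => h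
    · exact Filter.Eventually.of_forall fun δ h => absurd h hw
  have ev2 : ∀ᶠ δ : ℝ in nhdsWithin 0 (Set.Ioi 0),
      ∀ e : V × V, (edgeGraph K).Adj e.1 e.2 → inner ℝ (ξ + δ • η) (x e.2 - x e.1) ≠ 0 := by
    rw [Filter.eventually_all]
    intro e
    by_cases he : (edgeGraph K).Adj e.1 e.2
    · by_cases h0 : inner ℝ ξ (x e.2 - x e.1) = 0
      · filter_upwards [self_mem_nhdsWithin] with δ hδ _
        rw [inner_add_left, h0, zero_add, inner_smul_left]
        exact mul_ne_zero (ne_of_gt hδ) (hη _ _ he)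
      · exact ((hcont _).eventually_ne h0).mono fun δ h _ => h
    · exact Filter.Eventually.of_forall fun δ h => absurd h he
  obtain ⟨δ, ⟨h1, h2⟩, hδ⟩ := ((ev1.and ev2).and self_mem_nhdsWithin).exists
  have hδ : 0 < δ := hδ
  have hsub : ∀ a b : V, inner ℝ (ξ + δ • η) (x a - x b) < 0 ↔
      inner ℝ (ξ + δ • η) (x a) < inner ℝ (ξ + δ • η) (x b) := by
    intro a b
    rw [inner_sub_right, sub_neg]
  have := lt_of_forall_adj_lt hconn (f := fun v => inner ℝ (ξ + δ • η) (x v)) (u := u) (p := p)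
    (fun v w hvw he => h2 (v, w) hvw (by rw [inner_sub_right, he, sub_self]))
    (fun v w w' hw hw' hlt hlt' => by
      have := hX.lower_link_connected hK hx (ξ + δ • η) hw hw' ((hsub _ _).2 hlt) ((hsub _ _).2 hlt')
      simpa only [hsub] using this)
    (fun w hw => by
      have := h1 w hw
      rw [inner_sub_right] at this
      linarith) hpu
  have e1 : inner ℝ (ξ + δ • η) (x p - x u) ≤ 0 := by
    rw [inner_add_left, inner_smul_left]
    have := mul_nonpos_of_nonneg_of_nonpos hδ.le hηp
    simp only [conj_trivial]
    linarith
  rw [inner_sub_right] at e1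
  linarith

/-- The tangent plane of a sphere is a supporting plane. -/
theorem inner_sub_pos_of_mem_sphere {c : E3} {r : ℝ} {p q : E3} (hp : p ∈ Metric.sphere c r)
    (hq : q ∈ Metric.sphere c r) (hqp : q ≠ p) : 0 < inner ℝ (c - p) (q - p) := by
  rw [mem_sphere_iff_norm] at hp hq
  have h : ‖q - c‖ ^ 2 = ‖q - p‖ ^ 2 - 2 * inner ℝ (c - p) (q - p) + ‖p - c‖ ^ 2 := by
    rw [show q - c = (q - p) - (c - p) by abel, norm_sub_sq_real, real_inner_comm, norm_sub_rev c p]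
  have : 0 < ‖q - p‖ ^ 2 := by
    have := sub_ne_zero.2 hqp
    positivity
  rw [hp, hq] at h
  linarith

theorem LinksConvex.injective [Finite V] (hK : IsClosedSurface K)
    (hX : LinksConvex K x) (hx : IsNondegenerate K x) (hconn : (edgeGraph K).Connected) {c : E3}
    {r : ℝ} (hs : ∀ v, x v ∈ Metric.sphere c r) : Function.Injective x := by
  intro p u hpu
  by_contra hne
  have := hX.inner_pos_of_forall_adj hK hx hconn (ξ := c - x u) (u := u)
    (fun w hw => inner_sub_pos_of_mem_sphere (hs u) (hs w) (hx.ne_of_adj hw).symm) hne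
  rw [hpu, sub_self, inner_zero_right] at this
  exact lt_irrefl _ this

/-- A local minimum of a linear function is a global minimum: tilting the function towards the centre
of the sphere makes the minimum strict. -/
theorem LinksConvex.inner_nonneg_of_forall_adj [Finite V] (hK : IsClosedSurface K)
    (hX : LinksConvex K x) (hx : IsNondegenerate K x) (hconn : (edgeGraph K).Connected) {c : E3}
    {r : ℝ} (hs : ∀ v, x v ∈ Metric.sphere c r) {ξ : E3} {u : V}
    (hu : ∀ w, (edgeGraph K).Adj u w → 0 ≤ inner ℝ ξ (x w - x u)) (p : V) :
    0 ≤ inner ℝ ξ (x p - x u) := by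
  rcases eq_or_ne p u with rfl | hpu
  · simp
  have hpos := inner_sub_pos_of_mem_sphere (hs u) (hs p)
    ((hX.injective hK hx hconn hs).ne hpu)
  apply le_of_forall_pos_le_add
  intro ε hε
  have := hX.inner_pos_of_forall_adj hK hx hconn
    (ξ := ξ + (ε / inner ℝ (c - x u) (x p - x u)) • (c - x u)) (u := u) (fun w hw => by
      have := inner_sub_pos_of_mem_sphere (hs u) (hs w) (hx.ne_of_adj hw).symm
      have := hu w hw
      rw [inner_add_left, inner_smul_left, conj_trivial]
      positivity) hpu
  rw [inner_add_left, inner_smul_left, conj_trivial, div_mul_cancel₀ _ hpos.ne'] at this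
  exact this.le

/-- The plane of every triangle is a supporting plane of the set of all vertices. -/
theorem LinksConvex.exists_supporting [Finite V] (hK : IsClosedSurface K)
    (hX : LinksConvex K x) (hx : IsNondegenerate K x) (hconn : (edgeGraph K).Connected) {c : E3}
    {r : ℝ} (hs : ∀ v, x v ∈ Metric.sphere c r) {u v w : V} (h : IsTriangle K u v w) :
    ∃ ξ : E3, ξ ≠ 0 ∧ inner ℝ ξ (x v - x u) = 0 ∧ inner ℝ ξ (x w - x u) = 0 ∧
      ∀ p, 0 ≤ inner ℝ ξ (x p - x u) := by
  obtain ⟨n, a, ha⟩ := hK.exists_isLinkCycle u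
  obtain ⟨a, ha, hvw⟩ := ha.exists_shift_of_isTriangle h
  obtain ⟨ξ, hξ, h1, h2⟩ := exists_ne_zero_inner_eq_zero (x v - x u) (x w - x u)
  have h01 : inner ℝ ξ (x (a 0) - x u) = 0 ∧ inner ℝ ξ (x (a 1) - x u) = 0 := by
    rcases hvw with ⟨rfl, rfl⟩ | ⟨rfl, rfl⟩
    · exact ⟨h1, h2⟩
    · exact ⟨h2, h1⟩
  have hY := hX u n a ha
  have hne : linkPolygon x u a 1 ≠ linkPolygon x u a 0 := ha.linkPolygon_succ_ne hx 0
  have y0 : inner ℝ ξ (linkPolygon x u a 0) = 0 := by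
    rw [linkPolygon, invVec, inner_smul_right, h01.1, mul_zero]
  have y1 : inner ℝ ξ (linkPolygon x u a 1) = 0 := by
    rw [linkPolygon, invVec, inner_smul_right, h01.2, mul_zero]
  have hneg : ∀ i, inner ℝ ξ (linkPolygon x u a i) < 0 ↔ inner ℝ ξ (x (a i) - x u) < 0 :=
    fun i => inner_invVec_neg_iff (hx.ne_of_adj (ha.adj i)).symm ξ
  have hpos : ∀ i, 0 < inner ℝ ξ (linkPolygon x u a i) ↔ 0 < inner ℝ ξ (x (a i) - x u) := by
    intro i
    have := inner_invVec_neg_iff (hx.ne_of_adj (ha.adj i)).symm (-ξ)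
    rwa [inner_neg_left, inner_neg_left, neg_lt_zero, neg_lt_zero] at this
  -- no two neighbours lie strictly on different sides
  have two : ∀ i j, i < n → j < n → inner ℝ ξ (linkPolygon x u a i) < 0 →
      0 < inner ℝ ξ (linkPolygon x u a j) → False := by
    intro i j hi hj hneg hpos
    have ne01 : ∀ k, inner ℝ ξ (linkPolygon x u a k) ≠ 0 → 1 < k := by
      intro k hk
      match k, hk with
      | 0, hk => exact absurd y0 hk
      | 1, hk => exact absurd y1 hk
      | k + 2, _ => omega
    -- the diagonals can only meet on the line through `y 0` and `y 1`
    have seg : ∀ k l, 1 < k → k < l → l < n →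
        inner ℝ ξ (linkPolygon x u a k) * inner ℝ ξ (linkPolygon x u a l) < 0 → False := by
      intro k l hk hkl hln hkl0
      obtain ⟨z, ⟨s, t, hs, ht, hst, rfl⟩, s', t', hs', ht', hst', he⟩ :=
        hY 0 1 k l (by omega) hk hkl hln
      have := congrArg (inner ℝ ξ) he
      simp only [inner_add_right, inner_smul_right, y0, y1, mul_zero, zero_add] at this
      have hsq : t' * (inner ℝ ξ (linkPolygon x u a l)) ^ 2 =
          t * (inner ℝ ξ (linkPolygon x u a k) * inner ℝ ξ (linkPolygon x u a l)) := by
        rw [sq, ← mul_assoc, this, mul_assoc]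
      have hl0 : inner ℝ ξ (linkPolygon x u a l) ≠ 0 := by
        intro h0; rw [h0, mul_zero] at hkl0; exact lt_irrefl _ hkl0
      have hl2 : 0 < (inner ℝ ξ (linkPolygon x u a l) : ℝ) ^ 2 := by positivity
      have ht0 : t = 0 := by
        by_contra ht0
        have := mul_neg_of_pos_of_neg (ht.lt_of_ne' ht0) hkl0
        have := mul_nonneg ht' hl2.le
        linarith
      have ht'0 : t' = 0 := by
        rw [ht0, zero_mul] at hsq
        exact (mul_eq_zero.1 hsq).resolve_right hl2.ne'
      subst ht0 ht'0
      obtain rfl : s = 1 := by linarith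
      obtain rfl : s' = 1 := by linarith
      simp only [one_smul, zero_smul, add_zero] at he
      exact hne he
    have hi1 := ne01 i hneg.ne
    have hj1 := ne01 j hpos.ne'
    rcases lt_trichotomy i j with hij | rfl | hij
    · exact seg i j hi1 hij hj (mul_neg_of_neg_of_pos hneg hpos)
    · exact lt_asymm hneg hpos
    · exact seg j i hj1 hij hi (mul_neg_of_pos_of_neg hpos hneg)
  have fin : ∀ ζ : E3, ζ ≠ 0 → inner ℝ ζ (x v - x u) = 0 → inner ℝ ζ (x w - x u) = 0 →
      (∀ i < n, 0 ≤ inner ℝ ζ (x (a i) - x u)) → ∃ ξ : E3, ξ ≠ 0 ∧ inner ℝ ξ (x v - x u) = 0 ∧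
      inner ℝ ξ (x w - x u) = 0 ∧ ∀ p, 0 ≤ inner ℝ ξ (x p - x u) := by
    intro ζ h0 h1 h2 h3
    refine ⟨ζ, h0, h1, h2, fun p => hX.inner_nonneg_of_forall_adj hK hx hconn hs ?_ p⟩
    intro q hq
    obtain ⟨i, hi, rfl⟩ := (ha.adj_iff q).1 hq
    exact h3 i hi
  by_cases hall : ∀ i < n, 0 ≤ inner ℝ ξ (x (a i) - x u)
  · exact fin ξ hξ h1 h2 hall
  · push Not at hall
    obtain ⟨i, hi, hneg'⟩ := hall
    refine fin (-ξ) (neg_ne_zero.2 hξ) (by rw [inner_neg_left, h1, neg_zero])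
      (by rw [inner_neg_left, h2, neg_zero]) fun j hj => ?_
    rw [inner_neg_left, neg_nonneg]
    by_contra! hcon
    exact two i j hi hj ((hneg i).2 hneg') ((hpos j).2 hcon)

end Morse

/-! ### Edges of surfaces with convex links do not cross -/

section Crossing

/-- Two independent vectors orthogonal to `ξ ≠ 0` span the plane `ξᗮ`. -/
theorem exists_eq_smul_add_smul {A B ξ w : E3}
    (hAB : ∀ α β : ℝ, α • A + β • B = 0 → α = 0 ∧ β = 0) (hξ : ξ ≠ 0) (hA : inner ℝ ξ A = 0)
    (hB : inner ℝ ξ B = 0) (hw : inner ℝ ξ w = 0) : ∃ α β : ℝ, w = α • A + β • B := by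
  have hle : Submodule.span ℝ (Set.range ![A, B]) ≤ (ℝ ∙ ξ)ᗮ := by
    rw [Submodule.span_le]
    rintro _ ⟨i, rfl⟩
    rw [SetLike.mem_coe, Submodule.mem_orthogonal_singleton_iff_inner_right]
    fin_cases i
    · exact hA
    · exact hB
  have : Fact (Module.finrank ℝ E3 = 2 + 1) := ⟨by simp⟩
  have hfin : Module.finrank ℝ (ℝ ∙ ξ)ᗮ = 2 := Submodule.finrank_orthogonal_span_singleton hξ
  have heq := Submodule.eq_of_le_of_finrank_eq hle (by
    rw [finrank_span_eq_card (LinearIndependent.pair_iff.2 hAB), hfin, Fintype.card_fin])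
  have hmem : w ∈ Submodule.span ℝ (Set.range ![A, B]) := by
    rw [heq, Submodule.mem_orthogonal_singleton_iff_inner_right]
    exact hw
  rw [Matrix.range_cons, Matrix.range_cons, Matrix.range_empty, Set.union_empty,
    Set.singleton_union, Submodule.mem_span_pair] at hmem
  obtain ⟨α, β, h⟩ := hmem
  exact ⟨α, β, h.symm⟩

variable {c : E3} {r : ℝ}

theorem eq_zero_of_mem_sphere {p q s : E3} (hp : p ∈ Metric.sphere c r)
    (hq : q ∈ Metric.sphere c r) (hs : s ∈ Metric.sphere c r) (hqp : q ≠ p) (hsp : s ≠ p)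
    (hqs : q ≠ s) (α β : ℝ) (h : α • (q - p) + β • (s - p) = 0) : α = 0 ∧ β = 0 := by
  refine eq_zero_of_affineIndependent (p := p) ?_ h
  apply EuclideanGeometry.Cospherical.affineIndependent_of_ne _ hqp.symm hsp.symm hqs
  refine ⟨c, r, ?_⟩
  rintro _ (rfl | rfl | rfl)
  · exact hp
  · exact hq
  · exact hs

/-- A point of a line through two points of a sphere that lies in the ball lies between them. -/
theorem mem_Icc_of_mem_closedBall {p q : E3} (hp : p ∈ Metric.sphere c r)
    (hq : q ∈ Metric.sphere c r) (hqp : q ≠ p) {κ : ℝ}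
    (h : p + κ • (q - p) ∈ Metric.closedBall c r) : 0 ≤ κ ∧ κ ≤ 1 := by
  rw [mem_sphere_iff_norm] at hp hq
  rw [mem_closedBall_iff_norm] at h
  have hpos : 0 < ‖q - p‖ ^ 2 := by
    have := sub_ne_zero.2 hqp
    positivity
  have e1 : ‖q - c‖ ^ 2 = ‖p - c‖ ^ 2 + 2 * inner ℝ (p - c) (q - p) + ‖q - p‖ ^ 2 := by
    rw [← norm_add_sq_real]; congr 2; abel
  have e2 : ‖p + κ • (q - p) - c‖ ^ 2 =
      ‖p - c‖ ^ 2 + 2 * (κ * inner ℝ (p - c) (q - p)) + κ ^ 2 * ‖q - p‖ ^ 2 := by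
    rw [show p + κ • (q - p) - c = (p - c) + κ • (q - p) by abel, norm_add_sq_real,
      inner_smul_right, norm_smul, mul_pow, Real.norm_eq_abs, sq_abs]
  have e3 : ‖p + κ • (q - p) - c‖ ^ 2 ≤ r ^ 2 := pow_le_pow_left₀ (norm_nonneg _) h 2
  rw [hp, hq] at e1
  rw [e2, hp] at e3
  have e4 : κ * (κ - 1) * ‖q - p‖ ^ 2 ≤ 0 := by linear_combination e3 + κ * e1
  have e5 : κ * (κ - 1) ≤ 0 := by
    by_contra! hcon
    have := mul_pos hcon hpos
    linarith
  constructor <;> nlinarith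

theorem mem_segment_of_mem_closedBall {p q : E3} (hp : p ∈ Metric.sphere c r)
    (hq : q ∈ Metric.sphere c r) (hqp : q ≠ p) {κ : ℝ}
    (h : p + κ • (q - p) ∈ Metric.closedBall c r) : p + κ • (q - p) ∈ segment ℝ p q := by
  obtain ⟨h0, h1⟩ := mem_Icc_of_mem_closedBall hp hq hqp h
  exact ⟨1 - κ, κ, by linarith, h0, by ring, by module⟩

theorem segment_subset_closedBall {p q : E3} (hp : p ∈ Metric.sphere c r)
    (hq : q ∈ Metric.sphere c r) : segment ℝ p q ⊆ Metric.closedBall c r :=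
  (convex_closedBall c r).segment_subset (Metric.sphere_subset_closedBall hp)
    (Metric.sphere_subset_closedBall hq)

/-- The points of a sphere are in convex position. -/
theorem eq_of_sum_smul_mem_sphere {ι : Type*} {s : Finset ι} {w : ι → ℝ} {y : ι → E3} {p : E3}
    (hp : p ∈ Metric.sphere c r) (hy : ∀ i ∈ s, y i ∈ Metric.sphere c r)
    (hw : ∀ i ∈ s, 0 ≤ w i) (h1 : ∑ i ∈ s, w i = 1) (h : ∑ i ∈ s, w i • y i = p) :
    ∀ i ∈ s, w i ≠ 0 → y i = p := by
  have hnn : ∀ i ∈ s, 0 ≤ inner ℝ (c - p) (y i - p) := by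
    intro i hi
    rcases eq_or_ne (y i) p with he | he
    · rw [he, sub_self, inner_zero_right]
    · exact (inner_sub_pos_of_mem_sphere hp (hy i hi) he).le
  have h0 : ∑ i ∈ s, w i * inner ℝ (c - p) (y i - p) = 0 := by
    have : ∑ i ∈ s, w i • (y i - p) = 0 := by
      simp only [smul_sub, Finset.sum_sub_distrib]
      rw [h, ← Finset.sum_smul, h1, one_smul, sub_self]
    have := congrArg (inner ℝ (c - p)) this
    rw [inner_sum, inner_zero_right] at this
    simpa only [inner_smul_right] using this
  rw [Finset.sum_eq_zero_iff_of_nonneg fun i hi => mul_nonneg (hw i hi) (hnn i hi)] at h0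
  intro i hi hwi
  by_contra hne
  exact (inner_sub_pos_of_mem_sphere hp (hy i hi) hne).ne'
    ((mul_eq_zero.1 (h0 i hi)).resolve_left hwi)

theorem eq_or_eq_of_mem_segment {p q s : E3} (hp : p ∈ Metric.sphere c r)
    (hq : q ∈ Metric.sphere c r) (hs : s ∈ Metric.sphere c r) (h : p ∈ segment ℝ q s) :
    p = q ∨ p = s := by
  obtain ⟨α, β, hα, hβ, hαβ, rfl⟩ := h
  have := eq_of_sum_smul_mem_sphere (s := Finset.univ) (w := ![α, β]) (y := ![q, s]) hp
    (by intro i _; fin_cases i <;> assumption) (by intro i _; fin_cases i <;> assumption)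
    (by simpa [Fin.sum_univ_two] using hαβ) (by simp [Fin.sum_univ_two])
  by_cases h0 : α = 0
  · right
    have hβ1 : β ≠ 0 := by rintro rfl; rw [h0, add_zero] at hαβ; exact zero_ne_one hαβ
    simpa using (this 1 (Finset.mem_univ _) (by simpa using hβ1)).symm
  · left
    simpa using (this 0 (Finset.mem_univ _) (by simpa using h0)).symm

/-- If the chord `p q` of a sphere meets the ray from `v` towards `u`, and `p` lies beyond the line
`v a`, then the chord meets `v a`. -/
theorem segment_inter_nonempty_of_beyond {u v a p q z : E3} (hv : v ∈ Metric.sphere c r)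
    (ha : a ∈ Metric.sphere c r) (hp : p ∈ Metric.sphere c r) (hq : q ∈ Metric.sphere c r)
    (hav : a ≠ v) {α β s : ℝ} (hpc : p - v = α • (u - v) + β • (a - v)) (hα : α < 0) (hs : 0 ≤ s)
    (hz : z - v = s • (u - v)) (hzpq : z ∈ segment ℝ p q) :
    (segment ℝ v a ∩ segment ℝ p q).Nonempty := by
  have hsα : 0 < s - α := by linarith
  set τ := -α / (s - α) with hτ
  have h0 : 0 ≤ τ := div_nonneg (by linarith) hsα.le
  have h1 : τ ≤ 1 := by rw [hτ, div_le_one hsα]; linarith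
  have hm : (1 - τ) • p + τ • z ∈ segment ℝ p q :=
    (convex_segment p q).segment_subset (left_mem_segment ℝ p q) hzpq
      ⟨1 - τ, τ, by linarith, h0, by ring, rfl⟩
  have he : (1 - τ) • p + τ • z = v + ((1 - τ) * β) • (a - v) := by
    have e1 : p = v + (α • (u - v) + β • (a - v)) := by rw [← hpc]; abel
    have e2 : z = v + s • (u - v) := by rw [← hz]; abel
    have e3 : (1 - τ) * α + τ * s = 0 := by rw [hτ]; field_simp; ring
    calc (1 - τ) • p + τ • z
        = v + ((1 - τ) * α + τ * s) • (u - v) + ((1 - τ) * β) • (a - v) := by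
          rw [e1, e2]; module
      _ = _ := by rw [e3, zero_smul, add_zero]
  rw [he] at hm
  exact ⟨_, mem_segment_of_mem_closedBall hv ha hav (segment_subset_closedBall hp hq hm), hm⟩

theorem inner_invVec_of_mem_sphere {p q : E3} (hp : p ∈ Metric.sphere c r)
    (hq : q ∈ Metric.sphere c r) (hqp : q ≠ p) : 2 * inner ℝ (c - p) (invVec p q) = 1 := by
  rw [mem_sphere_iff_norm] at hp hq
  have h : ‖q - c‖ ^ 2 = ‖q - p‖ ^ 2 - 2 * inner ℝ (c - p) (q - p) + ‖p - c‖ ^ 2 := by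
    rw [show q - c = (q - p) - (c - p) by abel, norm_sub_sq_real, real_inner_comm, norm_sub_rev c p]
  have : ‖q - p‖ ^ 2 ≠ 0 := by
    have := sub_ne_zero.2 hqp
    positivity
  rw [hp, hq] at h
  rw [invVec, inner_smul_right, mul_left_comm, inv_mul_eq_one₀ this]
  linarith

variable {V : Type*} [DecidableEq V] {K : AbstractSimplicialComplex V} {x : V → E3}

/-- The edge from `p` to `q` does not cross the opposite edge of a triangle at `p`. Otherwise the
inverted link of `p` has the vertex `q` in the interior of the side `u v`, while some other vertex
lies off the plane of `p`, `u`, `v`; then a pair of diagonals does not meet. -/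
theorem LinksConvex.not_crossing_opposite_edge [Finite V] (hK : IsClosedSurface K)
    (hX : LinksConvex K x) (hx : IsNondegenerate K x) (hconn : (edgeGraph K).Connected)
    (hcop : ¬ Coplanar ℝ (Set.range x)) (hs : ∀ v, x v ∈ Metric.sphere c r) {p q u v : V}
    (hT : IsTriangle K p u v) (hpq : (edgeGraph K).Adj p q) (huq : u ≠ q) (hvq : v ≠ q) :
    ¬ (segment ℝ (x u) (x v) ∩ segment ℝ (x p) (x q)).Nonempty := by
  intro hmeet
  have hinj := hX.injective hK hx hconn hs
  obtain ⟨n, a, ha⟩ := hK.exists_isLinkCycle p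
  obtain ⟨a, ha, hvw⟩ := ha.exists_shift_of_isTriangle hT
  wlog h01 : a 0 = u ∧ a 1 = v generalizing u v
  · exact this (u := v) (v := u) hT.rotate.swap.rotate.rotate hvq huq
      (by rwa [segment_symm ℝ (x v)]) hvw.symm (hvw.resolve_left h01)
  obtain ⟨rfl, rfl⟩ := h01
  obtain ⟨z, ⟨s₁, s₂, hs₁, hs₂, hs₁₂, rfl⟩, t₁, t₂, ht₁, ht₂, ht₁₂, hz⟩ := hmeet
  obtain ⟨k, hkn, rfl⟩ := (ha.adj_iff q).1 hpq
  have hk : 1 < k := by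
    match k, huq, hvq with
    | 0, h, _ => exact absurd rfl h
    | 1, _, h => exact absurd rfl h
    | k + 2, _, _ => omega
  have hs₁0 : s₁ ≠ 0 := by
    rintro rfl
    obtain rfl : s₂ = 1 := by linarith
    rw [zero_smul, zero_add, one_smul] at hz
    rcases eq_or_eq_of_mem_segment (hs _) (hs _) (hs _) ⟨t₁, t₂, ht₁, ht₂, ht₁₂, hz⟩ with h | h
    · exact hT.2.1 (hinj h).symm
    · exact hvq (hinj h)
  have hs₂0 : s₂ ≠ 0 := by
    rintro rfl
    obtain rfl : s₁ = 1 := by linarith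
    rw [zero_smul, add_zero, one_smul] at hz
    rcases eq_or_eq_of_mem_segment (hs _) (hs _) (hs _) ⟨t₁, t₂, ht₁, ht₂, ht₁₂, hz⟩ with h | h
    · exact hT.1 (hinj h).symm
    · exact huq (hinj h)
  -- in the inverted link of `p`, the vertex `q` lies inside the side from `u` to `v`
  have hy : ∀ i, x (a i) - x p = (‖x (a i) - x p‖ ^ 2) • linkPolygon x p a i := by
    intro i
    have : ‖x (a i) - x p‖ ^ 2 ≠ 0 := by
      have := sub_ne_zero.2 (hx.ne_of_adj (ha.adj i)).symm
      positivity
    rw [linkPolygon, invVec, smul_smul, mul_inv_cancel₀ this, one_smul]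
  have hnorm : ∀ i, 0 < ‖x (a i) - x p‖ ^ 2 := by
    intro i
    have := sub_ne_zero.2 (hx.ne_of_adj (ha.adj i)).symm
    positivity
  have hsph : ∀ i, 2 * inner ℝ (c - x p) (linkPolygon x p a i) = 1 := fun i =>
    inner_invVec_of_mem_sphere (hs _) (hs _) (hx.ne_of_adj (ha.adj i)).symm
  have e1 : s₁ • (x (a 0) - x p) + s₂ • (x (a 1) - x p) = t₂ • (x (a k) - x p) := by
    obtain rfl : s₁ = 1 - s₂ := by linarith
    obtain rfl : t₁ = 1 - t₂ := by linarith
    have := sub_eq_zero.2 hz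
    rw [← sub_eq_zero]
    rw [← neg_eq_zero, ← this]
    module
  rw [hy 0, hy 1, hy k, smul_smul, smul_smul, smul_smul] at e1
  set l₀ := s₁ * ‖x (a 0) - x p‖ ^ 2
  set l₁ := s₂ * ‖x (a 1) - x p‖ ^ 2
  set m := t₂ * ‖x (a k) - x p‖ ^ 2
  have hl₀ : 0 < l₀ := mul_pos (hs₁.lt_of_ne' hs₁0) (hnorm 0)
  have hl₁ : 0 < l₁ := mul_pos (hs₂.lt_of_ne' hs₂0) (hnorm 1)
  have hm : m = l₀ + l₁ := by
    have := congrArg (inner ℝ (c - x p)) e1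
    simp only [inner_add_right, inner_smul_right] at this
    have h0 := hsph 0
    have h1 := hsph 1
    have hk := hsph k
    linear_combination l₀ * h0 + l₁ * h1 - m * hk - 2 * this
  clear_value l₀ l₁ m
  have hne : linkPolygon x p a 1 - linkPolygon x p a 0 ≠ 0 :=
    sub_ne_zero.2 (ha.linkPolygon_succ_ne hx 0)
  have d0 : m • (linkPolygon x p a k - linkPolygon x p a 0) =
      l₁ • (linkPolygon x p a 1 - linkPolygon x p a 0) := by
    rw [smul_sub, ← e1, hm]; module
  have d1 : m • (linkPolygon x p a k - linkPolygon x p a 1) =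
      (-l₀) • (linkPolygon x p a 1 - linkPolygon x p a 0) := by
    rw [smul_sub, ← e1, hm]; module
  -- a neighbour off the plane of the triangle
  obtain ⟨ξ, hξ, h0, h1⟩ := exists_ne_zero_inner_eq_zero (linkPolygon x p a 0)
    (linkPolygon x p a 1)
  have hk0 : inner ℝ ξ (linkPolygon x p a k) = 0 := by
    have := congrArg (inner ℝ ξ) e1
    simp only [inner_add_right, inner_smul_right, h0, h1, mul_zero, add_zero] at this
    exact (mul_eq_zero.1 this.symm).resolve_left (by rw [hm]; positivity)
  obtain ⟨w, hw, hwne⟩ := hX.exists_inner_ne_zero hK hx hconn hcop p hξ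
  obtain ⟨j, hjn, rfl⟩ := (ha.adj_iff w).1 hw
  rw [hy j, inner_smul_right] at hwne
  have hj0 : inner ℝ ξ (linkPolygon x p a j) ≠ 0 := (mul_ne_zero_iff.1 hwne).2
  have hj : 1 < j := by
    match j, hj0 with
    | 0, h => exact absurd h0 h
    | 1, h => exact absurd h1 h
    | j + 2, _ => omega
  have hY := hX p n a ha
  have cancel : ∀ {κ : ℝ}, κ • (linkPolygon x p a 1 - linkPolygon x p a 0) = 0 → κ = 0 :=
    fun h => (smul_eq_zero.1 h).resolve_right hne
  rcases lt_trichotomy k j with hkj | rfl | hjk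
  · obtain ⟨z, ⟨α, β, hα, hβ, hαβ, rfl⟩, α', β', hα', hβ', hαβ', he⟩ :=
      hY 0 1 k j (by omega) hk hkj hjn
    have := congrArg (inner ℝ ξ) he
    simp only [inner_add_right, inner_smul_right, h0, h1, hk0, mul_zero, add_zero, zero_add] at this
    obtain rfl : β' = 0 := (mul_eq_zero.1 this).resolve_right hj0
    obtain rfl : α' = 1 := by linarith
    obtain rfl : α = 1 - β := by linarith
    have e : m • (linkPolygon x p a 1 - linkPolygon x p a 0) =
        (β * l₁) • (linkPolygon x p a 1 - linkPolygon x p a 0) := by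
      have h : linkPolygon x p a 1 - linkPolygon x p a 0 =
          β • (linkPolygon x p a k - linkPolygon x p a 0) := by
        rw [zero_smul, add_zero, one_smul] at he
        rw [he]; module
      rw [mul_smul, ← d0, smul_comm β m, ← h]
    have := cancel (κ := m - β * l₁) (by rw [sub_smul, e, sub_self])
    nlinarith
  · exact hj0 hk0
  · obtain ⟨z, ⟨α, β, hα, hβ, hαβ, rfl⟩, α', β', hα', hβ', hαβ', he⟩ :=
      hY 0 1 j k (by omega) hj hjk hkn
    have := congrArg (inner ℝ ξ) he
    simp only [inner_add_right, inner_smul_right, h0, h1, hk0, mul_zero, add_zero, zero_add] at this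
    obtain rfl : β = 0 := (mul_eq_zero.1 this.symm).resolve_right hj0
    obtain rfl : α = 1 := by linarith
    obtain rfl : α' = 1 - β' := by linarith
    have e : m • (linkPolygon x p a 1 - linkPolygon x p a 0) =
        (β' * l₀) • (linkPolygon x p a 1 - linkPolygon x p a 0) := by
      have h : linkPolygon x p a 1 - linkPolygon x p a 0 =
          -(β' • (linkPolygon x p a k - linkPolygon x p a 1)) := by
        rw [zero_smul, add_zero, one_smul] at he
        rw [← he]; module
      rw [mul_smul, ← neg_neg (l₀ • (linkPolygon x p a 1 - linkPolygon x p a 0)), ← neg_smul, ← d1,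
        smul_neg, smul_comm β' m, ← smul_neg, ← h]
    have := cancel (κ := m - β' * l₀) (by rw [sub_smul, e, sub_self])
    nlinarith

/-- The reduction step for crossing edges: if `p q` crosses the side `u v` of the triangle `u v w`
from the side of `w`, then it also crosses one of the other two sides. -/
theorem LinksConvex.crossing_other_side [Finite V] (hK : IsClosedSurface K)
    (hX : LinksConvex K x) (hx : IsNondegenerate K x) (hconn : (edgeGraph K).Connected)
    (hcop : ¬ Coplanar ℝ (Set.range x)) (hs : ∀ v, x v ∈ Metric.sphere c r) {p q u v w : V}
    (hT : IsTriangle K u v w) (hpq : (edgeGraph K).Adj p q) (hup : u ≠ p) (huq : u ≠ q)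
    (hvp : v ≠ p) (hvq : v ≠ q) (hmeet : (segment ℝ (x u) (x v) ∩ segment ℝ (x p) (x q)).Nonempty)
    {α β : ℝ} (hp : x p - x v = α • (x u - x v) + β • (x w - x v)) (hβ : 0 < β) :
    w ≠ p ∧ ((segment ℝ (x u) (x w) ∩ segment ℝ (x p) (x q)).Nonempty ∨
      (segment ℝ (x v) (x w) ∩ segment ℝ (x p) (x q)).Nonempty) := by
  have hinj := hX.injective hK hx hconn hs
  have hwp : w ≠ p := by
    rintro rfl
    exact hX.not_crossing_opposite_edge hK hx hconn hcop hs hT.rotate.rotate hpq huq hvq hmeet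
  refine ⟨hwp, ?_⟩
  obtain ⟨z, ⟨s₁, s₂, hs₁, hs₂, hs₁₂, rfl⟩, hz⟩ := hmeet
  have hzv : s₁ • x u + s₂ • x v - x v = s₁ • (x u - x v) := by
    obtain rfl : s₂ = 1 - s₁ := by linarith
    module
  have hzu : s₁ • x u + s₂ • x v - x u = s₂ • (x v - x u) := by
    obtain rfl : s₁ = 1 - s₂ := by linarith
    module
  by_cases hα : α < 0
  · right
    exact segment_inter_nonempty_of_beyond (hs v) (hs w) (hs p) (hs q)
      (hinj.ne hT.2.2.1.symm) hp hα hs₁ hzv hz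
  by_cases hα' : 1 - α - β < 0
  · left
    refine segment_inter_nonempty_of_beyond (β := β) (hs u) (hs w) (hs p) (hs q)
      (hinj.ne hT.2.1.symm) ?_ hα' hs₂ hzu hz
    have : x p = x v + (α • (x u - x v) + β • (x w - x v)) := by rw [← hp]; abel
    rw [this]
    module
  · -- `p` would lie in the triangle `u v w`
    exfalso
    push Not at hα hα'
    have := eq_of_sum_smul_mem_sphere (s := Finset.univ) (w := ![1 - α - β, α, β])
      (y := ![x v, x u, x w]) (hs p) (by intro i _; fin_cases i <;> exact hs _)
      (by intro i _; fin_cases i; exacts [hα', hα, hβ.le])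
      (by simp only [Fin.sum_univ_three, Matrix.cons_val]; ring)
      (by
        simp only [Fin.sum_univ_three, Matrix.cons_val]
        have : x p = x v + (α • (x u - x v) + β • (x w - x v)) := by rw [← hp]; abel
        rw [this]
        module) 2 (Finset.mem_univ _) (by simpa using hβ.ne')
    exact hwp (hinj (by simpa using this))

/-- Two edges without a common vertex do not meet. Otherwise choose a crossing for which the first
edge `u v` is as short as possible. Both triangles at `u v` lie in the face of the convex hull that
contains the crossing. By the convexity of the links the apex `w` of one of them is joined to `u`
and to `v` by edges shorter than `u v`, and one of these edges is also crossed by `p q`. -/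
theorem LinksConvex.not_crossing [Finite V] (hK : IsClosedSurface K)
    (hX : LinksConvex K x) (hx : IsNondegenerate K x) (hconn : (edgeGraph K).Connected)
    (hcop : ¬ Coplanar ℝ (Set.range x)) (hs : ∀ v, x v ∈ Metric.sphere c r) {u v p q : V}
    (huv : (edgeGraph K).Adj u v) (hpq : (edgeGraph K).Adj p q) (hup : u ≠ p) (huq : u ≠ q)
    (hvp : v ≠ p) (hvq : v ≠ q) :
    ¬ (segment ℝ (x u) (x v) ∩ segment ℝ (x p) (x q)).Nonempty := by
  intro hmeet
  have hinj := hX.injective hK hx hconn hs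
  obtain ⟨⟨u, v, p, q⟩, ⟨huv, hpq, hup, huq, hvp, hvq, hmeet⟩, hmin⟩ := Set.exists_min_image
    {e : V × V × V × V | (edgeGraph K).Adj e.1 e.2.1 ∧ (edgeGraph K).Adj e.2.2.1 e.2.2.2 ∧
      e.1 ≠ e.2.2.1 ∧ e.1 ≠ e.2.2.2 ∧ e.2.1 ≠ e.2.2.1 ∧ e.2.1 ≠ e.2.2.2 ∧
      (segment ℝ (x e.1) (x e.2.1) ∩ segment ℝ (x e.2.2.1) (x e.2.2.2)).Nonempty}
    (fun e => dist (x e.1) (x e.2.1)) (Set.toFinite _)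
    ⟨(u, v, p, q), huv, hpq, hup, huq, hvp, hvq, hmeet⟩
  dsimp only at huv hpq hup huq hvp hvq hmeet hmin
  obtain ⟨z, ⟨s₁, s₂, hs₁, hs₂, hs₁₂, hzuv⟩, t₁, t₂, ht₁, ht₂, ht₁₂, hzpq⟩ := id hmeet
  have ht₁0 : t₁ ≠ 0 := by
    rintro rfl
    obtain rfl : t₂ = 1 := by linarith
    rw [zero_smul, zero_add, one_smul] at hzpq
    rw [← hzpq] at hzuv
    rcases eq_or_eq_of_mem_segment (hs q) (hs u) (hs v) ⟨s₁, s₂, hs₁, hs₂, hs₁₂, hzuv⟩ with h | h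
    · exact huq (hinj h).symm
    · exact hvq (hinj h).symm
  have ht₂0 : t₂ ≠ 0 := by
    rintro rfl
    obtain rfl : t₁ = 1 := by linarith
    rw [zero_smul, add_zero, one_smul] at hzpq
    rw [← hzpq] at hzuv
    rcases eq_or_eq_of_mem_segment (hs p) (hs u) (hs v) ⟨s₁, s₂, hs₁, hs₂, hs₁₂, hzuv⟩ with h | h
    · exact hup (hinj h).symm
    · exact hvp (hinj h).symm
  have ht₁pos := ht₁.lt_of_ne' ht₁0
  have ht₂pos := ht₂.lt_of_ne' ht₂0
  have hzv : t₁ • (x p - x v) + t₂ • (x q - x v) = s₁ • (x u - x v) := by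
    have e1 : s₁ • (x u - x v) = z - x v := by
      obtain rfl : s₂ = 1 - s₁ := by linarith
      rw [← hzuv]; module
    rw [e1, ← hzpq]
    obtain rfl : t₁ = 1 - t₂ := by linarith
    module
  -- a supporting plane through `u v` contains `p` and `q`
  have hface : ∀ ξ : E3, inner ℝ ξ (x u - x v) = 0 → (∀ p, 0 ≤ inner ℝ ξ (x p - x v)) →
      inner ℝ ξ (x p - x v) = 0 ∧ inner ℝ ξ (x q - x v) = 0 := by
    intro ξ h1 h2
    have := congrArg (inner ℝ ξ) hzv
    simp only [inner_add_right, inner_smul_right, h1, mul_zero] at this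
    have hp := mul_nonneg ht₁ (h2 p)
    have hq := mul_nonneg ht₂ (h2 q)
    have hp0 : t₁ * inner ℝ ξ (x p - x v) = 0 := by linarith
    have hq0 : t₂ * inner ℝ ξ (x q - x v) = 0 := by linarith
    exact ⟨(mul_eq_zero.1 hp0).resolve_left ht₁0, (mul_eq_zero.1 hq0).resolve_left ht₂0⟩
  obtain ⟨n, a, ha⟩ := hK.exists_isLinkCycle v
  obtain ⟨a, ha, rfl⟩ := ha.exists_shift_one huv.symm
  have T0 : IsTriangle K v (a 0) (a 1) := ha.isTriangle 0
  have T2 : IsTriangle K v (a 1) (a 2) := ha.isTriangle 1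
  obtain ⟨ξ, hξ, hξ0, hξ1, hξs⟩ := hX.exists_supporting hK hx hconn hs T0
  obtain ⟨ζ, hζ, hζ1, hζ2, hζs⟩ := hX.exists_supporting hK hx hconn hs T2
  obtain ⟨hξp, hξq⟩ := hface ξ hξ1 hξs
  obtain ⟨hζp, hζq⟩ := hface ζ hζ1 hζs
  have hξ2 : inner ℝ ξ (x (a 2) - x v) = 0 := by
    obtain ⟨α, β, he⟩ := exists_eq_smul_add_smul (eq_zero_of_mem_sphere (hs v) (hs (a 1)) (hs p)
      (hinj.ne T0.2.1.symm) (hinj.ne hvp.symm) (hinj.ne hup)) hζ hζ1 hζp hζ2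
    rw [he, inner_add_right, inner_smul_right, inner_smul_right, hξ1, hξp]
    ring
  obtain ⟨w, hw, hlt1, hlt2⟩ := exists_shorter_of_mem_segment (hinj.ne T0.2.1.symm)
    (hinj.ne T0.2.2.1) (hinj.ne T0.1.symm) (hinj.ne T2.2.2.1.symm) (hinj.ne T2.2.1.symm)
    (hX.mem_segment_of_coplanar hK hx hconn hcop ha hξ hξ0 hξ1 hξ2)
  obtain ⟨w, rfl, hT, hξw⟩ : ∃ w', x w' = w ∧ IsTriangle K (a 1) v w' ∧
      inner ℝ ξ (x w' - x v) = 0 := by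
    rcases hw with rfl | rfl
    · exact ⟨_, rfl, T0.rotate.rotate, hξ0⟩
    · exact ⟨_, rfl, T2.swap, hξ2⟩
  have hli := eq_zero_of_mem_sphere (hs v) (hs (a 1)) (hs w) (hinj.ne T0.2.1.symm)
    (hinj.ne hT.2.2.1.symm) (hinj.ne hT.2.1)
  obtain ⟨α, β, hp⟩ := exists_eq_smul_add_smul hli hξ hξ1 hξw hξp
  obtain ⟨α', β', hq⟩ := exists_eq_smul_add_smul hli hξ hξ1 hξw hξq
  have hβ : t₁ * β + t₂ * β' = 0 := by
    refine (hli (t₁ * α + t₂ * α' - s₁) _ ?_).2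
    rw [hp, hq] at hzv
    rw [← sub_eq_zero.2 hzv]
    module
  have hβ0 : β ≠ 0 := by
    rintro rfl
    have := eq_zero_of_mem_sphere (hs v) (hs (a 1)) (hs p) (hinj.ne T0.2.1.symm)
      (hinj.ne hvp.symm) (hinj.ne hup) α (-1) (by rw [hp]; module)
    linarith [this.2]
  have hwpos : ∀ {y : V} {α β : ℝ}, x y - x v = α • (x (a 1) - x v) + β • (x w - x v) → β < 0 →
      w ≠ y := by
    rintro y α β he hβ rfl
    have := hli α (β - 1) (by
      rw [sub_smul, one_smul, ← add_sub_assoc, ← he, sub_self])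
    linarith [this.2]
  have fin : ∀ p q, (edgeGraph K).Adj p q → a 1 ≠ p → a 1 ≠ q → v ≠ p → v ≠ q →
      (segment ℝ (x (a 1)) (x v) ∩ segment ℝ (x p) (x q)).Nonempty → ∀ α β : ℝ,
      x p - x v = α • (x (a 1) - x v) + β • (x w - x v) → 0 < β → w ≠ q → False := by
    intro p q hpq hup huq hvp hvq hmeet α β hp hβ hwq
    obtain ⟨hwp, h | h⟩ := hX.crossing_other_side hK hx hconn hcop hs hT hpq hup huq hvp hvq hmeet
      hp hβ
    · exact absurd (hmin (a 1, w, p, q) ⟨hT.rotate.rotate.swap.adj, hpq, hup, huq, hwp, hwq, h⟩)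
        (not_le.2 hlt1)
    · have := hmin (v, w, p, q) ⟨hT.rotate.adj, hpq, hvp, hvq, hwp, hwq, h⟩
      dsimp only at this
      rw [dist_comm (x v)] at this
      exact absurd this (not_le.2 hlt2)
  rcases lt_or_gt_of_ne hβ0 with hneg | hpos
  · have hpos' : 0 < β' := by
      by_contra! hcon
      have := mul_neg_of_pos_of_neg ht₁pos hneg
      have := mul_nonpos_of_nonneg_of_nonpos ht₂ hcon
      linarith
    exact fin q p hpq.symm huq hup hvq hvp (by rwa [segment_symm ℝ (x q)]) α' β' hq hpos'
      (hwpos hp hneg)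
  · have hneg' : β' < 0 := by
      by_contra! hcon
      have := mul_pos ht₁pos hpos
      have := mul_nonneg ht₂ hcon
      linarith
    exact fin p q hpq hup huq hvp hvq hmeet α β hp hpos (hwpos hq hneg')

end Crossing

/-! ### Surfaces with convex links are embedded -/

section Embedding

theorem realize_mem_convexHull {V : Type*} [Fintype V] {K : AbstractSimplicialComplex V} {x : V → E3}
    {ω : V → ℝ} (hω : ω ∈ space K) :
    realize x ω ∈ convexHull ℝ (Set.range x) :=
  (convex_convexHull ℝ _).sum_mem (fun v _ => hω.1 v) hω.2.1
    fun v _ => subset_convexHull ℝ _ ⟨v, rfl⟩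

theorem isClosed_convexHull_range {V : Type*} [Finite V] (x : V → E3) :
    IsClosed (convexHull ℝ (Set.range x)) :=
  (Set.finite_range x).isClosed_convexHull ℝ

variable {V : Type*} [DecidableEq V] {K : AbstractSimplicialComplex V} {x : V → E3}

/-- The geometric properties of a surface with convex links that make it the boundary of a convex
polyhedron: the vertices are distinct points of a sphere, the planes of the triangles are supporting
planes, and edges without a common vertex do not meet. -/
structure IsFaceted (K : AbstractSimplicialComplex V) (x : V → E3) (c : E3) (r : ℝ) : Prop where
  mem_sphere : ∀ v, x v ∈ Metric.sphere c r
  injective : Function.Injective x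
  supporting : ∀ u v w, IsTriangle K u v w → ∃ ξ : E3, ξ ≠ 0 ∧ inner ℝ ξ (x v - x u) = 0 ∧
    inner ℝ ξ (x w - x u) = 0 ∧ ∀ p, 0 ≤ inner ℝ ξ (x p - x u)
  not_crossing : ∀ u v p q, (edgeGraph K).Adj u v → (edgeGraph K).Adj p q → u ≠ p → u ≠ q →
    v ≠ p → v ≠ q → ¬ (segment ℝ (x u) (x v) ∩ segment ℝ (x p) (x q)).Nonempty

theorem LinksConvex.exists_isFaceted [Finite V] (hK : IsClosedSurface K)
    (hX : LinksConvex K x) (hx : IsNondegenerate K x) (hconn : (edgeGraph K).Connected)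
    (hcop : ¬ Coplanar ℝ (Set.range x)) : ∃ c r, IsFaceted K x c r := by
  obtain ⟨c, r, hs⟩ := hX.exists_sphere hK hx hconn hcop
  exact ⟨c, r, hs, hX.injective hK hx hconn hs,
    fun u v w h => hX.exists_supporting hK hx hconn hs h,
    fun u v p q => hX.not_crossing hK hx hconn hcop hs⟩

/-- Every face is contained in a triangle. -/
theorem IsClosedSurface.exists_isTriangle_superset [Finite V] (hK : IsClosedSurface K)
    {s : Finset V} (hs : s ∈ K.faces) : ∃ u v w, IsTriangle K u v w ∧ s ⊆ {u, v, w} := by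
  have h3 := hK.card_le_three s hs
  have hne : s.Nonempty := (K.isRelLowerSet_faces hs).1
  have h0 := hne.card_pos
  obtain h | h | h : s.card = 1 ∨ s.card = 2 ∨ s.card = 3 := by omega
  · obtain ⟨v, rfl⟩ := Finset.card_eq_one.1 h
    obtain ⟨n, a, ha⟩ := hK.exists_isLinkCycle v
    exact ⟨_, _, _, ha.isTriangle 0, by simp⟩
  · obtain ⟨u, v, huv, rfl⟩ := Finset.card_eq_two.1 h
    obtain ⟨n, a, ha⟩ := hK.exists_isLinkCycle u
    obtain ⟨a, ha, rfl⟩ := ha.exists_shift (u := v) ⟨huv, hs⟩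
    exact ⟨_, _, _, ha.isTriangle 0, by intro; simp; tauto⟩
  · obtain ⟨u, v, w, h1, h2, h4, rfl⟩ := Finset.card_eq_three.1 h
    exact ⟨u, v, w, ⟨h1, h2, h4, hs⟩, subset_rfl⟩

theorem sum_eq_of_support [Fintype V] {M : Type*} [AddCommMonoid M] {u v w : V} (huv : u ≠ v)
    (huw : u ≠ w) (hvw : v ≠ w) {f : V → M} (h : ∀ p, p ∉ ({u, v, w} : Finset V) → f p = 0) :
    ∑ p, f p = f u + f v + f w := by
  rw [← Finset.sum_subset (Finset.subset_univ {u, v, w}) fun p _ hp => h p hp,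
    Finset.sum_insert (by simp [huv, huw]), Finset.sum_pair hvw, add_assoc]

theorem realize_eq_of_support [Fintype V] {u v w : V} (huv : u ≠ v)
    (huw : u ≠ w) (hvw : v ≠ w) {ω : V → ℝ} (h : ∀ p, p ∉ ({u, v, w} : Finset V) → ω p = 0) :
    realize x ω = ω u • x u + ω v • x v + ω w • x w :=
  sum_eq_of_support huv huw hvw fun p hp => by rw [h p hp, zero_smul]

/-- The point of the underlying space with given barycentric coordinates in a triangle. -/
theorem IsTriangle.exists_mem_space [Fintype V] {u v w : V} (h : IsTriangle K u v w) (x : V → E3)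
    {α β γ : ℝ} (hα : 0 ≤ α) (hβ : 0 ≤ β) (hγ : 0 ≤ γ) (h1 : α + β + γ = 1) :
    ∃ ω ∈ space K, ω u = α ∧ ω v = β ∧ ω w = γ ∧
      (∀ p, p ∉ ({u, v, w} : Finset V) → ω p = 0) ∧
      realize x ω = α • x u + β • x v + γ • x w := by
  obtain ⟨huv, huw, hvw, hf⟩ := h
  let ω : V → ℝ := fun p => if p = u then α else if p = v then β else if p = w then γ else 0
  have hu : ω u = α := by simp [ω]
  have hv : ω v = β := by simp [ω, huv.symm]
  have hw : ω w = γ := by simp [ω, huw.symm, hvw.symm]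
  have h0 : ∀ p, p ∉ ({u, v, w} : Finset V) → ω p = 0 := by
    intro p hp
    simp only [Finset.mem_insert, Finset.mem_singleton, not_or] at hp
    simp [ω, hp.1, hp.2.1, hp.2.2]
  refine ⟨ω, ⟨?_, ?_, _, hf, h0⟩, hu, hv, hw, h0, ?_⟩
  · intro p
    simp only [ω]
    split_ifs <;> first | assumption | exact le_rfl
  · rw [sum_eq_of_support huv huw hvw h0, hu, hv, hw, h1]
  · rw [realize_eq_of_support huv huw hvw h0, hu, hv, hw]

theorem inner_nonneg_of_mem_convexHull {s : Set E3} {ξ u : E3}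
    (h : ∀ p ∈ s, 0 ≤ inner ℝ ξ (p - u)) {p : E3} (hp : p ∈ convexHull ℝ s) :
    0 ≤ inner ℝ ξ (p - u) := by
  have hc : Convex ℝ {p : E3 | inner ℝ ξ u ≤ inner ℝ ξ p} :=
    convex_halfSpace_ge (innerₛₗ ℝ ξ).isLinear _
  have := convexHull_min (fun p hp => by
    have := h p hp
    rw [inner_sub_right] at this
    simpa using this) hc hp
  rw [inner_sub_right]
  simpa using this

theorem inner_pos_of_mem_interior_convexHull {s : Set E3} {ξ u : E3} (hξ : ξ ≠ 0)
    (h : ∀ p ∈ s, 0 ≤ inner ℝ ξ (p - u)) {o : E3} (ho : o ∈ interior (convexHull ℝ s)) :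
    0 < inner ℝ ξ (o - u) := by
  have hc : Filter.Tendsto (fun ε : ℝ => o - ε • ξ) (nhdsWithin 0 (Set.Ioi 0)) (nhds o) := by
    have : Continuous fun ε : ℝ => o - ε • ξ := by fun_prop
    have := this.tendsto 0
    rw [zero_smul, sub_zero] at this
    exact this.mono_left nhdsWithin_le_nhds
  obtain ⟨ε, hε, hpos⟩ := ((hc.eventually (isOpen_interior.mem_nhds ho)).and
    self_mem_nhdsWithin).exists
  have := inner_nonneg_of_mem_convexHull h (interior_subset hε)
  rw [show o - ε • ξ - u = (o - u) - ε • ξ by abel, inner_sub_right, inner_smul_right,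
    real_inner_self_eq_norm_sq] at this
  have hpos : 0 < ε := hpos
  have : 0 < ε * ‖ξ‖ ^ 2 := by positivity
  linarith

namespace IsFaceted

variable {c : E3} {r : ℝ}

theorem linearIndependent (h : IsFaceted K x c r) {u v w : V} (hT : IsTriangle K u v w) (α β : ℝ)
    (h0 : α • (x v - x u) + β • (x w - x u) = 0) : α = 0 ∧ β = 0 :=
  eq_zero_of_mem_sphere (h.mem_sphere u) (h.mem_sphere v) (h.mem_sphere w)
    (h.injective.ne hT.1.symm) (h.injective.ne hT.2.1.symm) (h.injective.ne hT.2.2.1) α β h0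

theorem mapsTo [Fintype V] (hK : IsClosedSurface K) (h : IsFaceted K x c r) :
    Set.MapsTo (realize x) (space K) (frontier (convexHull ℝ (Set.range x))) := by
  intro ω hω
  refine ⟨subset_closure (realize_mem_convexHull hω), fun hint => ?_⟩
  obtain ⟨-, h1, s, hs, hsup⟩ := hω
  obtain ⟨u, v, w, hT, hsT⟩ := hK.exists_isTriangle_superset hs
  obtain ⟨ξ, hξ, hv, hw, hpos⟩ := h.supporting u v w hT
  have := inner_pos_of_mem_interior_convexHull hξ (u := x u) (by rintro _ ⟨p, rfl⟩; exact hpos p)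
    hint
  have h0 : ∀ p, p ∉ ({u, v, w} : Finset V) → ω p = 0 := fun p hp => hsup p fun hps => hp (hsT hps)
  rw [sum_eq_of_support hT.1 hT.2.1 hT.2.2.1 h0] at h1
  rw [realize_eq_of_support hT.1 hT.2.1 hT.2.2.1 h0,
    show ω u • x u + ω v • x v + ω w • x w - x u = ω v • (x v - x u) + ω w • (x w - x u) by
      obtain h2 : ω u = 1 - ω v - ω w := by linarith
      rw [h2]; module, inner_add_right, inner_smul_right, inner_smul_right, hv, hw] at this
  linarith

/-- If a face of `K` meets the triangle `u v w`, then none of its vertices lies in the plane of the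
triangle strictly beyond the side `u v`. Otherwise one of its edges crosses `u v`. -/
theorem nonneg_of_realize_eq [Fintype V] (h : IsFaceted K x c r) {u v w : V}
    (hT : IsTriangle K u v w) {l₁ l₂ l₃ : ℝ} (hl₃ : 0 ≤ l₃)
    (hl : l₁ + l₂ + l₃ = 1) {ω : V → ℝ} (hω : ω ∈ space K)
    (hz : realize x ω = l₁ • x u + l₂ • x v + l₃ • x w) {p : V} (hp : ω p ≠ 0) {α β : ℝ}
    (hpc : x p - x v = α • (x u - x v) + β • (x w - x v)) : 0 ≤ β := by
  by_contra! hβ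
  obtain ⟨ξ, hξ, hξu, hξw, hξs⟩ := h.supporting v u w hT.swap
  have hli := h.linearIndependent hT.swap
  set U := x u - x v with hU
  set A := x w - x v with hA
  have hzv : realize x ω - x v = l₁ • U + l₃ • A := by
    rw [hz, hU, hA]
    obtain rfl : l₂ = 1 - l₁ - l₃ := by linarith
    module
  have hsum : ∑ q, ω q • (x q - x v) = realize x ω - x v := by
    simp only [smul_sub, Finset.sum_sub_distrib]
    rw [← Finset.sum_smul, hω.2.1, one_smul]
    rfl
  have hplane : ∀ q, ω q ≠ 0 → inner ℝ ξ (x q - x v) = 0 := by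
    have := congrArg (inner ℝ ξ) hsum
    rw [hzv, inner_sum, inner_add_right, inner_smul_right, inner_smul_right, hξu, hξw, mul_zero,
      mul_zero, add_zero] at this
    simp only [inner_smul_right] at this
    rw [Finset.sum_eq_zero_iff_of_nonneg fun q _ => mul_nonneg (hω.1 q) (hξs q)] at this
    exact fun q hq => (mul_eq_zero.1 (this q (Finset.mem_univ q))).resolve_left hq
  -- a linear function that vanishes on `u v` and is positive at `w`
  set ψ := ‖U‖ ^ 2 • A - (inner ℝ U A : ℝ) • U with hψ
  have hψU : inner ℝ ψ U = 0 := by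
    rw [hψ, inner_sub_left, inner_smul_left, inner_smul_left, real_inner_self_eq_norm_sq,
      real_inner_comm]
    simp only [conj_trivial]
    ring
  have hψA : 0 < inner ℝ ψ A := by
    have hU0 : ‖U‖ ^ 2 ≠ 0 := by
      have : U ≠ 0 := sub_ne_zero.2 (h.injective.ne hT.1)
      positivity
    have hψ0 : ψ ≠ 0 := by
      intro h0
      have := hli (-inner ℝ U A) (‖U‖ ^ 2) (by rw [← h0, hψ]; module)
      exact hU0 this.2
    have h1 : 0 < ‖ψ‖ ^ 2 := by positivity
    have h2 : ‖ψ‖ ^ 2 = ‖U‖ ^ 2 * inner ℝ ψ A := by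
      rw [← real_inner_self_eq_norm_sq]
      nth_rewrite 2 [hψ]
      rw [inner_sub_right, inner_smul_right, inner_smul_right, hψU]
      ring
    rw [h2] at h1
    exact pos_of_mul_pos_right h1 (by positivity)
  have hψp : inner ℝ ψ (x p - x v) < 0 := by
    rw [hpc, inner_add_right, inner_smul_right, inner_smul_right, hψU]
    have := mul_neg_of_neg_of_pos hβ hψA
    linarith
  obtain ⟨q, hq⟩ : ∃ q, 0 < ω q * inner ℝ ψ (x q - x v) := by
    by_contra! hcon
    have := congrArg (inner ℝ ψ) hsum
    rw [hzv, inner_sum, inner_add_right, inner_smul_right, inner_smul_right, hψU] at this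
    simp only [inner_smul_right] at this
    have hlt := Finset.sum_lt_sum (s := Finset.univ) (g := fun _ => (0 : ℝ)) (fun q _ => hcon q)
      ⟨p, Finset.mem_univ p, mul_neg_of_pos_of_neg ((hω.1 p).lt_of_ne' hp) hψp⟩
    rw [this, Finset.sum_const_zero] at hlt
    have := mul_nonneg hl₃ hψA.le
    linarith
  have hq0 : ω q ≠ 0 := by
    intro h0; rw [h0, zero_mul] at hq; exact lt_irrefl _ hq
  have hψq : 0 < inner ℝ ψ (x q - x v) := pos_of_mul_pos_right hq (hω.1 q)
  have hpq : (edgeGraph K).Adj p q := by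
    obtain ⟨-, -, s, hs, hsup⟩ := hω
    refine ⟨?_, mem_faces_of_subset hs ?_ (by simp)⟩
    · rintro rfl; exact lt_asymm hψp hψq
    · intro i hi
      simp only [Finset.mem_insert, Finset.mem_singleton] at hi
      by_contra his
      rcases hi with rfl | rfl
      · exact hp (hsup _ his)
      · exact hq0 (hsup _ his)
  -- the point where the edge `p q` meets the line `u v`
  set a := inner ℝ ψ (x p - x v) with ha
  set b := inner ℝ ψ (x q - x v) with hb
  have hba : 0 < b - a := by linarith
  set m := (b / (b - a)) • x p + (-a / (b - a)) • x q with hm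
  have hab1 : b / (b - a) + -a / (b - a) = 1 := by field_simp; ring
  have hmseg : m ∈ segment ℝ (x p) (x q) :=
    ⟨_, _, div_nonneg hψq.le hba.le, div_nonneg (by linarith) hba.le, hab1, rfl⟩
  have hmv : m - x v = (b / (b - a)) • (x p - x v) + (-a / (b - a)) • (x q - x v) := by
    have : x v = (b / (b - a) + -a / (b - a)) • x v := by rw [hab1, one_smul]
    rw [hm]
    nth_rewrite 1 [this]
    module
  obtain ⟨κ, μ, hκ⟩ := exists_eq_smul_add_smul hli hξ hξu hξw (w := m - x v) (by
    rw [hmv, inner_add_right, inner_smul_right, inner_smul_right, hplane p hp, hplane q hq0]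
    ring)
  have hμ : μ = 0 := by
    have h1 : inner ℝ ψ (m - x v) = 0 := by
      rw [hmv, inner_add_right, inner_smul_right, inner_smul_right, ← ha, ← hb]
      field_simp
      ring
    rw [hκ, inner_add_right, inner_smul_right, inner_smul_right, hψU, mul_zero, zero_add] at h1
    exact (mul_eq_zero.1 h1).resolve_right hψA.ne'
  rw [hμ, zero_smul, add_zero, sub_eq_iff_eq_add, add_comm, hU] at hκ
  have hmuv : m ∈ segment ℝ (x v) (x u) := by
    rw [hκ]
    refine mem_segment_of_mem_closedBall (h.mem_sphere v) (h.mem_sphere u) (h.injective.ne hT.1) ?_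
    rw [← hκ]
    exact segment_subset_closedBall (h.mem_sphere p) (h.mem_sphere q) hmseg
  refine h.not_crossing v u p q hT.adj.symm hpq ?_ ?_ ?_ ?_ ⟨m, hmuv, hmseg⟩
  · rintro rfl; rw [ha, sub_self, inner_zero_right] at hψp; exact lt_irrefl _ hψp
  · rintro rfl; rw [hb, sub_self, inner_zero_right] at hψq; exact lt_irrefl _ hψq
  · rintro rfl; rw [ha, ← hU, hψU] at hψp; exact lt_irrefl _ hψp
  · rintro rfl; rw [hb, ← hU, hψU] at hψq; exact lt_irrefl _ hψq

/-- A face whose relative interior meets the triangle `u v w` is a face of this triangle. -/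
theorem mem_of_realize_eq [Fintype V] (h : IsFaceted K x c r) {u v w : V}
    (hT : IsTriangle K u v w) {l₁ l₂ l₃ : ℝ} (hl₁ : 0 ≤ l₁) (hl₂ : 0 ≤ l₂) (hl₃ : 0 ≤ l₃)
    (hl : l₁ + l₂ + l₃ = 1) {ω : V → ℝ} (hω : ω ∈ space K)
    (hz : realize x ω = l₁ • x u + l₂ • x v + l₃ • x w) {p : V} (hp : ω p ≠ 0) :
    p ∈ ({u, v, w} : Finset V) := by
  obtain ⟨ξ, hξ, hξu, hξw, hξs⟩ := h.supporting v u w hT.swap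
  have hsum : ∑ q, ω q • (x q - x v) = l₁ • (x u - x v) + l₃ • (x w - x v) := by
    simp only [smul_sub, Finset.sum_sub_distrib]
    rw [← Finset.sum_smul, hω.2.1, one_smul]
    change realize x ω - x v = _
    rw [hz]
    obtain rfl : l₂ = 1 - l₁ - l₃ := by linarith
    module
  have hplane : inner ℝ ξ (x p - x v) = 0 := by
    have := congrArg (inner ℝ ξ) hsum
    rw [inner_sum, inner_add_right, inner_smul_right, inner_smul_right, hξu, hξw, mul_zero,
      mul_zero, add_zero] at this
    simp only [inner_smul_right] at this
    rw [Finset.sum_eq_zero_iff_of_nonneg fun q _ => mul_nonneg (hω.1 q) (hξs q)] at this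
    exact (mul_eq_zero.1 (this p (Finset.mem_univ p))).resolve_left hp
  obtain ⟨α, β, hpc⟩ := exists_eq_smul_add_smul (h.linearIndependent hT.swap) hξ hξu hξw hplane
  have hβ : 0 ≤ β := h.nonneg_of_realize_eq hT hl₃ hl hω hz hp hpc
  have hα : 0 ≤ α := h.nonneg_of_realize_eq hT.rotate.swap hl₁ (l₁ := l₃) (l₂ := l₂)
    (by linarith) hω (by rw [hz]; abel) hp (α := β) (by rw [hpc]; abel)
  have hγ : 0 ≤ 1 - α - β := by
    refine h.nonneg_of_realize_eq hT.rotate.rotate.swap hl₂ (l₁ := l₁) (l₂ := l₃)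
      (by linarith) hω (by rw [hz]; abel) hp (α := α) ?_
    have : x p = x v + (α • (x u - x v) + β • (x w - x v)) := by rw [← hpc]; abel
    rw [this]
    module
  have hsum1 : (1 - α - β) + α + β = 1 := by ring
  have key := eq_of_sum_smul_mem_sphere (s := Finset.univ) (w := ![1 - α - β, α, β])
    (y := ![x v, x u, x w]) (h.mem_sphere p)
    (by intro i _; fin_cases i <;> exact h.mem_sphere _)
    (by intro i _; fin_cases i; exacts [hγ, hα, hβ])
    (by simp only [Fin.sum_univ_three, Matrix.cons_val]; ring)
    (by
      simp only [Fin.sum_univ_three, Matrix.cons_val]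
      have : x p = x v + (α • (x u - x v) + β • (x w - x v)) := by rw [← hpc]; abel
      rw [this]
      module)
  by_cases h0 : 1 - α - β = 0
  · by_cases h1 : α = 0
    · have := h.injective (key 2 (Finset.mem_univ _) (by
        simp only [Matrix.cons_val]; intro h2; rw [h0, h1, h2] at hsum1; norm_num at hsum1))
      rw [← this]; simp
    · have := h.injective (key 1 (Finset.mem_univ _) (by simpa using h1))
      rw [← this]; simp
  · have := h.injective (key 0 (Finset.mem_univ _) (by simpa using h0))
    rw [← this]; simp

theorem injOn [Fintype V] (hK : IsClosedSurface K) (hx : IsNondegenerate K x)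
    (h : IsFaceted K x c r) : Set.InjOn (realize x) (space K) := by
  -- the support of `ω'` is contained in that of `ω`
  have key : ∀ ω ∈ space K, ∀ ω' ∈ space K, realize x ω = realize x ω' → ∀ p, ω' p ≠ 0 →
      ω p ≠ 0 := by
    intro ω hω ω' hω' he p hp' hp
    obtain ⟨hnn, h1, s, hs, hsup⟩ := hω
    obtain ⟨u, v, w, hT, hsT⟩ := hK.exists_isTriangle_superset hs
    have h0 : ∀ p, p ∉ ({u, v, w} : Finset V) → ω p = 0 :=
      fun p hp => hsup p fun hps => hp (hsT hps)
    have hmem : ∀ q, ω' q ≠ 0 → q ∈ ({u, v, w} : Finset V) := fun q hq =>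
      h.mem_of_realize_eq hT (hnn u) (hnn v) (hnn w)
        (by rw [← sum_eq_of_support hT.1 hT.2.1 hT.2.2.1 h0, h1]) hω'
        (by rw [← he, realize_eq_of_support hT.1 hT.2.1 hT.2.2.1 h0]) hq
    have h0' : ∀ p, p ∉ ({u, v, w} : Finset V) → ω' p = 0 := by
      intro q hq
      by_contra hcon
      exact hq (hmem q hcon)
    have hs1 := sum_eq_of_support hT.1 hT.2.1 hT.2.2.1 h0
    have hs1' := sum_eq_of_support hT.1 hT.2.1 hT.2.2.1 h0'
    rw [h1] at hs1
    rw [hω'.2.1] at hs1'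
    rw [realize_eq_of_support hT.1 hT.2.1 hT.2.2.1 h0,
      realize_eq_of_support hT.1 hT.2.1 hT.2.2.1 h0'] at he
    have hz := h.linearIndependent hT (ω v - ω' v) (ω w - ω' w) (by
      have e1 : ω u = 1 - ω v - ω w := by linarith
      have e2 : ω' u = 1 - ω' v - ω' w := by linarith
      rw [e1, e2] at he
      rw [← sub_eq_zero.2 he]
      module)
    have hm := hmem p hp'
    simp only [Finset.mem_insert, Finset.mem_singleton] at hm
    rcases hm with rfl | rfl | rfl
    · apply hp'; linarith [hz.1, hz.2]
    · apply hp'; linarith [hz.1, hz.2]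
    · apply hp'; linarith [hz.1, hz.2]
  intro ω hω ω' hω' he
  obtain ⟨s, hs, hsup⟩ := hω.2.2
  have hsup' : ∀ p, p ∉ s → ω' p = 0 := by
    intro p hp
    by_contra hcon
    exact key ω hω ω' hω' he p hcon (hsup p hp)
  have hind := hx s hs
  rw [affineIndependent_iff] at hind
  have hsum : ∀ {M : Type} [AddCommMonoid M] (f : V → M), (∀ p, p ∉ s → f p = 0) →
      ∑ i : s, f i = ∑ p, f p := by
    intro M _ f hf
    rw [← Finset.sum_subset (Finset.subset_univ s) fun p _ hp => hf p hp]
    exact Finset.sum_coe_sort s f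
  have h0 := hind Finset.univ (fun i => ω i - ω' i) (by
    rw [hsum (fun p => ω p - ω' p) fun p hp => by rw [hsup p hp, hsup' p hp, sub_self],
      Finset.sum_sub_distrib, hω.2.1, hω'.2.1, sub_self]) (by
    rw [hsum (fun p => (ω p - ω' p) • x p) fun p hp => by
      rw [hsup p hp, hsup' p hp, sub_self, zero_smul]]
    simp only [sub_smul, Finset.sum_sub_distrib]
    exact sub_eq_zero.2 he)
  funext p
  by_cases hp : p ∈ s
  · exact sub_eq_zero.1 (h0 ⟨p, hp⟩ (Finset.mem_univ _))
  · rw [hsup p hp, hsup' p hp]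

end IsFaceted

end Embedding

/-! ### Surfaces with convex links cover the boundary of the convex hull -/

section Covering

theorem interior_convexHull_nonempty_of_not_coplanar {s : Set E3} (hs : ¬ Coplanar ℝ s) :
    (interior (convexHull ℝ s)).Nonempty := by
  have hne : s.Nonempty := by
    rw [Set.nonempty_iff_ne_empty]
    rintro rfl
    exact hs (coplanar_empty ℝ E3)
  rw [interior_convexHull_nonempty_iff_affineSpan_eq_top,
    AffineSubspace.affineSpan_eq_top_iff_vectorSpan_eq_top_of_nonempty ℝ E3 E3 hne]
  rw [coplanar_iff_finrank_le_two] at hs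
  apply Submodule.eq_top_of_finrank_eq
  have := Submodule.finrank_le (vectorSpan ℝ s)
  have h3 : Module.finrank ℝ E3 = 3 := by simp
  omega

theorem exists_mem_forall_notMem_of_isOpen {ι : Type*} [Finite ι] {U : Set E3} (hU : IsOpen U)
    (hne : U.Nonempty) {P : ι → Submodule ℝ E3} (hP : ∀ i, P i ≠ ⊤) :
    ∃ d ∈ U, ∀ i, d ∉ P i := by
  by_contra! hcon
  have h0 : MeasureTheory.volume (⋃ i, (P i : Set E3)) = 0 :=
    MeasureTheory.measure_iUnion_null fun i =>
      MeasureTheory.Measure.addHaar_submodule _ _ (hP i)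
  refine (hU.measure_pos MeasureTheory.volume hne).ne' (MeasureTheory.measure_mono_null ?_ h0)
  intro d hd
  obtain ⟨i, hi⟩ := hcon d hd
  exact Set.mem_iUnion.2 ⟨i, hi⟩

theorem span_pair_ne_top (a b : E3) : Submodule.span ℝ {a, b} ≠ ⊤ := by
  obtain ⟨η, hη, ha, hb⟩ := exists_ne_zero_inner_eq_zero a b
  intro h
  have hle : Submodule.span ℝ {a, b} ≤ (ℝ ∙ η)ᗮ := by
    rw [Submodule.span_le]
    rintro _ (rfl | rfl)
    · exact Submodule.mem_orthogonal_singleton_iff_inner_right.2 ha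
    · exact Submodule.mem_orthogonal_singleton_iff_inner_right.2 hb
  rw [h] at hle
  have := Submodule.mem_orthogonal_singleton_iff_inner_right.1 (hle (Submodule.mem_top (x := η)))
  exact hη (inner_self_eq_zero.1 this)

variable {V : Type*} [DecidableEq V] {K : AbstractSimplicialComplex V} {x : V → E3}

/-- The union of the cones with apex `o` over the triangles of the surface, as a set of vectors. -/
def coneOver (K : AbstractSimplicialComplex V) (x : V → E3) (o : E3) : Set E3 :=
  {d | ∃ u v w, IsTriangle K u v w ∧ ∃ α β γ : ℝ, 0 ≤ α ∧ 0 ≤ β ∧ 0 ≤ γ ∧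
    d = α • (x u - o) + β • (x v - o) + γ • (x w - o)}

namespace IsFaceted

variable {c o : E3} {r : ℝ}

theorem exists_supporting_of_mem_interior (h : IsFaceted K x c r)
    (ho : o ∈ interior (convexHull ℝ (Set.range x))) {u v w : V} (hT : IsTriangle K u v w) :
    ∃ ξ : E3, inner ℝ ξ (x u - o) = -1 ∧ inner ℝ ξ (x v - o) = -1 ∧ inner ℝ ξ (x w - o) = -1 ∧
      ∀ p ∈ convexHull ℝ (Set.range x), -1 ≤ inner ℝ ξ (p - o) := by
  obtain ⟨ξ, hξ, hv, hw, hpos⟩ := h.supporting u v w hT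
  have hpos' : ∀ p ∈ Set.range x, 0 ≤ inner ℝ ξ (p - x u) := by
    rintro _ ⟨p, rfl⟩
    exact hpos p
  have hκ := inner_pos_of_mem_interior_convexHull hξ hpos' ho
  have key : ∀ p, inner ℝ ((inner ℝ ξ (o - x u))⁻¹ • ξ) (p - o) =
      (inner ℝ ξ (o - x u))⁻¹ * inner ℝ ξ (p - x u) - 1 := by
    intro p
    rw [inner_smul_left, show p - o = (p - x u) - (o - x u) by abel, inner_sub_right ξ (p - x u),
      conj_trivial, mul_sub, inv_mul_cancel₀ hκ.ne']
  refine ⟨(inner ℝ ξ (o - x u))⁻¹ • ξ, ?_, ?_, ?_, fun p hp => ?_⟩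
  · rw [key, sub_self, inner_zero_right]; ring
  · rw [key, hv]; ring
  · rw [key, hw]; ring
  · rw [key]
    have := mul_nonneg (inv_pos.2 hκ).le (inner_nonneg_of_mem_convexHull hpos' hp)
    linarith

/-- The vectors from an interior point to the vertices of a triangle form a basis. -/
theorem exists_basis (h : IsFaceted K x c r) (ho : o ∈ interior (convexHull ℝ (Set.range x)))
    {u v w : V} (hT : IsTriangle K u v w) :
    ∃ b : Module.Basis (Fin 3) ℝ E3, ⇑b = ![x u - o, x v - o, x w - o] := by
  obtain ⟨ξ, hu, hv, hw, -⟩ := h.exists_supporting_of_mem_interior ho hT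
  have hli : LinearIndependent ℝ ![x u - o, x v - o, x w - o] := by
    rw [Fintype.linearIndependent_iff]
    intro g hg
    simp only [Fin.sum_univ_three, Matrix.cons_val] at hg
    have h0 := congrArg (inner ℝ ξ) hg
    simp only [inner_add_right, inner_smul_right, hu, hv, hw, inner_zero_right] at h0
    have h1 := h.linearIndependent hT (g 1) (g 2) (by
      obtain h2 : g 0 = -g 1 - g 2 := by linarith
      rw [h2] at hg
      rw [← hg]
      module)
    intro i
    fin_cases i
    · change g 0 = 0; linarith [h1.1, h1.2]
    · exact h1.1
    · exact h1.2
  exact ⟨basisOfLinearIndependentOfCardEqFinrank hli (by simp), by simp⟩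

/-- Two triangles with a common side lie on different sides of the plane through this side and an
interior point of the convex hull. If not, they are coplanar by the supporting planes, and then
they overlap. -/
theorem neg_of_isTriangle [Fintype V] (h : IsFaceted K x c r)
    (ho : o ∈ interior (convexHull ℝ (Set.range x))) {u v w w' : V} (hT : IsTriangle K u v w)
    (hT' : IsTriangle K u v w') (hww : w ≠ w') {α β γ : ℝ}
    (he : x w' - o = α • (x u - o) + β • (x v - o) + γ • (x w - o)) : γ < 0 := by
  by_contra! hγ
  obtain ⟨ξ, hu, hv, hw, hξ⟩ := h.exists_supporting_of_mem_interior ho hT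
  obtain ⟨ξ', hu', hv', hw', hξ'⟩ := h.exists_supporting_of_mem_interior ho hT'
  have h1 := hξ _ (subset_convexHull ℝ _ ⟨w', rfl⟩)
  have h2 := hξ' _ (subset_convexHull ℝ _ ⟨w, rfl⟩)
  rw [he] at h1 hw'
  simp only [inner_add_right, inner_smul_right, hu, hv, hw, hu', hv'] at h1 hw'
  have h3 := mul_le_mul_of_nonneg_left h2 hγ
  have hsum : α + β + γ = 1 := by linarith
  have hpt : x w' = α • x u + β • x v + γ • x w := by
    have : x w' = x w' - o + (α + β + γ) • o := by rw [hsum, one_smul, sub_add_cancel]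
    rw [this, he]
    module
  rcases hγ.eq_or_lt with rfl | hγ
  · have := (h.linearIndependent hT' (-β) 1 (by
      rw [hpt]
      obtain rfl : α = 1 - β := by linarith
      module)).2
    exact one_ne_zero this
  -- a point close to the midpoint of the side, in the interior of both triangles
  set τ := (2 + 2 * |α| + 2 * |β|)⁻¹ with hτ
  have hτ0 : 0 < τ := by positivity
  have hτ1 : (1 - τ) / 2 = τ * (1 / 2 + |α| + |β|) := by rw [hτ]; field_simp; ring
  have hhalf : 0 ≤ (1 - τ) / 2 := by rw [hτ1]; positivity
  obtain ⟨ω, hω, -, -, hωw, -, hz⟩ := hT'.exists_mem_space x hhalf hhalf hτ0.le (by ring)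
  have hα : 0 ≤ (1 - τ) / 2 + τ * α := by
    rw [hτ1, ← mul_add]
    apply mul_nonneg hτ0.le
    linarith [neg_abs_le α, abs_nonneg β]
  have hβ : 0 ≤ (1 - τ) / 2 + τ * β := by
    rw [hτ1, ← mul_add]
    apply mul_nonneg hτ0.le
    linarith [neg_abs_le β, abs_nonneg α]
  have hmem := h.mem_of_realize_eq hT hα hβ (mul_nonneg hτ0.le hγ.le) (by
      rw [show (1 - τ) / 2 + τ * α + ((1 - τ) / 2 + τ * β) + τ * γ =
        1 - τ + τ * (α + β + γ) by ring, hsum]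
      ring) hω (by rw [hz, hpt]; module) (p := w') (by rw [hωw]; exact hτ0.ne')
  simp only [Finset.mem_insert, Finset.mem_singleton] at hmem
  rcases hmem with hm | hm | hm
  · exact hT'.2.1 hm.symm
  · exact hT'.2.2.1 hm.symm
  · exact hww hm.symm

theorem isClosed_coneOver [Finite V] (h : IsFaceted K x c r)
    (ho : o ∈ interior (convexHull ℝ (Set.range x))) : IsClosed (coneOver K x o) := by
  have heq : coneOver K x o = ⋃ t : {t : V × V × V // IsTriangle K t.1 t.2.1 t.2.2},
      {d | ∃ α β γ : ℝ, 0 ≤ α ∧ 0 ≤ β ∧ 0 ≤ γ ∧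
        d = α • (x t.1.1 - o) + β • (x t.1.2.1 - o) + γ • (x t.1.2.2 - o)} := by
    ext d
    simp [coneOver]
  rw [heq]
  refine isClosed_iUnion_of_finite fun ⟨⟨u, v, w⟩, hT⟩ => ?_
  obtain ⟨b, hb⟩ := h.exists_basis ho hT
  have hcone : {d | ∃ α β γ : ℝ, 0 ≤ α ∧ 0 ≤ β ∧ 0 ≤ γ ∧
      d = α • (x u - o) + β • (x v - o) + γ • (x w - o)} = ⋂ i, {d | 0 ≤ b.coord i d} := by
    ext d
    simp only [Set.mem_iInter, Set.mem_ofPred_eq]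
    constructor
    · rintro ⟨α, β, γ, hα, hβ, hγ, rfl⟩ i
      have : α • (x u - o) + β • (x v - o) + γ • (x w - o) =
          α • b 0 + β • b 1 + γ • b 2 := by rw [hb]; simp
      rw [this]
      fin_cases i <;> simpa [Finsupp.single_apply]
    · intro hd
      refine ⟨_, _, _, hd 0, hd 1, hd 2, ?_⟩
      nth_rewrite 1 [← b.sum_repr d]
      rw [Fin.sum_univ_three, hb]
      rfl
  change IsClosed {d | ∃ α β γ : ℝ, 0 ≤ α ∧ 0 ≤ β ∧ 0 ≤ γ ∧
      d = α • (x u - o) + β • (x v - o) + γ • (x w - o)}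
  rw [hcone]
  exact isClosed_iInter fun i => isClosed_le continuous_const
    (b.coord i).continuous_of_finiteDimensional

/-- A point of a cone that does not lie on an edge of it is an interior point of the union of the
cones: a boundary point of the cone belongs to the cone over the adjacent triangle. -/
theorem coneOver_mem_nhds_of_pos [Fintype V] (hK : IsClosedSurface K) (h : IsFaceted K x c r)
    (ho : o ∈ interior (convexHull ℝ (Set.range x))) {u v w : V} (hT : IsTriangle K u v w)
    {α β γ : ℝ} (hα : 0 < α) (hβ : 0 < β) (hγ : 0 ≤ γ) :
    coneOver K x o ∈ nhds (α • (x u - o) + β • (x v - o) + γ • (x w - o)) := by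
  obtain ⟨b, hb⟩ := h.exists_basis ho hT
  set d := α • (x u - o) + β • (x v - o) + γ • (x w - o) with hd
  have hd' : d = α • b 0 + β • b 1 + γ • b 2 := by rw [hd, hb]; simp
  have hd0 : b.coord 0 d = α := by rw [hd']; simp
  have hd1 : b.coord 1 d = β := by rw [hd']; simp
  have hd2 : b.coord 2 d = γ := by rw [hd']; simp
  have hc : ∀ i, Continuous (b.coord i) := fun i => (b.coord i).continuous_of_finiteDimensional
  have hrep : ∀ d, d = b.coord 0 d • (x u - o) + b.coord 1 d • (x v - o) +
      b.coord 2 d • (x w - o) := by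
    intro d
    nth_rewrite 1 [← b.sum_repr d]
    rw [Fin.sum_univ_three, hb]
    rfl
  have e0 : ∀ᶠ y in nhds d, 0 < b.coord 0 y :=
    (hc 0).continuousAt.eventually_const_lt (by rwa [hd0])
  have e1 : ∀ᶠ y in nhds d, 0 < b.coord 1 y :=
    (hc 1).continuousAt.eventually_const_lt (by rwa [hd1])
  rcases hγ.eq_or_lt with rfl | hγ
  · obtain ⟨w', hT', hww⟩ : ∃ w', IsTriangle K u v w' ∧ w ≠ w' := by
      obtain ⟨n, a, ha⟩ := hK.exists_isLinkCycle u
      obtain ⟨a, ha, rfl⟩ := ha.exists_shift_one hT.adj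
      have hw := hT.mem_apices
      rw [ha.apices_eq 0] at hw
      rcases hw with rfl | rfl
      · exact ⟨_, ha.isTriangle 1, ha.ne_succ_succ 0⟩
      · exact ⟨_, (ha.isTriangle 0).rotate.rotate.swap, (ha.ne_succ_succ 0).symm⟩
    have hneg := h.neg_of_isTriangle ho hT hT' hww (hrep (x w' - o))
    set ε := fun i => b.coord i (x w' - o) with hε
    have e2 : ∀ᶠ y in nhds d, 0 < b.coord 0 y - b.coord 2 y * (ε 0 / ε 2) :=
      ((hc 0).sub ((hc 2).mul continuous_const)).continuousAt.eventually_const_lt (by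
        simp only [Pi.sub_apply, Pi.mul_apply, hd0, hd2, zero_mul, sub_zero, hα])
    have e3 : ∀ᶠ y in nhds d, 0 < b.coord 1 y - b.coord 2 y * (ε 1 / ε 2) :=
      ((hc 1).sub ((hc 2).mul continuous_const)).continuousAt.eventually_const_lt (by
        simp only [Pi.sub_apply, Pi.mul_apply, hd1, hd2, zero_mul, sub_zero, hβ])
    filter_upwards [e0, e1, e2, e3] with y h0 h1 h2 h3
    rcases le_or_gt 0 (b.coord 2 y) with h4 | h4
    · exact ⟨u, v, w, hT, _, _, _, h0.le, h1.le, h4, hrep y⟩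
    · refine ⟨u, v, w', hT', _, _, b.coord 2 y / ε 2, h2.le, h3.le,
        div_nonneg_of_nonpos h4.le hneg.le, ?_⟩
      have hneg' : ε 2 ≠ 0 := hneg.ne
      have hw' : x w' - o = ε 0 • (x u - o) + ε 1 • (x v - o) + ε 2 • (x w - o) := hrep _
      have h5 : b.coord 2 y = b.coord 2 y / ε 2 * ε 2 := by field_simp
      nth_rewrite 1 [hrep y]
      rw [hw', mul_div_assoc', mul_div_assoc']
      nth_rewrite 1 [h5]
      module
  · have e2 : ∀ᶠ y in nhds d, 0 < b.coord 2 y :=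
      (hc 2).continuousAt.eventually_const_lt (by rwa [hd2])
    filter_upwards [e0, e1, e2] with y h0 h1 h2
    exact ⟨u, v, w, hT, _, _, _, h0.le, h1.le, h2.le, hrep y⟩

theorem coneOver_mem_nhds [Fintype V] (hK : IsClosedSurface K) (h : IsFaceted K x c r)
    (ho : o ∈ interior (convexHull ℝ (Set.range x))) {d : E3} (hd : d ∈ coneOver K x o)
    (hline : ∀ p (κ : ℝ), d ≠ κ • (x p - o)) : coneOver K x o ∈ nhds d := by
  obtain ⟨u, v, w, hT, α, β, γ, hα, hβ, hγ, rfl⟩ := hd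
  rcases hα.eq_or_lt with rfl | hα
  · rcases hβ.eq_or_lt with rfl | hβ
    · exact absurd (by module) (hline w γ)
    · rcases hγ.eq_or_lt with rfl | hγ
      · exact absurd (by module) (hline v β)
      · convert h.coneOver_mem_nhds_of_pos hK ho hT.rotate hβ hγ le_rfl using 2
        module
  · rcases hβ.eq_or_lt with rfl | hβ
    · rcases hγ.eq_or_lt with rfl | hγ
      · exact absurd (by module) (hline u α)
      · convert h.coneOver_mem_nhds_of_pos hK ho hT.rotate.rotate hγ hα le_rfl using 2
        module
    · exact h.coneOver_mem_nhds_of_pos hK ho hT hα hβ hγ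

/-- The cones over the triangles fill space: otherwise a generic segment from the interior of a cone
to an uncovered point, which avoids the lines through the vertices, leaves the closed set covered
by the cones at an interior point of this set. -/
theorem coneOver_eq_univ [Fintype V] [Nonempty V] (hK : IsClosedSurface K) (h : IsFaceted K x c r)
    (ho : o ∈ interior (convexHull ℝ (Set.range x))) : coneOver K x o = Set.univ := by
  by_contra hne
  have hopen := (h.isClosed_coneOver ho).isOpen_compl
  obtain ⟨v⟩ := ‹Nonempty V›
  obtain ⟨n, a, ha⟩ := hK.exists_isLinkCycle v
  have hT := ha.isTriangle 0
  have hd0 := h.coneOver_mem_nhds_of_pos hK ho hT one_pos one_pos zero_le_one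
  set d₀ := (1 : ℝ) • (x v - o) + (1 : ℝ) • (x (a 0) - o) + (1 : ℝ) • (x (a (0 + 1)) - o)
  obtain ⟨d₁, hd1, hgen⟩ := exists_mem_forall_notMem_of_isOpen hopen
    (Set.nonempty_compl.2 hne) (P := fun p : V => Submodule.span ℝ {d₀, x p - o})
    fun p => span_pair_ne_top _ _
  have hf : Continuous fun t : ℝ => d₀ + t • (d₁ - d₀) := by fun_prop
  refine hd1 ?_
  have hmem : (1 : ℝ) ∈ (fun t : ℝ => d₀ + t • (d₁ - d₀)) ⁻¹' coneOver K x o := by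
    refine IsClosed.mem_of_ge_of_forall_exists_gt (a := 0)
      (((h.isClosed_coneOver ho).preimage hf).inter isClosed_Icc) ?_ zero_le_one ?_
    · simpa using mem_of_mem_nhds hd0
    · rintro t ⟨ht, ht0, ht1⟩
      have hnhds : coneOver K x o ∈ nhds (d₀ + t • (d₁ - d₀)) := by
        rcases ht0.eq_or_lt with rfl | ht0
        · simpa using hd0
        · refine h.coneOver_mem_nhds hK ho ht fun p κ hκ => hgen p ?_
          rw [Submodule.mem_span_pair]
          refine ⟨(t - 1) / t, κ / t, ?_⟩
          have : d₁ = t⁻¹ • (d₀ + t • (d₁ - d₀)) + ((t - 1) / t) • d₀ := by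
            match_scalars <;> field_simp <;> ring
          refine Eq.trans ?_ this.symm
          rw [hκ, smul_smul, inv_mul_eq_div, add_comm]
      have hev := (hf.continuousAt.eventually hnhds).filter_mono
        (nhdsWithin_le_nhds (s := Set.Ioi t))
      obtain ⟨s, hs, hst⟩ := (hev.and (Ioc_mem_nhdsGT ht1)).exists
      exact ⟨s, hs, hst⟩
  simpa using hmem

theorem surjOn [Fintype V] [Nonempty V] (hK : IsClosedSurface K) (h : IsFaceted K x c r)
    (ho : o ∈ interior (convexHull ℝ (Set.range x))) :
    Set.SurjOn (realize x) (space K) (frontier (convexHull ℝ (Set.range x))) := by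
  rintro z ⟨hz, hzint⟩
  rw [(isClosed_convexHull_range x).closure_eq] at hz
  have hcov : z - o ∈ coneOver K x o := by rw [h.coneOver_eq_univ hK ho]; trivial
  obtain ⟨u, v, w, hT, α, β, γ, hα, hβ, hγ, he⟩ := hcov
  obtain ⟨ξ, hu, hv, hw, hξ⟩ := h.exists_supporting_of_mem_interior ho hT
  have hle := hξ z hz
  rw [he] at hle
  simp only [inner_add_right, inner_smul_right, hu, hv, hw] at hle
  have hz' : z = (1 - (α + β + γ)) • o + (α • x u + β • x v + γ • x w) := by
    rw [← sub_add_cancel z o, he]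
    module
  rcases lt_or_eq_of_le (show α + β + γ ≤ 1 by linarith) with hlt | heq
  · exfalso
    apply hzint
    rcases (show 0 ≤ α + β + γ by positivity).eq_or_lt with h0 | h0
    · have h1 : α = 0 := by linarith
      have h2 : β = 0 := by linarith
      have h3 : γ = 0 := by linarith
      rw [hz', h1, h2, h3]
      simpa using ho
    · obtain ⟨ω, hω, -, -, -, -, hr⟩ := hT.exists_mem_space x (α := α / (α + β + γ))
        (β := β / (α + β + γ)) (γ := γ / (α + β + γ)) (by positivity) (by positivity)
        (by positivity) (by field_simp)
      have := (convex_convexHull ℝ (Set.range x)).combo_interior_self_mem_interior ho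
        (realize_mem_convexHull (x := x) hω) (a := 1 - (α + β + γ)) (b := α + β + γ) (by linarith)
        h0.le (by ring)
      rw [hr] at this
      convert this using 1
      rw [hz']
      match_scalars <;> field_simp
  · obtain ⟨ω, hω, -, -, -, -, hr⟩ := hT.exists_mem_space x hα hβ hγ heq
    refine ⟨ω, hω, ?_⟩
    rw [hr, hz', heq]
    module

theorem isInscribedConvexPolyhedron [Fintype V] [Nonempty V] (hK : IsClosedSurface K)
    (hx : IsNondegenerate K x) (h : IsFaceted K x c r) (hcop : ¬ Coplanar ℝ (Set.range x)) :
    IsInscribedConvexPolyhedron K x := by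
  have hsolid := interior_convexHull_nonempty_of_not_coplanar hcop
  exact ⟨⟨c, r, h.mem_sphere⟩, hsolid, h.mapsTo hK, h.injOn hK hx, h.surjOn hK hsolid.some_mem⟩

end IsFaceted

end Covering

/-! ### Links of inscribed convex polyhedra are convex -/

section Converse

theorem exists_neg_and_succ_nonneg {f : ℕ → ℝ} {i j : ℕ} (hij : i ≤ j) (hi : f i < 0)
    (hj : 0 ≤ f j) : ∃ m, i ≤ m ∧ m < j ∧ f m < 0 ∧ 0 ≤ f (m + 1) := by
  by_contra! hcon
  have key : ∀ k, i ≤ k → k ≤ j → f k < 0 := by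
    intro k hk
    induction k, hk using Nat.le_induction with
    | base => exact fun _ => hi
    | succ k hk ih => exact fun hkj => hcon k hk hkj (ih (by omega))
  exact absurd (key j hij le_rfl) hj.not_gt

/-- A polygon crosses the plane through the origin orthogonal to `ξ` between vertices on different
sides of this plane. -/
theorem exists_inner_smul_add_smul_eq_zero {X : ℕ → E3} {ξ : E3} {i j : ℕ} (hij : i ≤ j)
    (hi : inner ℝ ξ (X i) < 0) (hj : 0 < inner ℝ ξ (X j)) :
    ∃ m, i ≤ m ∧ m < j ∧ ∃ α β : ℝ, 0 ≤ α ∧ 0 < β ∧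
      inner ℝ ξ (α • X m + β • X (m + 1)) = 0 := by
  obtain ⟨m, him, hmj, h0, h1⟩ :=
    exists_neg_and_succ_nonneg (f := fun k => inner ℝ ξ (X k)) hij hi hj.le
  refine ⟨m, him, hmj, inner ℝ ξ (X (m + 1)), -inner ℝ ξ (X m), h1, neg_pos.2 h0, ?_⟩
  rw [inner_add_right, inner_smul_right, inner_smul_right]
  ring

/-- A planar convex cone with interior points has at most two boundary rays: the vectors `z m` lie
in the plane orthogonal to `ξ`, and `g m` is a supporting functional of the cone at `z m`, which is
not trivial since it does not vanish at `e`. -/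
theorem false_of_three_supporting {ξ e : E3} {z g : Fin 3 → E3} (hξ : ξ ≠ 0)
    (hz : ∀ m, inner ℝ ξ (z m) = 0) (he : inner ℝ ξ e = 0) (hge : ∀ m, inner ℝ (g m) e ≠ 0)
    (hg : ∀ m q, 0 ≤ inner ℝ (g m) (z q)) (hgz : ∀ m, inner ℝ (g m) (z m) = 0)
    (hz0 : ∀ m, z m ≠ 0) (hpar : ∀ p q, p < q → ∀ κ : ℝ, 0 < κ → z p ≠ κ • z q) : False := by
  -- a functional `g m` cannot vanish on two independent vectors
  have hdep : ∀ m p q, inner ℝ (g m) (z p) = 0 → inner ℝ (g m) (z q) = 0 →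
      ¬ ∀ α β : ℝ, α • z p + β • z q = 0 → α = 0 ∧ β = 0 := by
    intro m p q hp hq hli
    obtain ⟨α, β, rfl⟩ := exists_eq_smul_add_smul hli hξ (hz p) (hz q) he
    apply hge m
    rw [inner_add_right, inner_smul_right, inner_smul_right, hp, hq, mul_zero, mul_zero, add_zero]
  have hneg : ∀ p q, p < q → (¬ ∀ α β : ℝ, α • z p + β • z q = 0 → α = 0 ∧ β = 0) →
      ∃ κ : ℝ, κ < 0 ∧ z p = κ • z q := by
    intro p q hpq hli
    push Not at hli
    obtain ⟨α, β, h0, h1⟩ := hli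
    have hα : α ≠ 0 := by
      rintro rfl
      rw [zero_smul, zero_add] at h0
      exact (smul_ne_zero (h1 rfl) (hz0 q)) h0
    have hzp : z p = (-β / α) • z q := by
      have h2 : α • z p = (-β) • z q := by rw [neg_smul]; exact eq_neg_of_add_eq_zero_left h0
      rw [div_eq_inv_mul, mul_smul, ← h2, smul_smul, inv_mul_cancel₀ hα, one_smul]
    rcases lt_trichotomy (-β / α) 0 with h | h | h
    · exact ⟨_, h, hzp⟩
    · rw [h, zero_smul] at hzp
      exact absurd hzp (hz0 p)
    · exact absurd hzp (hpar p q hpq _ h)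
  by_cases hli : ∀ α β : ℝ, α • z 0 + β • z 1 = 0 → α = 0 ∧ β = 0
  · obtain ⟨α, β, h2⟩ := exists_eq_smul_add_smul hli hξ (hz 0) (hz 1) (hz 2)
    have hval : ∀ m, inner ℝ (g m) (z 2) =
        α * inner ℝ (g m) (z 0) + β * inner ℝ (g m) (z 1) := by
      intro m
      rw [h2, inner_add_right, inner_smul_right, inner_smul_right]
    have hβ : 0 ≤ β := by
      have h3 := hg 0 2
      rw [hval, hgz, mul_zero, zero_add] at h3
      refine nonneg_of_mul_nonneg_left h3 ((hg 0 1).lt_of_ne' fun h => hdep 0 0 1 (hgz 0) h hli)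
    have hα : 0 ≤ α := by
      have h3 := hg 1 2
      rw [hval, hgz, mul_zero, add_zero] at h3
      refine nonneg_of_mul_nonneg_left h3 ((hg 1 0).lt_of_ne' fun h => hdep 1 0 1 h (hgz 1) hli)
    rcases hα.eq_or_lt with rfl | hα
    · rw [zero_smul, zero_add] at h2
      rcases hβ.eq_or_lt with rfl | hβ
      · exact hz0 2 (by rw [h2, zero_smul])
      · exact hpar 1 2 (by decide) β⁻¹ (inv_pos.2 hβ)
          (by rw [h2, smul_smul, inv_mul_cancel₀ hβ.ne', one_smul])
    · rcases hβ.eq_or_lt with rfl | hβ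
      · rw [zero_smul, add_zero] at h2
        exact hpar 0 2 (by decide) α⁻¹ (inv_pos.2 hα)
          (by rw [h2, smul_smul, inv_mul_cancel₀ hα.ne', one_smul])
      · have h3 := hgz 2
        rw [hval] at h3
        have h4 := mul_nonneg hα.le (hg 2 0)
        have h5 := mul_nonneg hβ.le (hg 2 1)
        exact hdep 2 0 1 ((mul_eq_zero.1 (by linarith)).resolve_left hα.ne')
          ((mul_eq_zero.1 (by linarith)).resolve_left hβ.ne') hli
  · obtain ⟨κ, hκ, h01⟩ := hneg 0 1 (by decide) hli
    have h1 : inner ℝ (g 2) (z 1) = 0 := by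
      have h3 := hg 2 0
      rw [h01, inner_smul_right] at h3
      exact le_antisymm (nonpos_of_mul_nonneg_right h3 hκ) (hg 2 1)
    have h0 : inner ℝ (g 2) (z 0) = 0 := by rw [h01, inner_smul_right, h1, mul_zero]
    obtain ⟨μ, hμ, h02⟩ := hneg 0 2 (by decide) (hdep 2 0 2 h0 (hgz 2))
    obtain ⟨ν, hν, h12⟩ := hneg 1 2 (by decide) (hdep 2 1 2 h1 (hgz 2))
    refine hpar 0 2 (by decide) (κ * ν) (mul_pos_of_neg_of_neg hκ hν) ?_
    rw [h01, h12, smul_smul]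

variable {V : Type*} [DecidableEq V] {K : AbstractSimplicialComplex V} {x : V → E3}

namespace IsInscribedConvexPolyhedron

variable [Fintype V]

theorem injective (hK : IsClosedSurface K) (h : IsInscribedConvexPolyhedron K x) :
    Function.Injective x := by
  have hmem : ∀ v, Pi.single v (1 : ℝ) ∈ space K := by
    intro v
    obtain ⟨n, a, ha⟩ := hK.exists_isLinkCycle v
    refine ⟨fun p => ?_, by simp, _, (ha.isTriangle 0).2.2.2, fun p hp => ?_⟩
    · rw [Pi.single_apply]; split_ifs <;> norm_num
    · rw [Pi.single_apply, if_neg]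
      rintro rfl
      simp at hp
  have hr : ∀ v, realize x (Pi.single v 1) = x v := by
    intro v
    simp [realize, Pi.single_apply]
  intro u v huv
  have := h.boundary.injOn (hmem u) (hmem v) (by rw [hr, hr, huv])
  by_contra hne
  have h1 := congrFun this u
  rw [Pi.single_eq_same, Pi.single_eq_of_ne hne] at h1
  exact one_ne_zero h1

/-- A functional that supports the polyhedron at the barycentre of a triangle is constant on the
triangle. -/
theorem exists_supporting (h : IsInscribedConvexPolyhedron K x) {o : E3}
    (ho : o ∈ interior (convexHull ℝ (Set.range x))) {u v w : V} (hT : IsTriangle K u v w) :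
    ∃ g : E3, inner ℝ g (x v - x u) = 0 ∧ inner ℝ g (x w - x u) = 0 ∧
      (∀ p, 0 ≤ inner ℝ g (x p - x u)) ∧ 0 < inner ℝ g (o - x u) := by
  obtain ⟨ω, hω, -, -, -, -, hr⟩ := hT.exists_mem_space x (α := 1 / 3) (β := 1 / 3) (γ := 1 / 3)
    (by norm_num) (by norm_num) (by norm_num) (by norm_num)
  have hfr := h.boundary.mapsTo hω
  obtain ⟨f, hf⟩ := geometric_hahn_banach_open_point (convex_convexHull ℝ _).interior
    isOpen_interior hfr.2
  have hle : ∀ p, f (x p) ≤ f (realize x ω) := by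
    intro p
    have hp : x p ∈ closure (interior (convexHull ℝ (Set.range x))) := by
      rw [(convex_convexHull ℝ _).closure_interior_eq_closure_of_nonempty_interior ⟨o, ho⟩]
      exact subset_closure (subset_convexHull ℝ _ ⟨p, rfl⟩)
    exact closure_minimal (t := {q | f q ≤ f (realize x ω)}) (fun q hq => (hf q hq).le)
      (isClosed_le f.continuous continuous_const) hp
  have hr' : f (realize x ω) = (f (x u) + f (x v) + f (x w)) / 3 := by
    rw [hr]
    simp only [map_add, map_smul, smul_eq_mul]
    ring
  have hu := hle u
  have hv := hle v
  have hw := hle w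
  have hg : ∀ y, inner ℝ ((InnerProductSpace.toDual ℝ E3).symm (-f)) y = -f y := by
    intro y
    rw [InnerProductSpace.toDual_symm_apply]
    rfl
  refine ⟨(InnerProductSpace.toDual ℝ E3).symm (-f), ?_, ?_, fun p => ?_, ?_⟩
  · rw [hg, map_sub]; linarith
  · rw [hg, map_sub]; linarith
  · rw [hg, map_sub]; linarith [hle p]
  · rw [hg, map_sub]; linarith [hf o ho]

/-- The sectors at a vertex that are spanned by its triangles do not overlap. -/
theorem eq_zero_of_smul_add_smul_eq (h : IsInscribedConvexPolyhedron K x) {v : V} {n : ℕ}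
    {a : ℕ → V} (ha : IsLinkCycle K v n a) {p q : ℕ} (hpq : p < q) (hq : q + 1 < n)
    {α β α' β' : ℝ} (hα : 0 ≤ α) (hβ : 0 ≤ β) (hα' : 0 ≤ α') (hβ' : 0 ≤ β')
    (he : α • (x (a p) - x v) + β • (x (a (p + 1)) - x v) =
      α' • (x (a q) - x v) + β' • (x (a (q + 1)) - x v)) : β' = 0 := by
  -- scaling by `ε` moves the common point into both triangles
  set ε := (1 + α + β + α' + β')⁻¹ with hε
  have hε0 : 0 < ε := by positivity
  have hε1 : ε * (1 + α + β + α' + β') = 1 := inv_mul_cancel₀ (by positivity)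
  have h1 : 0 ≤ 1 - ε * α - ε * β := by
    have h2 := mul_nonneg hε0.le hα'
    have h3 := mul_nonneg hε0.le hβ'
    linarith
  have h1' : 0 ≤ 1 - ε * α' - ε * β' := by
    have h2 := mul_nonneg hε0.le hα
    have h3 := mul_nonneg hε0.le hβ
    linarith
  obtain ⟨ω, hω, -, -, -, hsup, hr⟩ := (ha.isTriangle p).exists_mem_space x h1
    (mul_nonneg hε0.le hα) (mul_nonneg hε0.le hβ) (by ring)
  obtain ⟨ω', hω', -, -, hβω, -, hr'⟩ := (ha.isTriangle q).exists_mem_space x h1'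
    (mul_nonneg hε0.le hα') (mul_nonneg hε0.le hβ') (by ring)
  have heq : ω = ω' := by
    refine h.boundary.injOn hω hω' ?_
    have h2 := congrArg (fun y => x v + ε • y) he
    rw [hr, hr']
    convert h2 using 1 <;> module
  have hne : ∀ {j}, j < q + 1 → a (q + 1) ≠ a j := fun {j} hj hcon =>
    hj.ne' (ha.injOn hq (hj.trans hq) hcon)
  have h0 : ω (a (q + 1)) = 0 := hsup _ (by
    simp only [Finset.mem_insert, Finset.mem_singleton, not_or]
    exact ⟨(ha.adj _).1.symm, hne (by omega), hne (by omega)⟩)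
  rw [heq, hβω] at h0
  exact (mul_eq_zero.1 h0).resolve_left hε0.ne'

/-- If the inverted link of a vertex were not convex, then some plane through the vertex would
separate its neighbours alternately, and the polyhedral cone at the vertex would have three
boundary rays in this plane. -/
theorem linksConvex (hx : IsNondegenerate K x) (h : IsInscribedConvexPolyhedron K x) :
    LinksConvex K x := by
  intro v n a ha i j k l hij hjk hkl hln
  obtain ⟨c, r, hs⟩ := h.inscribed
  obtain ⟨o, ho⟩ := h.solid
  refine segment_inter_nonempty_of_not_alternating fun L t hi hk hj hl => ?_
  -- on the sphere the affine function `L - t` of the inverted points is linear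
  set ξ := (InnerProductSpace.toDual ℝ E3).symm L - (2 * t) • (c - x v) with hξ
  have hval : ∀ m, inner ℝ ξ (linkPolygon x v a m) = L (linkPolygon x v a m) - t := by
    intro m
    have := inner_invVec_of_mem_sphere (hs v) (hs (a m)) (hx.ne_of_adj (ha.adj m)).symm
    rw [hξ, inner_sub_left, InnerProductSpace.toDual_symm_apply, inner_smul_left, conj_trivial,
      linkPolygon, mul_comm 2 t, mul_assoc, this, mul_one]
  have hsign : ∀ (ξ : E3) m, inner ℝ ξ (linkPolygon x v a m) < 0 ↔
      inner ℝ ξ (x (a m) - x v) < 0 := fun ξ m =>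
    inner_invVec_neg_iff (hx.ne_of_adj (ha.adj m)).symm ξ
  have hsign' : ∀ m, 0 < inner ℝ ξ (linkPolygon x v a m) ↔
      0 < inner ℝ ξ (x (a m) - x v) := by
    intro m
    have := hsign (-ξ) m
    rwa [inner_neg_left, inner_neg_left, neg_lt_zero, neg_lt_zero] at this
  have hi' := (hsign ξ i).1 (by rw [hval]; linarith)
  have hk' := (hsign ξ k).1 (by rw [hval]; linarith)
  have hj' := (hsign' j).1 (by rw [hval]; linarith)
  have hl' := (hsign' l).1 (by rw [hval]; linarith)
  have hξ0 : ξ ≠ 0 := by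
    intro h0
    rw [h0, inner_zero_left] at hi'
    exact lt_irrefl _ hi'
  obtain ⟨m₁, him, hmj, α₁, β₁, hα₁, hβ₁, hz₁⟩ :=
    exists_inner_smul_add_smul_eq_zero (X := fun m => x (a m) - x v) hij.le hi' hj'
  obtain ⟨m₂, hjm, hmk, α₂, β₂, hα₂, hβ₂, hz₂⟩ :=
    exists_inner_smul_add_smul_eq_zero (X := fun m => x (a m) - x v) (ξ := -ξ) hjk.le
      (by rwa [inner_neg_left, neg_lt_zero]) (by rwa [inner_neg_left, neg_pos])
  rw [inner_neg_left, neg_eq_zero] at hz₂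
  obtain ⟨m₃, hkm, hml, α₃, β₃, hα₃, hβ₃, hz₃⟩ :=
    exists_inner_smul_add_smul_eq_zero (X := fun m => x (a m) - x v) hkl.le hk' hl'
  choose g hg0 hg1 hg hgo using fun m => h.exists_supporting ho (ha.isTriangle m)
  -- a vector of the plane that points into the interior
  obtain ⟨e, he, hge⟩ : ∃ e : E3, inner ℝ ξ e = 0 ∧ ∀ m, 0 < inner ℝ (g m) e := by
    rcases lt_trichotomy (inner ℝ ξ (o - x v)) 0 with h0 | h0 | h0
    · refine ⟨(-inner ℝ ξ (o - x v)) • (x (a j) - x v) +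
        (inner ℝ ξ (x (a j) - x v) : ℝ) • (o - x v), ?_, fun m => ?_⟩
      · rw [inner_add_right, inner_smul_right, inner_smul_right]
        ring
      · rw [inner_add_right, inner_smul_right, inner_smul_right]
        exact add_pos_of_nonneg_of_pos (mul_nonneg (neg_pos.2 h0).le (hg m _))
          (mul_pos hj' (hgo m))
    · exact ⟨o - x v, h0, hgo⟩
    · refine ⟨(inner ℝ ξ (o - x v) : ℝ) • (x (a i) - x v) +
        (-inner ℝ ξ (x (a i) - x v)) • (o - x v), ?_, fun m => ?_⟩
      · rw [inner_add_right, inner_smul_right, inner_smul_right]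
        ring
      · rw [inner_add_right, inner_smul_right, inner_smul_right]
        exact add_pos_of_nonneg_of_pos (mul_nonneg h0.le (hg m _))
          (mul_pos (neg_pos.2 hi') (hgo m))
  set μ : Fin 3 → ℕ := ![m₁, m₂, m₃] with hμ
  set α : Fin 3 → ℝ := ![α₁, α₂, α₃] with hα
  set β : Fin 3 → ℝ := ![β₁, β₂, β₃] with hβ
  have hα0 : ∀ p, 0 ≤ α p := by intro p; fin_cases p; exacts [hα₁, hα₂, hα₃]
  have hβ0 : ∀ p, 0 < β p := by intro p; fin_cases p; exacts [hβ₁, hβ₂, hβ₃]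
  have hμn : ∀ p, μ p + 1 < n := by intro p; fin_cases p <;> simp [hμ] <;> omega
  have hμlt : ∀ p q, p < q → μ p < μ q := by
    intro p q
    fin_cases p <;> fin_cases q <;> simp [hμ] <;> omega
  refine false_of_three_supporting (ξ := ξ) (e := e)
    (z := fun p => α p • (x (a (μ p)) - x v) + β p • (x (a (μ p + 1)) - x v))
    (g := fun p => g (μ p)) hξ0 ?_ he (fun m => (hge _).ne') ?_ ?_ ?_ ?_
  · intro p; fin_cases p; exacts [hz₁, hz₂, hz₃]
  · intro p q
    simp only [inner_add_right, inner_smul_right]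
    exact add_nonneg (mul_nonneg (hα0 q) (hg _ _)) (mul_nonneg (hβ0 q).le (hg _ _))
  · intro p
    simp only [inner_add_right, inner_smul_right, hg0, hg1, mul_zero, add_zero]
  · intro p h0
    have := (eq_zero_of_affineIndependent ((ha.isTriangle (μ p)).affineIndependent hx) h0).2
    exact (hβ0 p).ne' this
  · intro p q hpq κ hκ heq
    rw [smul_add, smul_smul, smul_smul] at heq
    have := h.eq_zero_of_smul_add_smul_eq ha (hμlt p q hpq) (hμn q) (hα0 p) (hβ0 p).le
      (mul_nonneg hκ.le (hα0 q)) (mul_nonneg hκ.le (hβ0 q).le) heq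
    exact (mul_pos hκ (hβ0 q)).ne' this

end IsInscribedConvexPolyhedron

end Converse

end DiscreteWillmore

/-- Non-negativity of the discrete conformal energy of closed simplicial surfaces, with the case of
equality. An embedded or immersed closed surface is never contained in a plane. -/
theorem mainTheorem1 {V : Type*} [Fintype V] [DecidableEq V] (K : AbstractSimplicialComplex V)
    (hK : DiscreteWillmore.IsClosedSurface K) (x : V → EuclideanSpace ℝ (Fin 3))
    (hx : DiscreteWillmore.IsNondegenerate K x) :
    0 ≤ DiscreteWillmore.energy K x ∧
      ((DiscreteWillmore.edgeGraph K).Connected → ¬ Coplanar ℝ (Set.range x) →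
        (DiscreteWillmore.energy K x = 0 ↔
          DiscreteWillmore.IsInscribedConvexPolyhedron K x)) := by
  refine ⟨DiscreteWillmore.energy_nonneg hK hx, fun hconn hcop => ⟨fun h0 => ?_, fun h => ?_⟩⟩
  · have hX := DiscreteWillmore.linksConvex_of_energy_eq_zero hK hx h0
    obtain ⟨c, r, hF⟩ := hX.exists_isFaceted hK hx hconn hcop
    have := hconn.nonempty
    exact hF.isInscribedConvexPolyhedron hK hx hcop
  · exact DiscreteWillmore.energy_eq_zero_of_linksConvex hK hx (h.injective hK)
      (h.linksConvex hx)
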